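/- **Notation.** Write $\mathbb H$ for the upper half-plane, $\tau=x+iy\in\mathbb H$, $q=e^{2\pi i\tau}$, $e(z)=e^{2\pi i z}$, $\Gamma(a,y)=\int_y^\infty e^{-t}t^{a-1}\,dt$. Fix $m=1$ or a prime, let $k\in\mathbb Z$ and $\kappa=k+\tfrac12$, and use principal branches of square roots. Let $\Delta_\kappa=-y^2(\partial_x^2+\partial_y^2)+i\kappa y(\partial_x+i\partial_y)$. *Scalar forms.* $H_{\kappa}(\Gamma_0(4m))$ is the space of smooth $f:\mathbb H\to\mathbb C$ such that (i) $f\big(\frac{a\tau+b}{c\tau+d}\big)=\big(\frac cd\big)\varepsilon_d^{-2\kappa}(c\tau+d)^{\kappa}f(\tau)$ for all $\begin{pmatrix}a&b\\c&d\end{pmatrix}\in\Gamma_0(4m)$, where $\varepsilon_d=\big(\frac{-1}d\big)^{1/2}$ is $1$ or $i$ according as $d\equiv 1$ or $3 \bmod 4$, and $\big(\frac cd\big)$ is the Jacobi symbol, with $\big(\frac cd\big)=\operatorname{sgn}(c)\big(\frac c{|d|}\big)$ for $d<0$, $c\ne0$, and $\big(\frac0{\pm1}\big)=1$; (ii) $\Delta_\kappa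 f=0$; (iii) there is $P_f\in\mathbb C[q^{-1}]$ with $f=P_f+O(e^{-\varepsilon y})$ as $y\to\infty$ for some $\varepsilon>0$, and analogous conditions hold at all cusps. Such an $f$ has a unique decomposition $$f=\sum_{n\gg-\infty}c_f^+(n)q^n+\sum_{n<0}c_f^-(n)\,\Gamma(\tfrac12-k,4\pi|n|y)\,q^n .$$ $H^+_\kappa(\Gamma_0(4m))$ is the subspace of those $f$ with $c_f^\pm(n)=0$ unless $(-1)^kn$ is a square modulo $4m$. Put $c_f(n,y)=c_f^+(n)+c_f^-(n)\Gamma(\tfrac12-k,4\pi|n|y)$ (with $c_f^-(n)=0$ for $n\ge0$). *Vector-valued forms.* Let $L=2m\mathbb Z$ with $Q(x)=x^2/4m$, so $L'/L=\mathbb Z/2m\mathbb Z$, with standard basis $(\mathfrak e_\gamma)$ of $\mathbb C[L'/L]$. $\mathrm{Mp}_2(\mathbb Z)$ is the group of pairs $(M,\phi)$ with $M=\begin{pmatrix}a&b\\c&d\end{pmatrix}\in\mathrm{SL}_2(\mathbb Z)$ and $\phi$ holomorphic on $\mathbb H$, $\phi(\tau)^2=c\tau+d$, with product $(M,\phi)(M',\phi')=(MM',\phi(M'\tau)\phi'(\tau))$.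 The Weil representation $\rho_L$ is the representation of $\mathrm{Mp}_2(\mathbb Z)$ on $\mathbb C[L'/L]$ given on the generators $T=\big(\begin{pmatrix}1&1\\0&1\end{pmatrix},1\big)$ and $S=\big(\begin{pmatrix}0&-1\\1&0\end{pmatrix},\sqrt\tau\big)$ by $$\rho_L(T)\mathfrak e_\gamma=e\Big(\frac{\gamma^2}{4m}\Big)\mathfrak e_\gamma,\qquad \rho_L(S)\mathfrak e_\gamma=\frac{e(-1/8)}{\sqrt{2m}}\sum_{\delta}e\Big(-\frac{\gamma\delta}{2m}\Big)\mathfrak e_\delta,$$ and $\bar\rho_L$ is its dual. For $\rho=\rho_L$ (resp. $\bar\rho_L$), $H_{\kappa,\rho}$ is the space of smooth $F=\sum_\gamma F_\gamma\mathfrak e_\gamma:\mathbb H\to\mathbb C[L'/L]$ with $F(M\tau)=\phi(\tau)^{2\kappa}\rho(M,\phi)F(\tau)$ for all $(M,\phi)\in\mathrm{Mp}_2(\mathbb Z)$, $\Delta_\kappa F=0$, and $F_\gamma=P_\gamma+O(e^{-\varepsilon y})$ as $y\to\infty$ for some $\varepsilon>0$, where $P_\gamma$ is a finite linear combination of $e(n\tau)$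 with $n\le0$, $n\in\mathbb Z+\frac{\gamma^2}{4m}$ (resp. $n\in\mathbb Z-\frac{\gamma^2}{4m}$). **Theorem.** For $f\in H^+_{k+1/2}(\Gamma_0(4m))$ put $F=\sum_{\gamma\in\mathbb Z/2m\mathbb Z}F_\gamma\mathfrak e_\gamma$ with $$F_\gamma(\tau)=\frac1{s(\gamma)}\sum_{n\in\mathbb Z,\ (-1)^kn\equiv\gamma^2\bmod 4m}c_f\Big(n,\frac y{4m}\Big)q^{n/4m},$$ where $s(\gamma)=1$ if $\gamma\equiv0,m\bmod 2m$ and $s(\gamma)=2$ otherwise. (1) If $k$ is even, then $f\mapsto F$ is an isomorphism of complex vector spaces from $H^+_{k+1/2}(\Gamma_0(4m))$ onto $H_{k+1/2,\rho_L}$. (2) If $k$ is odd, then $f\mapsto F$ is an isomorphism of complex vector spaces from $H^+_{k+1/2}(\Gamma_0(4m))$ onto $H_{k+1/2,\bar\rho_L}$. In both cases the inverse map is $F\mapsto f$, $f(\tau)=\sum_{\gamma}F_\gamma(4m\tau)$. -/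

import Mathlib

open UpperHalfPlane Matrix
open scoped MatrixGroups Manifold ContDiff Topology

namespace HalfMaass

noncomputable section

/-- `e(z) = exp(2πiz)`. -/
def e (z : ℂ) : ℂ := Complex.exp (2 * Real.pi * Complex.I * z)

lemma e_add (z w : ℂ) : e (z + w) = e z * e w := by
  simp [e, mul_add, Complex.exp_add]

lemma e_ne_zero (z : ℂ) : e z ≠ 0 := Complex.exp_ne_zero _

lemma e_zero : e 0 = 1 := by simp [e]

lemma e_int (n : ℤ) : e n = 1 := by
  rw [e, Complex.exp_eq_one_iff]
  exact ⟨n, by ring⟩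

lemma e_add_int (z : ℂ) (n : ℤ) : e (z + n) = e z := by rw [e_add, e_int, mul_one]

/-! ### The integral metaplectic group -/

/-- The automorphy factor `cτ + d` of `g = (a b; c d) ∈ SL₂(ℤ)`. -/
def autFactor (g : SL(2, ℤ)) (τ : ℍ) : ℂ := (g 1 0 : ℂ) * τ + (g 1 1 : ℂ)

lemma autFactor_eq_denom (g : SL(2, ℤ)) (τ : ℍ) : autFactor g τ = denom g τ :=
  (ModularGroup.denom_apply g τ).symm

lemma autFactor_ne_zero (g : SL(2, ℤ)) (τ : ℍ) : autFactor g τ ≠ 0 := by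
  rw [autFactor_eq_denom]; exact denom_ne_zero _ _

lemma coe_smul_eq (g : SL(2, ℤ)) (τ : ℍ) :
    ((g • τ : ℍ) : ℂ) = ((g 0 0 : ℂ) * τ + (g 0 1 : ℂ)) / autFactor g τ := by
  rw [UpperHalfPlane.coe_specialLinearGroup_apply]
  simp [autFactor]

lemma autFactor_mul (g h : SL(2, ℤ)) (τ : ℍ) :
    autFactor (g * h) τ = autFactor g (h • τ) * autFactor h τ := by
  have hh := autFactor_ne_zero h τ
  rw [autFactor, autFactor, coe_smul_eq, add_mul, mul_div_assoc', div_mul_cancel₀ _ hh]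
  simp [Matrix.mul_apply, Fin.sum_univ_two, autFactor]
  ring

lemma autFactor_one (τ : ℍ) : autFactor 1 τ = 1 := by simp [autFactor]

lemma mdifferentiable_smul_SL (g : SL(2, ℤ)) :
    MDifferentiable 𝓘(ℂ) 𝓘(ℂ) (fun τ : ℍ => g • τ) := by
  have : 0 < (Matrix.GeneralLinearGroup.det (g : GL (Fin 2) ℝ)).val := by simp
  exact mdifferentiable_smul this

/-- The integral metaplectic group `Mp₂(ℤ)`: pairs `(M, φ)` of a matrix `M = (a b; c d) ∈ SL₂(ℤ)` and
a holomorphic function `φ` on the upper half-plane with `φ(τ)² = cτ + d`. -/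
@[ext]
structure Mp2Z where
  mat : SL(2, ℤ)
  phi : ℍ → ℂ
  holo : MDifferentiable 𝓘(ℂ) 𝓘(ℂ) phi
  sq : ∀ τ, phi τ ^ 2 = autFactor mat τ

namespace Mp2Z

lemma phi_ne_zero (g : Mp2Z) (τ : ℍ) : g.phi τ ≠ 0 := by
  intro h
  have := g.sq τ
  rw [h] at this
  exact autFactor_ne_zero g.mat τ (by rw [← this]; simp)

/-- `(M, φ)(M', φ') = (MM', φ(M'τ)φ'(τ))`. -/
instance : Mul Mp2Z where
  mul g h :=
    { mat := g.mat * h.mat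
      phi := fun τ => g.phi (h.mat • τ) * h.phi τ
      holo := (g.holo.comp (mdifferentiable_smul_SL h.mat)).mul h.holo
      sq := fun τ => by rw [mul_pow, g.sq, h.sq, autFactor_mul] }

instance : One Mp2Z where
  one :=
    { mat := 1
      phi := fun _ => 1
      holo := mdifferentiable_const
      sq := fun τ => by rw [autFactor_one, one_pow] }

instance : Inv Mp2Z where
  inv g :=
    { mat := g.mat⁻¹
      phi := fun τ => (g.phi (g.mat⁻¹ • τ))⁻¹
      holo := (g.holo.comp (mdifferentiable_smul_SL g.mat⁻¹)).inv fun τ => g.phi_ne_zero _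
      sq := fun τ => by
        rw [inv_pow, g.sq]
        refine inv_eq_of_mul_eq_one_right ?_
        rw [← autFactor_mul, mul_inv_cancel, autFactor_one] }

@[simp] lemma mat_mul (g h : Mp2Z) : (g * h).mat = g.mat * h.mat := rfl
@[simp] lemma phi_mul (g h : Mp2Z) (τ : ℍ) : (g * h).phi τ = g.phi (h.mat • τ) * h.phi τ := rfl
@[simp] lemma mat_one : (1 : Mp2Z).mat = 1 := rfl
@[simp] lemma phi_one (τ : ℍ) : (1 : Mp2Z).phi τ = 1 := rfl
@[simp] lemma mat_inv (g : Mp2Z) : (g⁻¹).mat = g.mat⁻¹ := rfl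
@[simp] lemma phi_inv (g : Mp2Z) (τ : ℍ) : (g⁻¹).phi τ = (g.phi (g.mat⁻¹ • τ))⁻¹ := rfl

instance : Group Mp2Z where
  mul_assoc a b c := by
    ext τ
    · simp [mul_assoc]
    · simp only [phi_mul, mat_mul, mul_smul, mul_assoc]
  one_mul a := by
    ext τ
    · simp
    · simp only [phi_mul, phi_one, one_mul]
  mul_one a := by
    ext τ
    · simp
    · simp only [phi_mul, phi_one, mat_one, one_smul, mul_one]
  inv_mul_cancel a := by
    ext τ
    · simp
    · simp only [phi_mul, phi_inv, phi_one, inv_smul_smul]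
      exact inv_mul_cancel₀ (a.phi_ne_zero τ)

/-- `T = ((1 1; 0 1), 1)`. -/
def T : Mp2Z where
  mat := ModularGroup.T
  phi := fun _ => 1
  holo := mdifferentiable_const
  sq := fun τ => by simp [autFactor, ModularGroup.T]

lemma autFactor_S (τ : ℍ) : autFactor ModularGroup.S τ = τ := by
  simp [autFactor, ModularGroup.S]

/-- `S = ((0 -1; 1 0), √τ)`, with the principal branch of the square root. -/
def S : Mp2Z where
  mat := ModularGroup.S
  phi := fun τ => (τ : ℂ) ^ (1 / 2 : ℂ)
  holo := by
    rw [UpperHalfPlane.mdifferentiable_iff]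
    refine DifferentiableOn.congr (f := fun z : ℂ => z ^ (1 / 2 : ℂ)) ?_ ?_
    · intro z hz
      refine DifferentiableAt.differentiableWithinAt ?_
      exact DifferentiableAt.cpow_const differentiableAt_id (Or.inr (ne_of_gt hz))
    · intro z hz
      simp [UpperHalfPlane.ofComplex_apply_of_im_pos hz]
  sq := fun τ => by
    rw [autFactor_S, ← Complex.cpow_nat_mul]
    simp

lemma arg_bounds (τ : ℍ) : 0 < (τ : ℂ).arg ∧ (τ : ℂ).arg < Real.pi :=
  ⟨lt_of_le_of_ne (Complex.arg_nonneg_iff.2 τ.im_pos.le) fun h =>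
      τ.im_pos.ne' (Complex.arg_eq_zero_iff.1 h.symm).2,
    Complex.arg_lt_pi_iff.2 (Or.inr τ.im_pos.ne')⟩

lemma coe_S_smul (τ : ℍ) : ((ModularGroup.S • τ : ℍ) : ℂ) = -(τ : ℂ)⁻¹ := by
  rw [coe_smul_eq, autFactor_S]
  simp [ModularGroup.S, neg_div]

lemma sqrt_S_smul (τ : ℍ) :
    ((ModularGroup.S • τ : ℍ) : ℂ) ^ (1 / 2 : ℂ) * (τ : ℂ) ^ (1 / 2 : ℂ) = Complex.I := by
  have h0 : (τ : ℂ) ≠ 0 := τ.ne_zero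
  have hx : Complex.exp (Real.pi * Complex.I - Complex.log τ) = -(τ : ℂ)⁻¹ := by
    rw [Complex.exp_sub, Complex.exp_pi_mul_I, Complex.exp_log h0, neg_div, one_div]
  have hb := arg_bounds τ
  have hl : Complex.log (-(τ : ℂ)⁻¹) = Real.pi * Complex.I - Complex.log τ := by
    rw [← hx, Complex.log_exp]
    · simp only [Complex.sub_im, Complex.mul_I_im, Complex.ofReal_re, Complex.log_im]
      linarith [Real.pi_pos]
    · simp only [Complex.sub_im, Complex.mul_I_im, Complex.ofReal_re, Complex.log_im]
      linarith
  rw [coe_S_smul, Complex.cpow_def_of_ne_zero (neg_ne_zero.2 (inv_ne_zero h0)),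
    Complex.cpow_def_of_ne_zero h0, ← Complex.exp_add, hl]
  refine Eq.trans ?_ Complex.exp_pi_div_two_mul_I
  congr 1
  ring

lemma S_pow_four_mat : (S ^ 4).mat = 1 := by
  have : (S ^ 4).mat = ModularGroup.S * ModularGroup.S * (ModularGroup.S * ModularGroup.S) := by
    rw [show (4 : ℕ) = 2 + 2 from rfl, pow_add, pow_two]; rfl
  rw [this]
  decide

lemma S_sq_phi (τ : ℍ) : (S ^ 2).phi τ = Complex.I := by
  rw [pow_two]; exact sqrt_S_smul τ

lemma S_pow_four_phi (τ : ℍ) : (S ^ 4).phi τ = -1 := by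
  rw [show (4 : ℕ) = 2 + 2 from rfl, pow_add, phi_mul, S_sq_phi, S_sq_phi, Complex.I_mul_I]

/-- The covering map `Mp₂(ℤ) → SL₂(ℤ)`. -/
def toSL : Mp2Z →* SL(2, ℤ) where
  toFun := mat
  map_one' := rfl
  map_mul' _ _ := rfl

/-- `Mp₂(ℤ)` is generated by `S` and `T`. -/
theorem closure_S_T : Subgroup.closure ({S, T} : Set Mp2Z) = ⊤ := by
  rw [eq_top_iff]
  intro g _
  set H := Subgroup.closure ({S, T} : Set Mp2Z) with hH
  have hS : S ∈ H := Subgroup.subset_closure (by simp)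
  have hmap : H.map toSL = ⊤ := by
    rw [hH, MonoidHom.map_closure, Set.image_pair]
    exact SpecialLinearGroup.SL2Z_generators
  obtain ⟨h, hh, hg⟩ : g.mat ∈ H.map toSL := by rw [hmap]; trivial
  have hm : h.mat = g.mat := hg
  have hprod : (fun τ => g.phi τ - h.phi τ) * (fun τ => g.phi τ + h.phi τ) = 0 := by
    funext τ
    have := g.sq τ
    rw [← hm, ← h.sq τ] at this
    simp only [Pi.mul_apply, Pi.zero_apply]
    linear_combination this
  rcases (UpperHalfPlane.mul_eq_zero_iff (g.holo.sub h.holo) (g.holo.add h.holo)).1 hprod with h1 | h1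
  · have : g = h := by
      ext τ
      · rw [hm]
      · exact sub_eq_zero.1 (congrFun h1 τ)
    rwa [this]
  · have : g = h * S ^ 4 := by
      ext τ
      · rw [mat_mul, S_pow_four_mat, mul_one, hm]
      · rw [phi_mul, S_pow_four_mat, S_pow_four_phi, one_smul, mul_neg_one]
        exact eq_neg_of_add_eq_zero_left (congrFun h1 τ)
    rw [this]
    exact H.mul_mem hh (H.pow_mem hS 4)

end Mp2Z

/-! ### The Weil representation of the discriminant form `(ℤ/2mℤ, γ²/4m)` -/

/-- `Q(γ) = γ²/4m`, for the representative `0 ≤ γ < 2m`; only its class modulo `ℤ` matters. -/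
def Q (m : ℕ) (γ : ZMod (2 * m)) : ℝ := (γ.val : ℝ) ^ 2 / (4 * m)

/-- `ρ_L(T) 𝔢_γ = e(Q(γ)) 𝔢_γ`, as a matrix in the standard basis. -/
def weilT (m : ℕ) : Matrix (ZMod (2 * m)) (ZMod (2 * m)) ℂ :=
  Matrix.diagonal fun γ => e (Q m γ)

/-- `ρ_L(S) 𝔢_γ = e(-1/8) / √(2m) · ∑_δ e(-(γ, δ)) 𝔢_δ`, where `(γ, δ) = γδ/2m` is the bilinear form
of `Q`, as a matrix in the standard basis (the signature is `b⁺ - b⁻ = 1`). -/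
def weilS (m : ℕ) : Matrix (ZMod (2 * m)) (ZMod (2 * m)) ℂ :=
  Matrix.of fun δ γ =>
    e (-1 / 8) / (Real.sqrt (2 * m) : ℂ) * e (-((γ.val : ℂ) * (δ.val : ℂ) / (2 * m)))

/-- The theta function `∑_{r ≡ μ (2m)} e(r² τ / 4m + r z)`. -/
def theta (m : ℕ) (μ : ZMod (2 * m)) (τ : ℍ) (z : ℂ) : ℂ :=
  e ((μ.val : ℂ) ^ 2 * τ / (4 * m) + μ.val * z) *
    jacobiTheta₂ (2 * m * z + μ.val * τ) (2 * m * τ)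

/-- The weight `1/2`, index `m` Jacobi action of `Mp₂(ℤ)` on functions of `(τ, z)`. -/
def jslash (m : ℕ) (g : Mp2Z) (f : ℍ → ℂ → ℂ) (τ : ℍ) (z : ℂ) : ℂ :=
  (g.phi τ)⁻¹ * e (-(m * (g.mat 1 0 : ℂ) * z ^ 2 / autFactor g.mat τ)) *
    f (g.mat • τ) (z / autFactor g.mat τ)

lemma jslash_one (m : ℕ) (f : ℍ → ℂ → ℂ) : jslash m 1 f = f := by
  funext τ z
  simp [jslash, autFactor_one, e_zero]

lemma jslash_mul (m : ℕ) (g h : Mp2Z) (f : ℍ → ℂ → ℂ) :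
    jslash m (g * h) f = jslash m h (jslash m g f) := by
  funext τ z
  have hg := autFactor_ne_zero g.mat (h.mat • τ)
  have hh := autFactor_ne_zero h.mat τ
  simp only [jslash, Mp2Z.mat_mul, Mp2Z.phi_mul, mul_smul, autFactor_mul, mul_inv]
  have hz : z / (autFactor g.mat (h.mat • τ) * autFactor h.mat τ) =
      z / autFactor h.mat τ / autFactor g.mat (h.mat • τ) := by
    rw [div_div, mul_comm]
  have hdet : (h.mat 0 0 : ℂ) * (h.mat 1 1 : ℂ) - (h.mat 0 1 : ℂ) * (h.mat 1 0 : ℂ) = 1 := by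
    have := h.mat.det_coe
    rw [Matrix.det_fin_two] at this
    exact_mod_cast this
  have hkey : ((g.mat * h.mat) 1 0 : ℂ) * autFactor h.mat τ =
      (h.mat 1 0 : ℂ) * (autFactor g.mat (h.mat • τ) * autFactor h.mat τ) + (g.mat 1 0 : ℂ) := by
    rw [← autFactor_mul]
    simp only [autFactor, Matrix.SpecialLinearGroup.coe_mul, Matrix.mul_apply, Fin.sum_univ_two]
    push_cast
    linear_combination (g.mat 1 0 : ℂ) * hdet
  have hexp : e (-(m * ((g.mat * h.mat) 1 0 : ℂ) * z ^ 2 /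
        (autFactor g.mat (h.mat • τ) * autFactor h.mat τ))) =
      e (-(m * (h.mat 1 0 : ℂ) * z ^ 2 / autFactor h.mat τ)) *
        e (-(m * (g.mat 1 0 : ℂ) * (z / autFactor h.mat τ) ^ 2 /
          autFactor g.mat (h.mat • τ))) := by
    rw [← e_add]
    congr 1
    field_simp
    linear_combination (-(m : ℂ) * z ^ 2) * hkey
  rw [hz, hexp]
  ring

lemma jslash_sum (m : ℕ) (g : Mp2Z) {ι : Type*} (s : Finset ι) (a : ι → ℂ)
    (f : ι → ℍ → ℂ → ℂ) (τ : ℍ) (z : ℂ) :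
    jslash m g (fun τ z => ∑ i ∈ s, a i * f i τ z) τ z =
      ∑ i ∈ s, a i * jslash m g (f i) τ z := by
  simp only [jslash, Finset.mul_sum]
  exact Finset.sum_congr rfl fun i _ => by ring

section

variable (m : ℕ) [NeZero m]

lemma m_ne_zero : (m : ℂ) ≠ 0 := Nat.cast_ne_zero.2 (NeZero.ne m)

/-- Splitting an integer into quotient and residue class modulo `2m`. -/
def residueEquiv : ZMod (2 * m) × ℤ ≃ ℤ where
  toFun p := p.1.val + (2 * m) * p.2
  invFun n := ((n : ZMod (2 * m)), n / (2 * m))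
  left_inv := by
    rintro ⟨μ, k⟩
    have h1 : (((μ.val : ℤ) + (2 * m) * k : ℤ) : ZMod (2 * m)) = μ := by
      have : ((2 * m : ℕ) : ZMod (2 * m)) = 0 := ZMod.natCast_self _
      push_cast at this ⊢
      rw [this]; simp
    have hlt : (μ.val : ℤ) < 2 * m := by exact_mod_cast μ.val_lt
    have hpos : (0 : ℤ) < 2 * m := lt_of_le_of_lt (Int.natCast_nonneg _) hlt
    have h2 : ((μ.val : ℤ) + (2 * m) * k) / (2 * m) = k := by
      rw [Int.add_mul_ediv_left _ _ hpos.ne', Int.ediv_eq_zero_of_lt (Int.natCast_nonneg _) hlt,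
        zero_add]
    exact Prod.ext h1 h2
  right_inv n := by
    have := ZMod.val_intCast (n := 2 * m) n
    push_cast at this
    simp only [this]
    exact Int.emod_add_mul_ediv n (2 * m)

lemma hasSum_of_eq {ι : Type*} {f g : ι → ℂ} {a : ℂ} (h : HasSum f a) (hfg : ∀ k, f k = g k) :
    HasSum g a := (funext hfg : f = g) ▸ h

lemma im_two_m_mul (τ : ℍ) : 0 < (2 * m * (τ : ℂ)).im := by
  have h0 : (0 : ℝ) < m := Nat.cast_pos.2 (NeZero.pos m)
  have : (2 * m * (τ : ℂ)) = ((2 * m : ℝ) : ℂ) * τ := by push_cast; ring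
  rw [this, Complex.im_ofReal_mul]
  have := τ.im_pos
  positivity

lemma theta_eq_tsum (μ : ZMod (2 * m)) (τ : ℍ) (z : ℂ) :
    HasSum (fun k : ℤ => e (((residueEquiv m (μ, k) : ℤ) : ℂ) ^ 2 * τ / (4 * m) +
      ((residueEquiv m (μ, k) : ℤ) : ℂ) * z)) (theta m μ τ z) := by
  have hm := m_ne_zero m
  have him := im_two_m_mul m τ
  have := (hasSum_jacobiTheta₂_term (2 * m * z + μ.val * τ) him).mul_left
    (e ((μ.val : ℂ) ^ 2 * τ / (4 * m) + μ.val * z))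
  refine hasSum_of_eq this fun k => ?_
  rw [jacobiTheta₂_term, e, e, ← Complex.exp_add]
  congr 1
  simp only [residueEquiv, Equiv.coe_fn_mk]
  push_cast
  field_simp
  ring

lemma theta_T (μ : ZMod (2 * m)) (τ : ℍ) (z : ℂ) :
    theta m μ (ModularGroup.T • τ) z = e (Q m μ) * theta m μ τ z := by
  have hm := m_ne_zero m
  refine (theta_eq_tsum m μ (ModularGroup.T • τ) z).unique ?_
  refine hasSum_of_eq ((theta_eq_tsum m μ τ z).mul_left (e (Q m μ))) fun k => ?_
  have hT : ((ModularGroup.T • τ : ℍ) : ℂ) = τ + 1 := by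
    rw [coe_smul_eq]; simp [autFactor, ModularGroup.T]
  rw [hT, ← e_add]
  refine (e_add_int _ (μ.val * k + m * k ^ 2)).symm.trans (congrArg e ?_)
  simp only [residueEquiv, Equiv.coe_fn_mk, Q]
  push_cast
  field_simp
  ring

lemma jacobiTheta₂_split (μ : ZMod (2 * m)) (τ : ℍ) (z : ℂ) :
    jacobiTheta₂ (z - μ.val / (2 * m)) (τ / (2 * m)) =
      ∑ ν : ZMod (2 * m), e (-((ν.val : ℂ) * μ.val / (2 * m))) * theta m ν τ z := by
  have hm := m_ne_zero m
  have him : 0 < ((τ : ℂ) / (2 * m)).im := by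
    have h0 : (0 : ℝ) < m := Nat.cast_pos.2 (NeZero.pos m)
    have : (τ : ℂ) / (2 * m) = ((1 / (2 * m) : ℝ) : ℂ) * τ := by push_cast; field_simp
    rw [this, Complex.im_ofReal_mul]
    have := τ.im_pos
    positivity
  have h1 := (residueEquiv m).hasSum_iff.2 (hasSum_jacobiTheta₂_term (z - μ.val / (2 * m)) him)
  refine (h1.prod_fiberwise (g := fun ν => e (-((ν.val : ℂ) * μ.val / (2 * m))) * theta m ν τ z)
    fun ν => ?_).unique (hasSum_fintype _)
  refine hasSum_of_eq
    ((theta_eq_tsum m ν τ z).mul_left (e (-((ν.val : ℂ) * μ.val / (2 * m))))) fun k => ?_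
  rw [← e_add]
  refine (e_add_int _ (-(μ.val * k))).symm.trans ?_
  rw [Function.comp_apply, jacobiTheta₂_term, e]
  congr 1
  simp only [residueEquiv, Equiv.coe_fn_mk]
  push_cast
  field_simp
  ring

lemma sqrt_const (τ : ℍ) :
    (τ : ℂ) ^ (1 / 2 : ℂ) * (2 * m * Complex.I / τ) ^ (1 / 2 : ℂ) =
      (Real.sqrt (2 * m) : ℂ) * e (1 / 8) := by
  have h0 : (τ : ℂ) ≠ 0 := τ.ne_zero
  have hm : (0 : ℝ) < 2 * m := by
    have : (0 : ℝ) < m := Nat.cast_pos.2 (NeZero.pos m)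
    positivity
  have hmC : (2 * m : ℂ) ≠ 0 := by exact_mod_cast hm.ne'
  set x : ℂ := (Real.log (2 * m) : ℝ) + Real.pi / 2 * Complex.I - Complex.log τ with hxdef
  have hx : Complex.exp x = 2 * m * Complex.I / τ := by
    rw [hxdef, Complex.exp_sub, Complex.exp_add, Complex.exp_pi_div_two_mul_I, Complex.exp_log h0,
      ← Complex.ofReal_exp, Real.exp_log hm]
    push_cast; rfl
  have hb := Mp2Z.arg_bounds τ
  have him : x.im = Real.pi / 2 - (τ : ℂ).arg := by
    have : (Real.pi / 2 * Complex.I : ℂ) = ((Real.pi / 2 : ℝ) : ℂ) * Complex.I := by push_cast; rfl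
    rw [hxdef, this, Complex.sub_im, Complex.add_im, Complex.ofReal_im, Complex.mul_I_im,
      Complex.ofReal_re, Complex.log_im, zero_add]
  have hl : Complex.log (2 * m * Complex.I / τ) = x := by
    rw [← hx, Complex.log_exp] <;> rw [him] <;> linarith [Real.pi_pos]
  have hs : (Real.sqrt (2 * m) : ℂ) = Complex.exp ((Real.log (2 * m) : ℝ) / 2) := by
    rw [Real.sqrt_eq_rpow, Real.rpow_def_of_pos hm, Complex.ofReal_exp]
    congr 1
    push_cast
    ring
  rw [Complex.cpow_def_of_ne_zero h0, Complex.cpow_def_of_ne_zero (by rw [← hx]; exact Complex.exp_ne_zero _),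
    ← Complex.exp_add, hl, hs, e, ← Complex.exp_add]
  congr 1
  rw [hxdef]
  ring

lemma theta_S (μ : ZMod (2 * m)) (τ : ℍ) (z : ℂ) :
    jslash m Mp2Z.S (theta m μ) τ z = ∑ ν, weilS m μ ν * theta m ν τ z := by
  have hm := m_ne_zero m
  have h0 : (τ : ℂ) ≠ 0 := τ.ne_zero
  have hsum : ∑ ν, weilS m μ ν * theta m ν τ z =
      e (-1 / 8) / (Real.sqrt (2 * m) : ℂ) *
        jacobiTheta₂ (z - μ.val / (2 * m)) (τ / (2 * m)) := by
    rw [jacobiTheta₂_split, Finset.mul_sum]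
    refine Finset.sum_congr rfl fun ν _ => ?_
    rw [weilS, Matrix.of_apply, mul_assoc]
  have hS10 : ((ModularGroup.S 1 0 : ℤ) : ℂ) = 1 := by simp [ModularGroup.S]
  have hfe := jacobiTheta₂_functional_equation
    (2 * m * (z / τ) + μ.val * -(τ : ℂ)⁻¹) (2 * m * -(τ : ℂ)⁻¹)
  have hz' : (2 * m * (z / τ) + μ.val * -(τ : ℂ)⁻¹) / (2 * m * -(τ : ℂ)⁻¹) =
      -(z - μ.val / (2 * m)) := by field_simp; ring
  have ht' : -1 / (2 * m * -(τ : ℂ)⁻¹) = τ / (2 * m) := by field_simp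
  have hI : -Complex.I * (2 * m * -(τ : ℂ)⁻¹) = 2 * m * Complex.I / τ := by field_simp
  rw [hz', ht', hI, jacobiTheta₂_neg_left] at hfe
  have hc := sqrt_const m τ
  have hc1 : (Real.sqrt (2 * m) : ℂ) ≠ 0 := by
    have : (0 : ℝ) < m := Nat.cast_pos.2 (NeZero.pos m)
    exact Complex.ofReal_ne_zero.2 (Real.sqrt_pos.2 (by positivity)).ne'
  have he : e (-1 / 8) = (e (1 / 8))⁻¹ := by
    refine eq_inv_of_mul_eq_one_left ?_
    rw [← e_add, neg_div, neg_add_cancel, e_zero]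
  rw [hsum, jslash, theta]
  simp only [Mp2Z.S, Mp2Z.autFactor_S, Mp2Z.coe_S_smul, hS10]
  have hexp : e (-(m * 1 * z ^ 2 / τ)) * (e ((μ.val : ℂ) ^ 2 * -(τ : ℂ)⁻¹ / (4 * m) + μ.val * (z / τ)) *
      Complex.exp (-Real.pi * Complex.I * (2 * m * (z / τ) + μ.val * -(τ : ℂ)⁻¹) ^ 2 /
        (2 * m * -(τ : ℂ)⁻¹))) = 1 := by
    rw [e, e, ← Complex.exp_add, ← Complex.exp_add]
    refine Eq.trans ?_ Complex.exp_zero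
    congr 1
    field_simp
    ring
  have hconst : ((τ : ℂ) ^ (1 / 2 : ℂ))⁻¹ * (1 / (2 * m * Complex.I / τ) ^ (1 / 2 : ℂ)) =
      (e (1 / 8))⁻¹ / (Real.sqrt (2 * m) : ℂ) := by
    rw [one_div ((2 * m * Complex.I / (τ : ℂ)) ^ (1 / 2 : ℂ)), ← mul_inv, hc, mul_inv,
      mul_comm, ← div_eq_mul_inv]
  rw [hfe, he, ← hconst]
  linear_combination (((τ : ℂ) ^ (1 / 2 : ℂ))⁻¹ * (1 / (2 * m * Complex.I / τ) ^ (1 / 2 : ℂ)) *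
    jacobiTheta₂ (z - μ.val / (2 * m)) (τ / (2 * m))) * hexp

/-- Translation by `1/2m` in the elliptic variable. -/
def shift : Module.End ℂ (ℂ → ℂ) where
  toFun f z := f (z + 1 / (2 * m))
  map_add' _ _ := rfl
  map_smul' _ _ := rfl

lemma theta_shift (μ : ZMod (2 * m)) (τ : ℍ) (z : ℂ) :
    theta m μ τ (z + 1 / (2 * m)) = e (μ.val / (2 * m)) * theta m μ τ z := by
  have hm := m_ne_zero m
  rw [theta, theta, ← mul_assoc, ← e_add,
    show 2 * m * (z + 1 / (2 * m)) + μ.val * (τ : ℂ) = 2 * m * z + μ.val * τ + 1 by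
      field_simp; ring, jacobiTheta₂_add_left]
  congr 2
  field_simp
  ring

lemma theta_ne_zero (μ : ZMod (2 * m)) :
    theta m μ UpperHalfPlane.I (-(μ.val * Complex.I) / (2 * m)) ≠ 0 := by
  have hm := m_ne_zero m
  rw [theta]
  refine mul_ne_zero (e_ne_zero _) ?_
  have h1 : (2 * m * (-(μ.val * Complex.I) / (2 * m)) + μ.val * (UpperHalfPlane.I : ℍ) : ℂ) = 0 := by
    rw [UpperHalfPlane.coe_I]; field_simp; ring
  rw [h1, ← jacobiTheta_eq_jacobiTheta₂]
  intro h
  have h2 := norm_jacobiTheta_sub_one_le (im_two_m_mul m UpperHalfPlane.I)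
  rw [h, zero_sub, norm_neg, norm_one] at h2
  have him : (2 * m * ((UpperHalfPlane.I : ℍ) : ℂ)).im = 2 * m := by simp
  rw [him] at h2
  have hm1 : (1 : ℝ) ≤ m := by exact_mod_cast NeZero.one_le
  have hexp : Real.exp (-Real.pi * (2 * m)) ≤ 1 / 7 := by
    rw [neg_mul, Real.exp_neg, one_div]
    refine inv_anti₀ (by norm_num) ?_
    have := Real.add_one_le_exp (Real.pi * (2 * m))
    nlinarith [Real.pi_gt_three]
  have hpos := Real.exp_pos (-Real.pi * (2 * m))
  rw [div_mul_eq_mul_div, le_div_iff₀ (by linarith)] at h2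
  linarith

lemma theta_linearIndependent :
    LinearIndependent ℂ (fun μ : ZMod (2 * m) => theta m μ UpperHalfPlane.I) := by
  refine Module.End.eigenvectors_linearIndependent' (shift m)
    (fun μ => e (μ.val / (2 * m))) ?_ _ fun μ => ⟨?_, ?_⟩
  · have : (fun μ : ZMod (2 * m) => e (μ.val / (2 * m))) = ZMod.stdAddChar := by
      funext μ
      have := ZMod.stdAddChar_coe (N := 2 * m) (μ.val : ℤ)
      rw [Int.cast_natCast, ZMod.natCast_zmod_val] at this
      rw [this, e]
      push_cast
      congr 1
      ring
    rw [this]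
    exact ZMod.injective_stdAddChar
  · rw [Module.End.mem_eigenspace_iff]
    funext z
    exact theta_shift m μ _ z
  · intro h
    exact theta_ne_zero m μ (congrFun h _)

/-- `A` describes the action of `g` on the vector of theta functions. -/
def HasTheta (g : Mp2Z) (A : Matrix (ZMod (2 * m)) (ZMod (2 * m)) ℂ) : Prop :=
  ∀ μ τ z, jslash m g (theta m μ) τ z = ∑ ν, A μ ν * theta m ν τ z

variable {m}

lemma HasTheta.unique {g : Mp2Z} {A B : Matrix (ZMod (2 * m)) (ZMod (2 * m)) ℂ}
    (hA : HasTheta m g A) (hB : HasTheta m g B) : A = B := by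
  ext μ ν
  have h := Fintype.linearIndependent_iff.1 (theta_linearIndependent m) (fun ν => A μ ν - B μ ν) ?_ ν
  · exact sub_eq_zero.1 h
  · funext z
    simp only [Finset.sum_apply, Pi.smul_apply, smul_eq_mul, sub_mul, Finset.sum_sub_distrib,
      Pi.zero_apply]
    rw [← hA μ, ← hB μ, sub_self]

lemma HasTheta.one : HasTheta m 1 1 := by
  intro μ τ z
  rw [jslash_one]
  simp [Matrix.one_apply]

lemma HasTheta.mul {g h : Mp2Z} {A B : Matrix (ZMod (2 * m)) (ZMod (2 * m)) ℂ}
    (hA : HasTheta m g A) (hB : HasTheta m h B) : HasTheta m (g * h) (A * B) := by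
  intro μ τ z
  have : jslash m g (theta m μ) = fun τ z => ∑ ν, A μ ν * theta m ν τ z := by
    funext τ z; exact hA μ τ z
  rw [jslash_mul, this, jslash_sum]
  simp only [hB _ τ z, Matrix.mul_apply, Finset.sum_mul, Finset.mul_sum]
  rw [Finset.sum_comm]
  exact Finset.sum_congr rfl fun _ _ => Finset.sum_congr rfl fun _ _ => (mul_assoc _ _ _).symm

lemma HasTheta.inv {g : Mp2Z} {A B : Matrix (ZMod (2 * m)) (ZMod (2 * m)) ℂ}
    (hA : HasTheta m g A) (hBA : B * A = 1) : HasTheta m g⁻¹ B := by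
  intro μ τ z
  have : theta m μ = jslash m g (fun τ z => ∑ ν, B μ ν * theta m ν τ z) := by
    funext τ z
    rw [jslash_sum]
    simp only [hA _ τ z, Finset.mul_sum]
    rw [Finset.sum_comm]
    simp only [← mul_assoc, ← Finset.sum_mul, ← Matrix.mul_apply, hBA]
    simp [Matrix.one_apply]
  rw [this, ← jslash_mul, mul_inv_cancel, jslash_one]

lemma HasTheta.T : HasTheta m Mp2Z.T (weilT m) := by
  intro μ τ z
  have h1 : (Mp2Z.T).mat = ModularGroup.T := rfl
  have h2 : autFactor ModularGroup.T τ = 1 := by simp [autFactor, ModularGroup.T]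
  have h3 : ((ModularGroup.T 1 0 : ℤ) : ℂ) = 0 := by simp [ModularGroup.T]
  have h4 : Mp2Z.T.phi τ = 1 := rfl
  rw [jslash, h1, h2, h3, h4, theta_T]
  simp [weilT, Matrix.diagonal_apply, e_zero]

lemma HasTheta.S : HasTheta m Mp2Z.S (weilS m) := theta_S m

lemma HasTheta.S_pow_four : HasTheta m (Mp2Z.S ^ 4) (-1) := by
  intro μ τ z
  have h3 : (((1 : SL(2, ℤ)) 1 0 : ℤ) : ℂ) = 0 := by simp
  rw [jslash, Mp2Z.S_pow_four_mat, Mp2Z.S_pow_four_phi, autFactor_one, h3]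
  simp [Matrix.one_apply, e_zero]

lemma weilS_inv : (-(weilS m) ^ 3) * weilS m = 1 := by
  have h : weilS m * weilS m * (weilS m * weilS m) = -1 := by
    refine HasTheta.unique (g := Mp2Z.S ^ 4) ?_ HasTheta.S_pow_four
    rw [show Mp2Z.S ^ 4 = Mp2Z.S * Mp2Z.S * (Mp2Z.S * Mp2Z.S) by
      rw [← pow_two, ← pow_two, ← pow_mul]]
    exact (HasTheta.S.mul HasTheta.S).mul (HasTheta.S.mul HasTheta.S)
  rw [neg_mul, ← pow_succ, show 3 + 1 = 2 + 2 from rfl, pow_add, pow_two, h, neg_neg]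

lemma weilT_inv : (Matrix.diagonal fun γ => (e (Q m γ))⁻¹) * weilT m = 1 := by
  rw [weilT, Matrix.diagonal_mul_diagonal, ← Matrix.diagonal_one]
  congr 1
  funext γ
  exact inv_mul_cancel₀ (e_ne_zero _)

lemma exists_hasTheta (g : Mp2Z) : ∃ A B : Matrix (ZMod (2 * m)) (ZMod (2 * m)) ℂ,
    HasTheta m g A ∧ B * A = 1 := by
  have hg : g ∈ Subgroup.closure ({Mp2Z.S, Mp2Z.T} : Set Mp2Z) := by
    rw [Mp2Z.closure_S_T]; trivial
  induction hg using Subgroup.closure_induction with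
  | mem x hx =>
    rcases hx with rfl | rfl
    · exact ⟨_, _, HasTheta.S, weilS_inv⟩
    · exact ⟨_, _, HasTheta.T, weilT_inv⟩
  | one => exact ⟨1, 1, HasTheta.one, one_mul 1⟩
  | mul x y _ _ hx hy =>
    obtain ⟨A, A', hA, hA'⟩ := hx
    obtain ⟨B, B', hB, hB'⟩ := hy
    refine ⟨A * B, B' * A', hA.mul hB, ?_⟩
    rw [mul_assoc, ← mul_assoc A', hA', one_mul, hB']
  | inv x _ hx =>
    obtain ⟨A, A', hA, hA'⟩ := hx
    exact ⟨A', A, hA.inv hA', mul_eq_one_comm.1 hA'⟩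

variable (m)

/-- The formulas for `S` and `T` define a representation of `Mp₂(ℤ)`. -/
theorem exists_weilRep : ∃ ρ : Mp2Z →* Matrix (ZMod (2 * m)) (ZMod (2 * m)) ℂ,
    ρ Mp2Z.T = weilT m ∧ ρ Mp2Z.S = weilS m := by
  choose A B hA hB using exists_hasTheta (m := m)
  refine ⟨⟨⟨A, (hA 1).unique HasTheta.one⟩, fun g h => (hA _).unique ((hA g).mul (hA h))⟩, ?_, ?_⟩
  · exact (hA _).unique HasTheta.T
  · exact (hA _).unique HasTheta.S

/-- The Weil representation `ρ_L` of `Mp₂(ℤ)` on `ℂ[L'/L]`, where `L = 2mℤ` with `Q(x) = x²/4m`, so that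
`L'/L = ℤ/2mℤ`; it is given by matrices in the standard basis `𝔢_γ`. It is the unique representation
with the values `weilT m` at `T` and `weilS m` at `S`. -/
def weilRep : Mp2Z →* Matrix (ZMod (2 * m)) (ZMod (2 * m)) ℂ := (exists_weilRep m).choose

lemma weilRep_T : weilRep m Mp2Z.T = weilT m := (exists_weilRep m).choose_spec.1

lemma weilRep_S : weilRep m Mp2Z.S = weilS m := (exists_weilRep m).choose_spec.2

/-- The dual representation `ρ̄_L`, in the basis dual to `𝔢_γ`: `g ↦ (ρ_L(g)⁻¹)ᵀ`. -/
def weilRepDual : Mp2Z →* Matrix (ZMod (2 * m)) (ZMod (2 * m)) ℂ where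
  toFun g := (weilRep m g⁻¹)ᵀ
  map_one' := by simp
  map_mul' g h := by rw [_root_.mul_inv_rev, map_mul, Matrix.transpose_mul]

end

/-! ### Harmonic weak Maass forms -/

/-- A function on the upper half-plane is smooth, i.e. `C^∞` in the real coordinates `x`, `y`. -/
def IsSmooth (f : ℍ → ℂ) : Prop := ContDiffOn ℝ ∞ (f ∘ ofComplex) upperHalfPlaneSet

/-- `∂/∂x`, for functions on `ℂ`. -/
def dx (g : ℂ → ℂ) (z : ℂ) : ℂ := fderiv ℝ g z 1

/-- `∂/∂y`, for functions on `ℂ`. -/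
def dy (g : ℂ → ℂ) (z : ℂ) : ℂ := fderiv ℝ g z Complex.I

/-- The hyperbolic Laplace operator of weight `κ`,
`Δ_κ = -y² (∂²/∂x² + ∂²/∂y²) + iκy (∂/∂x + i ∂/∂y)`. -/
def hypLaplacian (κ : ℝ) (f : ℍ → ℂ) (τ : ℍ) : ℂ :=
  -(τ.im : ℂ) ^ 2 * (dx (dx (f ∘ ofComplex)) τ + dy (dy (f ∘ ofComplex)) τ) +
    Complex.I * κ * τ.im * (dx (f ∘ ofComplex) τ + Complex.I * dy (f ∘ ofComplex) τ)

/-- There is a Fourier polynomial `P(τ) = ∑_r a_r e(rτ)`, with finitely many exponents `r ≤ 0`, all in `Λ`,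
such that `g(τ) = P(τ) + O(e^{-εy})` as `y → ∞` for some `ε > 0`. -/
def HasPrincipalPart (Λ : Set ℝ) (g : ℍ → ℂ) : Prop :=
  ∃ P : ℝ →₀ ℂ, (∀ r ∈ P.support, r ∈ Λ ∧ r ≤ 0) ∧ ∃ ε : ℝ, 0 < ε ∧
    (fun τ : ℍ => g τ - P.sum fun r a => a * e (r * τ)) =O[atImInfty]
      fun τ : ℍ => Real.exp (-ε * τ.im)

/-- The quadratic residue symbol `(c/d)` for odd `d`, possibly negative: the Jacobi symbol `(c/|d|)`, with
a sign `-1` if `c` and `d` are both negative; `(0/±1) = 1`. -/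
def shimuraSymbol (c d : ℤ) : ℤ :=
  if c < 0 ∧ d < 0 then -jacobiSym c d.natAbs else jacobiSym c d.natAbs

/-- `ε_d = (-1/d)^{1/2}` for odd `d`: it is `1` if `d ≡ 1 mod 4` and `i` if `d ≡ 3 mod 4`. -/
def epsilon (d : ℤ) : ℂ := if d % 4 = 1 then 1 else Complex.I

/-- Harmonic weak Maass forms of weight `k + 1/2` for `Γ₀(4m)`. -/
structure IsScalarForm (m : ℕ) (k : ℤ) (f : ℍ → ℂ) : Prop where
  smooth : IsSmooth f
  /-- `f(Mτ) = (c/d) ε_d^{-2κ} (cτ+d)^κ f(τ)` with `κ = k + 1/2`. -/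
  transform : ∀ M ∈ CongruenceSubgroup.Gamma0 (4 * m), ∀ τ : ℍ,
    f (M • τ) = (shimuraSymbol (M 1 0) (M 1 1) : ℂ) * epsilon (M 1 1) ^ (-(2 * k + 1)) *
      autFactor M τ ^ ((k : ℂ) + 1 / 2) * f τ
  harmonic : ∀ τ, hypLaplacian ((k : ℝ) + 1 / 2) f τ = 0
  /-- The growth condition at `∞`, with `P_f ∈ ℂ[q⁻¹]`. -/
  principalPart : HasPrincipalPart (Set.range fun n : ℤ => (n : ℝ)) f
  /-- The analogous condition at the cusp `σ∞`. -/
  principalPart_cusps : ∀ σ : SL(2, ℤ), HasPrincipalPart (Set.range fun r : ℚ => (r : ℝ))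
    fun τ => autFactor σ τ ^ (-((k : ℂ) + 1 / 2)) * f (σ • τ)

/-- `ℂ[L'/L]`-valued harmonic weak Maass forms of weight `k + 1/2` and type `ρ` for `Mp₂(ℤ)`, where
`L'/L = ℤ/2mℤ`. In the Fourier expansion of the component `F_γ` only the exponents in
`ℤ + q(γ)` occur. -/
structure IsVectorForm (m : ℕ) [NeZero m] (k : ℤ)
    (ρ : Mp2Z →* Matrix (ZMod (2 * m)) (ZMod (2 * m)) ℂ) (q : ZMod (2 * m) → ℝ)
    (F : ℍ → ZMod (2 * m) → ℂ) : Prop where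
  smooth : ∀ γ, IsSmooth fun τ => F τ γ
  /-- `F(Mτ) = φ(τ)^{2κ} ρ(M, φ) F(τ)` with `κ = k + 1/2`. -/
  transform : ∀ (g : Mp2Z) (τ : ℍ), F (g.mat • τ) = g.phi τ ^ (2 * k + 1) • (ρ g *ᵥ F τ)
  harmonic : ∀ γ τ, hypLaplacian ((k : ℝ) + 1 / 2) (fun τ => F τ γ) τ = 0
  principalPart : ∀ γ, HasPrincipalPart (Set.range fun n : ℤ => (n : ℝ) + q γ) fun τ => F τ γ

/-- The incomplete Gamma function `Γ(a, y) = ∫_y^∞ e^{-t} t^{a-1} dt`, for `y > 0`. -/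
def incGamma (a y : ℝ) : ℝ := ∫ t in Set.Ioi y, Real.exp (-t) * t ^ (a - 1)

/-- `c(n, y) = c⁺(n) + c⁻(n) Γ(1/2 - k, 4π|n|y)`. -/
def coeffAt (k : ℤ) (cp cm : ℤ → ℂ) (n : ℤ) (y : ℝ) : ℂ :=
  cp n + cm n * (incGamma (1 / 2 - k) (4 * Real.pi * |(n : ℝ)| * y) : ℂ)

/-- `f = f⁺ + f⁻` with `f⁺ = ∑_{n ≫ -∞} c⁺(n) qⁿ` and `f⁻ = ∑_{n < 0} c⁻(n) Γ(1/2 - k, 4π|n|y) qⁿ`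
(pointwise absolutely convergent). -/
structure IsFourierExpansion (k : ℤ) (f : ℍ → ℂ) (cp cm : ℤ → ℂ) : Prop where
  bddBelow : ∃ N : ℤ, ∀ n < N, cp n = 0
  neg : ∀ n, 0 ≤ n → cm n = 0
  hasSum : ∀ τ : ℍ, HasSum (fun n : ℤ => coeffAt k cp cm n τ.im * e (n * τ)) (f τ)

/-- `(-1)^k n` is a square modulo `4m`. -/
def PlusCondition (m : ℕ) (k n : ℤ) : Prop :=
  ∃ a : ℤ, (k.negOnePow : ℤ) * n ≡ a ^ 2 [ZMOD 4 * m]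

/-! #### Closure under linear combinations -/

lemma IsSmooth.add {f g : ℍ → ℂ} (hf : IsSmooth f) (hg : IsSmooth g) : IsSmooth (f + g) :=
  ContDiffOn.add hf hg

lemma IsSmooth.smul {f : ℍ → ℂ} (c : ℂ) (hf : IsSmooth f) : IsSmooth (c • f) :=
  ContDiffOn.const_smul c hf

lemma IsSmooth.zero : IsSmooth 0 := contDiffOn_const

lemma IsSmooth.contDiffAt {f : ℍ → ℂ} (hf : IsSmooth f) (τ : ℍ) :
    ContDiffAt ℝ ∞ (f ∘ ofComplex) τ :=
  ContDiffOn.contDiffAt hf (isOpen_upperHalfPlaneSet.mem_nhds τ.im_pos)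

lemma fderiv_apply_add {f g : ℂ → ℂ} {z : ℂ} (hf : ContDiffAt ℝ ∞ f z) (hg : ContDiffAt ℝ ∞ g z)
    (v : ℂ) : (fun w => fderiv ℝ (f + g) w v) =ᶠ[𝓝 z]
      (fun w => fderiv ℝ f w v) + fun w => fderiv ℝ g w v := by
  have h1 := (hf.of_le (m := 1) (by norm_cast)).eventually (by simp)
  have h2 := (hg.of_le (m := 1) (by norm_cast)).eventually (by simp)
  filter_upwards [h1, h2] with w hw1 hw2
  rw [fderiv_add (hw1.differentiableAt (by simp)) (hw2.differentiableAt (by simp))]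
  rfl

lemma contDiffAt_fderiv_apply {f : ℂ → ℂ} {z : ℂ} (hf : ContDiffAt ℝ ∞ f z) (v : ℂ) :
    ContDiffAt ℝ ∞ (fun w => fderiv ℝ f w v) z :=
  (hf.fderiv_right (m := ∞) (by simp)).clm_apply contDiffAt_const

lemma fderiv_fderiv_add {f g : ℂ → ℂ} {z : ℂ} (hf : ContDiffAt ℝ ∞ f z) (hg : ContDiffAt ℝ ∞ g z)
    (v : ℂ) : fderiv ℝ (fun w => fderiv ℝ (f + g) w v) z v =
      fderiv ℝ (fun w => fderiv ℝ f w v) z v + fderiv ℝ (fun w => fderiv ℝ g w v) z v := by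
  rw [(fderiv_apply_add hf hg v).fderiv_eq, fderiv_add
    ((contDiffAt_fderiv_apply hf v).differentiableAt (by simp))
    ((contDiffAt_fderiv_apply hg v).differentiableAt (by simp))]
  rfl

lemma hypLaplacian_add (κ : ℝ) {f g : ℍ → ℂ} (hf : IsSmooth f) (hg : IsSmooth g) (τ : ℍ) :
    hypLaplacian κ (f + g) τ = hypLaplacian κ f τ + hypLaplacian κ g τ := by
  have hF := hf.contDiffAt τ
  have hG := hg.contDiffAt τ
  have h1 : ∀ v, fderiv ℝ (f ∘ ofComplex + g ∘ ofComplex) τ v =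
      fderiv ℝ (f ∘ ofComplex) τ v + fderiv ℝ (g ∘ ofComplex) τ v :=
    fun v => (fderiv_apply_add hF hG v).self_of_nhds
  have h2 := fun v => fderiv_fderiv_add hF hG v
  have h0 : (f + g) ∘ ofComplex = f ∘ ofComplex + g ∘ ofComplex := rfl
  unfold hypLaplacian dx dy
  rw [h0, h1, h1, h2, h2]
  ring

lemma hypLaplacian_smul (κ : ℝ) (c : ℂ) (f : ℍ → ℂ) (τ : ℍ) :
    hypLaplacian κ (c • f) τ = c * hypLaplacian κ f τ := by
  have h1 : ∀ (g : ℂ → ℂ) (v : ℂ),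
      (fun w => fderiv ℝ (c • g) w v) = c • fun w => fderiv ℝ g w v := by
    intro g v
    funext w
    rw [fderiv_const_smul_field]
    rfl
  have h0 : (c • f) ∘ ofComplex = c • (f ∘ ofComplex) := rfl
  unfold hypLaplacian
  have hx : ∀ g : ℂ → ℂ, dx (c • g) = c • dx g := fun g => h1 g 1
  have hy : ∀ g : ℂ → ℂ, dy (c • g) = c • dy g := fun g => h1 g Complex.I
  rw [h0, hx, hy, hx, hy]
  simp only [Pi.smul_apply, smul_eq_mul]
  ring

lemma hypLaplacian_zero (κ : ℝ) (τ : ℍ) : hypLaplacian κ 0 τ = 0 := by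
  have := hypLaplacian_smul κ 0 0 τ
  rwa [zero_smul, zero_mul] at this

lemma HasPrincipalPart.zero (Λ : Set ℝ) : HasPrincipalPart Λ 0 := by
  refine ⟨0, by simp, 1, one_pos, ?_⟩
  simpa using Asymptotics.isBigO_zero _ _

lemma HasPrincipalPart.add {Λ : Set ℝ} {f g : ℍ → ℂ} (hf : HasPrincipalPart Λ f)
    (hg : HasPrincipalPart Λ g) : HasPrincipalPart Λ (f + g) := by
  obtain ⟨P, hP, ε, hε, hO⟩ := hf
  obtain ⟨P', hP', ε', hε', hO'⟩ := hg
  have key : ∀ δ η : ℝ, δ ≤ η → (fun τ : ℍ => Real.exp (-η * τ.im)) =O[atImInfty]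
      fun τ : ℍ => Real.exp (-δ * τ.im) := by
    intro δ η h
    refine Asymptotics.IsBigO.of_bound 1 (Filter.Eventually.of_forall fun τ => ?_)
    rw [Real.norm_of_nonneg (Real.exp_pos _).le, Real.norm_of_nonneg (Real.exp_pos _).le, one_mul]
    exact Real.exp_le_exp.2 (by nlinarith [τ.im_pos])
  refine ⟨P + P', fun r hr => ?_, min ε ε', lt_min hε hε', ?_⟩
  · rcases Finset.mem_union.1 (Finsupp.support_add hr) with h | h
    · exact hP r h
    · exact hP' r h
  · refine ((hO.trans (key _ _ (min_le_left _ _))).add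
      (hO'.trans (key _ _ (min_le_right _ _)))).congr_left fun τ => ?_
    rw [Finsupp.sum_add_index' (fun _ => zero_mul _) (fun _ _ _ => add_mul _ _ _), Pi.add_apply]
    ring

lemma HasPrincipalPart.smul {Λ : Set ℝ} {f : ℍ → ℂ} (c : ℂ) (hf : HasPrincipalPart Λ f) :
    HasPrincipalPart Λ (c • f) := by
  obtain ⟨P, hP, ε, hε, hO⟩ := hf
  refine ⟨c • P, fun r hr => hP r (Finsupp.support_smul hr), ε, hε, ?_⟩
  refine (hO.const_mul_left c).congr_left fun τ => ?_
  rw [Finsupp.sum_smul_index' (fun _ => zero_mul _), Pi.smul_apply, smul_eq_mul, mul_sub,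
    Finsupp.mul_sum]
  simp only [smul_eq_mul, mul_assoc]

/-- The space `H_{k+1/2}(Γ₀(4m))` of harmonic weak Maass forms. -/
def scalarForms (m : ℕ) (k : ℤ) : Submodule ℂ (ℍ → ℂ) where
  carrier := {f | IsScalarForm m k f}
  zero_mem' :=
    { smooth := IsSmooth.zero
      transform := fun M _ τ => by simp
      harmonic := hypLaplacian_zero _
      principalPart := HasPrincipalPart.zero _
      principalPart_cusps := fun σ => by simpa using! HasPrincipalPart.zero _ }
  add_mem' := fun {f g} hf hg =>
    { smooth := hf.smooth.add hg.smooth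
      transform := fun M hM τ => by
        rw [Pi.add_apply, hf.transform M hM, hg.transform M hM, Pi.add_apply]; ring
      harmonic := fun τ => by
        rw [hypLaplacian_add _ hf.smooth hg.smooth, hf.harmonic, hg.harmonic, add_zero]
      principalPart := hf.principalPart.add hg.principalPart
      principalPart_cusps := fun σ => by
        have := (hf.principalPart_cusps σ).add (hg.principalPart_cusps σ)
        convert this using 1
        funext τ
        simp [mul_add] }
  smul_mem' := fun c f hf =>
    { smooth := hf.smooth.smul c
      transform := fun M hM τ => by
        rw [Pi.smul_apply, hf.transform M hM, Pi.smul_apply, smul_eq_mul, smul_eq_mul]; ring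
      harmonic := fun τ => by rw [hypLaplacian_smul, hf.harmonic, mul_zero]
      principalPart := hf.principalPart.smul c
      principalPart_cusps := fun σ => by
        have := (hf.principalPart_cusps σ).smul c
        convert this using 1
        funext τ
        simp only [Pi.smul_apply, smul_eq_mul]
        ring }

lemma IsFourierExpansion.add {k : ℤ} {f g : ℍ → ℂ} {cp cm dp dm : ℤ → ℂ}
    (hf : IsFourierExpansion k f cp cm) (hg : IsFourierExpansion k g dp dm) :
    IsFourierExpansion k (f + g) (cp + dp) (cm + dm) where
  bddBelow := by
    obtain ⟨N, hN⟩ := hf.bddBelow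
    obtain ⟨N', hN'⟩ := hg.bddBelow
    refine ⟨min N N', fun n hn => ?_⟩
    rw [Pi.add_apply, hN n (lt_of_lt_of_le hn (min_le_left _ _)),
      hN' n (lt_of_lt_of_le hn (min_le_right _ _)), add_zero]
  neg n hn := by rw [Pi.add_apply, hf.neg n hn, hg.neg n hn, add_zero]
  hasSum τ := by
    refine hasSum_of_eq ((hf.hasSum τ).add (hg.hasSum τ)) fun n => ?_
    simp only [coeffAt, Pi.add_apply]
    ring

lemma IsFourierExpansion.smul {k : ℤ} {f : ℍ → ℂ} {cp cm : ℤ → ℂ} (c : ℂ)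
    (hf : IsFourierExpansion k f cp cm) : IsFourierExpansion k (c • f) (c • cp) (c • cm) where
  bddBelow := by
    obtain ⟨N, hN⟩ := hf.bddBelow
    exact ⟨N, fun n hn => by rw [Pi.smul_apply, hN n hn, smul_zero]⟩
  neg n hn := by rw [Pi.smul_apply, hf.neg n hn, smul_zero]
  hasSum τ := by
    refine hasSum_of_eq ((hf.hasSum τ).mul_left c) fun n => ?_
    simp only [coeffAt, Pi.smul_apply, smul_eq_mul]
    ring

/-- The plus space `H⁺_{k+1/2}(Γ₀(4m))`: the forms with `c^±(n) = 0` unless `(-1)^k n` is a square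
modulo `4m`. -/
def plusSpace (m : ℕ) (k : ℤ) : Submodule ℂ (ℍ → ℂ) where
  carrier := {f | f ∈ scalarForms m k ∧ ∃ cp cm : ℤ → ℂ, IsFourierExpansion k f cp cm ∧
    ∀ n, ¬ PlusCondition m k n → cp n = 0 ∧ cm n = 0}
  zero_mem' := ⟨zero_mem _, 0, 0,
    { bddBelow := ⟨0, fun _ _ => rfl⟩
      neg := fun _ _ => rfl
      hasSum := fun τ => hasSum_of_eq hasSum_zero fun n => by simp [coeffAt] },
    fun _ _ => ⟨rfl, rfl⟩⟩
  add_mem' := by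
    rintro f g ⟨hf, cp, cm, hc, hcs⟩ ⟨hg, dp, dm, hd, hds⟩
    refine ⟨add_mem hf hg, cp + dp, cm + dm, hc.add hd, fun n hn => ?_⟩
    simp [hcs n hn, hds n hn]
  smul_mem' := by
    rintro c f ⟨hf, cp, cm, hc, hcs⟩
    refine ⟨Submodule.smul_mem _ c hf, c • cp, c • cm, hc.smul c, fun n hn => ?_⟩
    simp [hcs n hn]

/-- The space of `ℂ[L'/L]`-valued harmonic weak Maass forms of weight `k + 1/2` and type `ρ`. -/
def vectorForms (m : ℕ) [NeZero m] (k : ℤ)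
    (ρ : Mp2Z →* Matrix (ZMod (2 * m)) (ZMod (2 * m)) ℂ) (q : ZMod (2 * m) → ℝ) :
    Submodule ℂ (ℍ → ZMod (2 * m) → ℂ) where
  carrier := {F | IsVectorForm m k ρ q F}
  zero_mem' :=
    { smooth := fun _ => IsSmooth.zero
      transform := fun g τ => by simp
      harmonic := fun _ => hypLaplacian_zero _
      principalPart := fun _ => HasPrincipalPart.zero _ }
  add_mem' := fun {F G} hF hG =>
    { smooth := fun γ => (hF.smooth γ).add (hG.smooth γ)
      transform := fun g τ => by
        rw [Pi.add_apply, hF.transform, hG.transform, Pi.add_apply, Matrix.mulVec_add, smul_add]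
      harmonic := fun γ τ => by
        have := hypLaplacian_add ((k : ℝ) + 1 / 2) (hF.smooth γ) (hG.smooth γ) τ
        rw [hF.harmonic, hG.harmonic, add_zero] at this
        exact this
      principalPart := fun γ => (hF.principalPart γ).add (hG.principalPart γ) }
  smul_mem' := fun c F hF =>
    { smooth := fun γ => (hF.smooth γ).smul c
      transform := fun g τ => by
        rw [Pi.smul_apply, hF.transform, Pi.smul_apply, Matrix.mulVec_smul, smul_comm]
      harmonic := fun γ τ => by
        have := hypLaplacian_smul ((k : ℝ) + 1 / 2) c (fun τ => F τ γ) τ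
        rw [hF.harmonic, mul_zero] at this
        exact this
      principalPart := fun γ => (hF.principalPart γ).smul c }

/-- `H_{k+1/2, ρ_L}`. -/
def weilForms (m : ℕ) [NeZero m] (k : ℤ) : Submodule ℂ (ℍ → ZMod (2 * m) → ℂ) :=
  vectorForms m k (weilRep m) fun γ => Q m γ

/-- `H_{k+1/2, ρ̄_L}`; here `T` acts on `𝔢_γ` by `e(-Q(γ))`. -/
def dualWeilForms (m : ℕ) [NeZero m] (k : ℤ) : Submodule ℂ (ℍ → ZMod (2 * m) → ℂ) :=
  vectorForms m k (weilRepDual m) fun γ => -Q m γ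

/-! ### The two maps -/

/-- `s(γ) = 1` if `γ ≡ 0, m mod 2m`, and `2` otherwise. -/
def sFactor (m : ℕ) (γ : ZMod (2 * m)) : ℂ := if γ = 0 ∨ γ = (m : ZMod (2 * m)) then 1 else 2

/-- `F_γ(τ) = s(γ)⁻¹ ∑_{(-1)^k n ≡ γ² mod 4m} c(n, y/4m) q^{n/4m}`. -/
def lift (m : ℕ) (k : ℤ) (cp cm : ℤ → ℂ) (τ : ℍ) (γ : ZMod (2 * m)) : ℂ :=
  1 / sFactor m γ *
    ∑' n : {n : ℤ // (k.negOnePow : ℤ) * n ≡ (γ.val : ℤ) ^ 2 [ZMOD 4 * m]},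
      coeffAt k cp cm n (τ.im / (4 * m)) * e ((n : ℤ) / (4 * m) * τ)

/-- The point `4mτ`. -/
def scale (m : ℕ) [NeZero m] (τ : ℍ) : ℍ :=
  ⟨4 * m * τ, by
    have h0 : (0 : ℝ) < m := Nat.cast_pos.2 (NeZero.pos m)
    have : (4 * m * (τ : ℂ)) = ((4 * m : ℝ) : ℂ) * τ := by push_cast; ring
    rw [this, Complex.im_ofReal_mul]
    have := τ.im_pos
    positivity⟩

end

end HalfMaass

namespace HalfMaass

noncomputable section

open scoped NumberTheorySymbols

/-! ### The multiplier of the theta function -/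

/-! Orthogonality of characters rewrites `f ↦ F` as the operator `avg`, a weighted sum of the
translates f((τ + j)/4m) (`avg_eq_lift`). In this form the map is linear, does not involve the
coefficients of f, and respects Δ_κ and principal parts. Since m is 1 or prime, two classes modulo
2m with the same square modulo 4m agree up to sign (`sqMod_eq_sqMod_iff`), so each admissible n
belongs to exactly s(γ) classes. Hence the sum of the components at 4mτ returns f (`sum_avg_scale`).
Conversely a vector-valued form is even in γ, by the action of S², and `avg` recovers it from the
sum of its components (`IsVectorForm.avg_descend`). What remains is that each map lands in the right
space.

The bridge between the two transformation laws is the column sum of the Weil representation. The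
theta functions realise ρ_L, and their sum is the classical theta series in a rescaled variable. By
its transformation law under Γ₀(4) (`thetaLaw`), every column of ρ_L(M') with M' ∈ Γ⁰(4m) has sum
(c/d) ε_d⁻¹ (`sum_weilRep_principal`). For odd k the dual representation is the complex conjugate,
by unitarity, and the sums are conjugated. This gives the transformation law of f from that of F at
once.

For the other direction the T-invariance of F is visible on exponents, and the point is E = F|S - F
= 0. If ab ≡ 1 mod 4m, then T^a S T^b lies in Γ⁰(4m), so modularity of the sum of the components
yields ∑ e(∓bQ(γ)) E_γ = 0 for all units b (`sum_vslash_S_sub`). Collecting E by squares gives a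
function on ℤ/4mℤ that is supported on squares and whose Fourier transform vanishes on units; such a
function has period 2m (`periodic_of_dft_units`). For odd m this forces E = 0, since adding 2m turns
squares into nonsquares. For m = 2 one degree of freedom survives, and the relation TSTST = S
removes it (`vslash_S_eq_self`).

Analysis is needed because the sum of the components must be shown to have a Fourier expansion of
the prescribed shape. The n-th coefficient of (∂/∂x + i∂/∂y)f satisfies a first order equation in y,
so that of f is a constant plus an incomplete Gamma term, once growth excludes the increasing
solution (`exists_coeff`). Smoothness makes the series converge (`hasSum_coef`). Cusps are treated
by writing diag(4m, 1)g as an integral unimodular matrix times an upper triangular one. -/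

lemma jacobiSym_eq_of_add_eq {a b₁ b₂ : ℕ} (h₁ : Odd b₁) (h₂ : Odd b₂) (h : b₁ + b₂ = 4 * a) :
    J(a | b₁) = J(a | b₂) := by
  have key : ∀ {x y : ℕ}, Odd x → x + y = 4 * a → J(a | x) = J(y | x) := by
    intro x y hx hxy
    have h4 := jacobiSym.div_four_left (a := ((4 * a : ℕ) : ℤ)) (b := x) (by push_cast; omega)
      (Nat.odd_iff.1 hx)
    have h5 : (((4 * a : ℕ) : ℤ) / 4) = a := by push_cast; omega
    rw [h5] at h4
    rw [h4, ← hxy]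
    refine jacobiSym.mod_left' ?_
    push_cast
    simp
  -- The symbols become (b₂/b₁) and (b₁/b₂). As the sum is divisible by 4, exactly one of the two
  -- odd numbers is 1 modulo 4, and reciprocity carries no sign.
  rw [key h₁ h, key h₂ ((add_comm _ _).trans h)]
  rcases Nat.odd_mod_four_iff.1 (Nat.odd_iff.1 h₁) with h' | h'
  · exact jacobiSym.quadratic_reciprocity_one_mod_four' h₂ h'
  · exact (jacobiSym.quadratic_reciprocity_one_mod_four' h₁ (a := b₁) (b := b₂) (by omega)).symm

lemma jacobiSym_eq_of_eq_add {a b₁ b₂ : ℕ} (h₁ : Odd b₁) (h : b₂ = b₁ + 4 * a) :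
    J(a | b₁) = J(a | b₂) := by
  have h₂ : Odd b₂ := by rw [h, Nat.odd_iff]; have := Nat.odd_iff.1 h₁; omega
  rw [jacobiSym.mod_right' a h₁, jacobiSym.mod_right' a h₂, h, Nat.add_mod_right]

lemma jacobiSym_four_mul (a : ℤ) {b : ℕ} (hb : Odd b) : J(4 * a | b) = J(a | b) := by
  rw [jacobiSym.mul_left, jacobiSym.at_four hb, one_mul]

lemma jacobiSym_neg_four_mul (a : ℤ) {b : ℕ} (hb : Odd b) :
    J(-(4 * a) | b) = ZMod.χ₄ b * J(a | b) := by
  rw [jacobiSym.neg _ hb, jacobiSym_four_mul a hb]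

/-- Write c = ±4a with a ≥ 0. The symbol (a/b) has period 4a in b and is unchanged by b ↦ 4a - b.
For negative c a factor χ₄ enters; its change of sign is compensated by the convention for two
negative arguments. -/
lemma shimuraSymbol_add_right {c d : ℤ} (hc : 4 ∣ c) (hd : Odd d) :
    shimuraSymbol c (c + d) = shimuraSymbol c d := by
  obtain ⟨c', rfl⟩ := hc
  have hd2 := Int.odd_iff.1 hd
  have o₁ : Odd d.natAbs := by rw [Nat.odd_iff]; omega
  have o₂ : Odd (4 * c' + d).natAbs := by rw [Nat.odd_iff]; omega
  unfold shimuraSymbol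
  rcases le_or_gt 0 c' with h | h
  · obtain ⟨a, rfl⟩ := Int.eq_ofNat_of_zero_le h
    rw [if_neg (by omega), if_neg (by omega), jacobiSym_four_mul _ o₁, jacobiSym_four_mul _ o₂]
    rcases le_or_gt 0 d with hd0 | hd0
    · exact (jacobiSym_eq_of_eq_add o₁ (by omega)).symm
    · rcases le_or_gt 0 (4 * (a : ℤ) + d) with h0 | h0
      · exact jacobiSym_eq_of_add_eq o₂ o₁ (by omega)
      · exact jacobiSym_eq_of_eq_add o₂ (by omega)
  · obtain ⟨a, ha⟩ := Int.eq_ofNat_of_zero_le (by omega : 0 ≤ -c')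
    have hc : 4 * c' = -(4 * (a : ℤ)) := by omega
    rw [hc] at o₂ ⊢
    rw [jacobiSym_neg_four_mul _ o₁, jacobiSym_neg_four_mul _ o₂]
    have chi_flip : ∀ {x y : ℕ}, Odd x → Odd y → (x + y) % 4 = 0 →
        ZMod.χ₄ x = - ZMod.χ₄ y := by
      intro x y hx hy hxy
      rw [ZMod.χ₄_nat_mod_four x, ZMod.χ₄_nat_mod_four y]
      have hx := Nat.odd_iff.1 hx
      rcases (by omega : x % 4 = 1 ∧ y % 4 = 3 ∨ x % 4 = 3 ∧ y % 4 = 1) with ⟨h1, h2⟩ | ⟨h1, h2⟩ <;>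
      · rw [h1, h2]; decide
    have chi_same : ∀ {x y : ℕ}, x % 4 = y % 4 → ZMod.χ₄ x = ZMod.χ₄ y := by
      intro x y hxy
      rw [ZMod.χ₄_nat_mod_four x, ZMod.χ₄_nat_mod_four y, hxy]
    rcases le_or_gt 0 d with hd0 | hd0
    · rw [if_neg (c := _ ∧ d < 0) (by omega)]
      rcases le_or_gt 0 (-(4 * (a : ℤ)) + d) with h0 | h0
      · rw [if_neg (by omega), jacobiSym_eq_of_eq_add o₂ (b₂ := d.natAbs) (a := a) (by omega),
          chi_same (y := d.natAbs) (by omega)]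
      · rw [if_pos (by omega), jacobiSym_eq_of_add_eq o₂ o₁ (a := a) (by omega),
          chi_flip o₂ o₁ (by omega)]
        ring
    · rw [if_pos (by omega), if_pos (by omega),
        jacobiSym_eq_of_eq_add o₁ (b₂ := (-(4 * (a : ℤ)) + d).natAbs) (a := a) (by omega),
        chi_same (y := d.natAbs) (by omega)]

/-- The Jacobi symbol sees only c modulo d; the sign convention acts when d < 0 and the upper entry
passes from nonnegative to negative. The same sign comes out of the square root in
`csqrt_mul_of_im_pos`. -/
lemma shimuraSymbol_add_left {c d : ℤ} :
    shimuraSymbol (c + 4 * d) d =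
      if 0 ≤ c ∧ c + 4 * d < 0 then -shimuraSymbol c d else shimuraSymbol c d := by
  have h : J(c + 4 * d | d.natAbs) = J(c | d.natAbs) := by
    refine jacobiSym.mod_left' ?_
    exact (Int.modEq_iff_dvd (a := c) (b := c + 4 * d).2 (Int.natAbs_dvd.2 ⟨4, by ring⟩)).symm
  unfold shimuraSymbol
  rw [h]
  split_ifs <;> omega

/-! ### Branches of the square root and the theta law on Γ₀(4) -/

lemma csqrt_mul {v w : ℂ} (hv : v ≠ 0) (hw : w ≠ 0) (h : v.arg + w.arg ∈ Set.Ioc (-Real.pi) Real.pi) :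
    (v * w) ^ (1 / 2 : ℂ) = v ^ (1 / 2 : ℂ) * w ^ (1 / 2 : ℂ) := by
  rw [Complex.cpow_def_of_ne_zero (mul_ne_zero hv hw), Complex.cpow_def_of_ne_zero hv,
    Complex.cpow_def_of_ne_zero hw, (Complex.log_mul_eq_add_log_iff hv hw).2 h, add_mul, Complex.exp_add]

/-- Since arg w ∈ (0, π), the sum of the arguments can leave (-π, π] only by exceeding π; the
logarithm of the product then drops by 2πi and the root changes sign. The overflow is expressed
through imaginary parts so that it can be compared with the signs of matrix entries. -/
lemma csqrt_mul_of_im_pos {v w : ℂ} (hv : v ≠ 0) (hw : 0 < w.im) :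
    (v * w) ^ (1 / 2 : ℂ) = (if 0 ≤ v.im ∧ (v * w).im < 0 then -1 else 1) *
      (v ^ (1 / 2 : ℂ) * w ^ (1 / 2 : ℂ)) := by
  have hw0 : w ≠ 0 := fun h => by simp [h] at hw
  have hb : 0 < w.arg ∧ w.arg < Real.pi := Mp2Z.arg_bounds ⟨w, hw⟩
  have hv1 := Complex.neg_pi_lt_arg v
  have hv2 := Complex.arg_le_pi v
  rcases le_or_gt (v.arg + w.arg) Real.pi with hs | hs
  · rw [if_neg, one_mul, csqrt_mul hv hw0 ⟨by linarith, hs⟩]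
    rintro ⟨h1, h2⟩
    have h3 := (Complex.arg_mul_eq_add_arg_iff hv hw0).2 ⟨by linarith, hs⟩
    have h4 := Complex.arg_neg_iff.2 h2
    have h5 := Complex.arg_nonneg_iff.2 h1
    linarith
  · have h0 : 0 ≤ v.im := by
      by_contra! h
      have := Complex.arg_neg_iff.2 h
      linarith
    have hl : Complex.log (v * w) = Complex.log v + Complex.log w - 2 * Real.pi * Complex.I := by
      have him : (Complex.log v + Complex.log w - 2 * Real.pi * Complex.I).im =
          v.arg + w.arg - 2 * Real.pi := by
        simp [Complex.log_im]
      have : v * w = Complex.exp (Complex.log v + Complex.log w - 2 * Real.pi * Complex.I) := by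
        rw [Complex.exp_sub, Complex.exp_two_pi_mul_I, div_one, Complex.exp_add, Complex.exp_log hv,
          Complex.exp_log hw0]
      rw [this, Complex.log_exp] <;> rw [him] <;> linarith [Real.pi_pos]
    have ha : (v * w).arg < 0 := by
      rw [← Complex.log_im, hl]
      simp [Complex.log_im]
      linarith
    rw [if_pos ⟨h0, Complex.arg_neg_iff.1 ha⟩, Complex.cpow_def_of_ne_zero (mul_ne_zero hv hw0),
      Complex.cpow_def_of_ne_zero hv, Complex.cpow_def_of_ne_zero hw0, hl, ← Complex.exp_add,
      ← Complex.exp_pi_mul_I, ← Complex.exp_add, Complex.exp_eq_exp_iff_exists_int]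
    exact ⟨-1, by push_cast; ring⟩

/-- The multiplier `(c/d) ε_d⁻¹` of the theta function. -/
def thetaMult (c d : ℤ) : ℂ := (shimuraSymbol c d : ℂ) * (epsilon d)⁻¹

/-- The transformation law of `∑_n e(n²τ + nz)` under `M ∈ Γ₀(4)`. -/
def ThetaLaw (M : SL(2, ℤ)) : Prop := ∀ (τ : ℍ) (z : ℂ),
  jacobiTheta₂ (z / autFactor M τ) (2 * (M • τ : ℍ)) =
    thetaMult (M 1 0) (M 1 1) * autFactor M τ ^ (1 / 2 : ℂ) *
      e ((M 1 0 : ℂ) * z ^ 2 / (4 * autFactor M τ)) * jacobiTheta₂ z (2 * τ)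

/-- The matrix `(1 0; 4 1)`. -/
def lowerFour : SL(2, ℤ) := ⟨!![1, 0; 4, 1], by simp [Matrix.det_fin_two]⟩

lemma coe_T_smul (τ : ℍ) : ((ModularGroup.T • τ : ℍ) : ℂ) = τ + 1 := by
  rw [coe_smul_eq]; simp [autFactor, ModularGroup.T]

lemma autFactor_T (τ : ℍ) : autFactor ModularGroup.T τ = 1 := by
  simp [autFactor, ModularGroup.T]

lemma autFactor_lowerFour (τ : ℍ) : autFactor lowerFour τ = 4 * τ + 1 := by
  simp [autFactor, lowerFour]

lemma mul_T_row (M : SL(2, ℤ)) :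
    (M * ModularGroup.T) 1 0 = M 1 0 ∧ (M * ModularGroup.T) 1 1 = M 1 0 + M 1 1 := by
  simp only [Matrix.SpecialLinearGroup.coe_mul, Matrix.mul_apply, Fin.sum_univ_two]
  simp [ModularGroup.T]

lemma mul_lowerFour_row (M : SL(2, ℤ)) :
    (M * lowerFour) 1 0 = M 1 0 + 4 * M 1 1 ∧ (M * lowerFour) 1 1 = M 1 1 := by
  simp only [Matrix.SpecialLinearGroup.coe_mul, Matrix.mul_apply, Fin.sum_univ_two]
  simp [lowerFour, mul_comm]

lemma odd_of_four_dvd {M : SL(2, ℤ)} (h : 4 ∣ M 1 0) : Odd (M 1 1) := by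
  have hdet := M.det_coe
  rw [Matrix.det_fin_two] at hdet
  by_contra ho
  rw [Int.not_odd_iff_even] at ho
  obtain ⟨x, hx⟩ := h
  obtain ⟨y, hy⟩ := ho
  rw [hx, hy] at hdet
  have : (2 : ℤ) ∣ 1 := ⟨M 0 0 * y - M 0 1 * (2 * x), by linear_combination -hdet⟩
  omega

lemma thetaMult_add_right {c d : ℤ} (hc : 4 ∣ c) (hd : Odd d) :
    thetaMult c (c + d) = thetaMult c d := by
  rw [thetaMult, thetaMult, shimuraSymbol_add_right hc hd, epsilon, epsilon,
    show (c + d) % 4 = d % 4 by omega]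

/-- Both the theta series at 2τ and the multiplier are invariant under this step. An equivalence,
not just an implication, is needed to pass to negative powers. -/
lemma thetaLaw_mul_T {M : SL(2, ℤ)} (h : 4 ∣ M 1 0) :
    ThetaLaw (M * ModularGroup.T) ↔ ThetaLaw M := by
  have key : ∀ τ z, (jacobiTheta₂ (z / autFactor (M * ModularGroup.T) τ)
      (2 * ((M * ModularGroup.T) • τ : ℍ)) =
      thetaMult ((M * ModularGroup.T) 1 0) ((M * ModularGroup.T) 1 1) *
        autFactor (M * ModularGroup.T) τ ^ (1 / 2 : ℂ) *
      e (((M * ModularGroup.T) 1 0 : ℂ) * z ^ 2 / (4 * autFactor (M * ModularGroup.T) τ)) *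
        jacobiTheta₂ z (2 * τ)) ↔
      (jacobiTheta₂ (z / autFactor M (ModularGroup.T • τ)) (2 * (M • (ModularGroup.T • τ) : ℍ)) =
    thetaMult (M 1 0) (M 1 1) * autFactor M (ModularGroup.T • τ) ^ (1 / 2 : ℂ) *
      e ((M 1 0 : ℂ) * z ^ 2 / (4 * autFactor M (ModularGroup.T • τ))) *
        jacobiTheta₂ z (2 * (ModularGroup.T • τ : ℍ))) := by
    intro τ z
    rw [(mul_T_row M).1, (mul_T_row M).2, thetaMult_add_right h (odd_of_four_dvd h), autFactor_mul,
      autFactor_T, mul_one, mul_smul, coe_T_smul, mul_add, mul_one, jacobiTheta₂_add_right]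
  constructor
  · intro hM τ z
    have := (key (ModularGroup.T⁻¹ • τ) z).1 (hM _ z)
    rwa [smul_inv_smul] at this
  · exact fun hM τ z => (key τ z).2 (hM _ z)

lemma coe_lowerFour_smul (τ : ℍ) : ((lowerFour • τ : ℍ) : ℂ) = τ / (4 * τ + 1) := by
  rw [coe_smul_eq, autFactor_lowerFour]; simp [lowerFour]

lemma four_mul_add_one_ne_zero (τ : ℍ) : (4 * τ + 1 : ℂ) ≠ 0 := by
  rw [← autFactor_lowerFour]; exact autFactor_ne_zero _ _

lemma coe_lowerFour_smul_mul (τ : ℍ) : ((lowerFour • τ : ℍ) : ℂ) * (4 * τ + 1) = τ := by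
  rw [coe_lowerFour_smul, div_mul_cancel₀ _ (four_mul_add_one_ne_zero τ)]

/-- For σ ∈ ℍ the number -2iσ lies in the right half-plane, so the arguments of one such number and
of the inverse of another add up to less than π in absolute value, and no sign occurs. -/
lemma csqrt_neg_two_I (τ : ℍ) : (-Complex.I * (2 * τ)) ^ (1 / 2 : ℂ) =
    (-Complex.I * (2 * (lowerFour • τ : ℍ))) ^ (1 / 2 : ℂ) * (4 * τ + 1 : ℂ) ^ (1 / 2 : ℂ) := by
  have key : ∀ σ : ℍ, -Complex.I * (2 * σ) ≠ 0 ∧ |(-Complex.I * (2 * σ) : ℂ).arg| < Real.pi / 2 := by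
    intro σ
    refine ⟨by simp [σ.ne_zero], Complex.abs_arg_lt_pi_div_two_iff.2 (Or.inl ?_)⟩
    simp [σ.im_pos]
  obtain ⟨h1, h2⟩ := key τ
  obtain ⟨h3, h4⟩ := key (lowerFour • τ)
  set v := (-Complex.I * (2 * (lowerFour • τ : ℍ)) : ℂ)
  set u := (-Complex.I * (2 * τ) : ℂ)
  have hw := four_mul_add_one_ne_zero τ
  have huv : u = v * (4 * τ + 1) := by
    simp only [u, v]
    linear_combination 2 * Complex.I * coe_lowerFour_smul_mul τ
  have h4' : |(v⁻¹).arg| < Real.pi / 2 := by rwa [Complex.abs_arg_inv]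
  have hvi : (v⁻¹) ^ (1 / 2 : ℂ) * v ^ (1 / 2 : ℂ) = 1 := by
    rw [Complex.inv_cpow, inv_mul_cancel₀ (by simp [Complex.cpow_eq_zero_iff, h3])]
    intro h
    rw [h] at h4
    rw [abs_of_pos Real.pi_pos] at h4
    linarith [Real.pi_pos]
  have hw' : (4 * τ + 1 : ℂ) = u * v⁻¹ := by rw [huv]; field_simp
  rw [abs_lt] at h2 h4'
  rw [hw', csqrt_mul h1 (inv_ne_zero h3) ⟨by linarith [h2.1, h4'.1], by linarith [h2.2, h4'.2]⟩,
    mul_left_comm, mul_comm (v ^ (1 / 2 : ℂ)), hvi, mul_one]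

/-- Inversion is applied on both sides: with V = `lowerFour` one has -1/(2Vτ) = -1/(2τ) - 2, and
theta has period 2 in its second argument. -/
lemma jacobiTheta₂_lowerFour (τ : ℍ) (z : ℂ) :
    jacobiTheta₂ (z / (4 * τ + 1)) (2 * (lowerFour • τ : ℍ)) =
      (4 * τ + 1 : ℂ) ^ (1 / 2 : ℂ) * e (z ^ 2 / (4 * τ + 1)) * jacobiTheta₂ z (2 * τ) := by
  have hw := four_mul_add_one_ne_zero τ
  have h0 : (τ : ℂ) ≠ 0 := τ.ne_zero
  have hv := csqrt_neg_two_I τ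
  have hv0 : (-Complex.I * (2 * (lowerFour • τ : ℍ)) : ℂ) ^ (1 / 2 : ℂ) ≠ 0 := by
    have := (lowerFour • τ).ne_zero
    generalize ((lowerFour • τ : ℍ) : ℂ) = σ at this
    simp [Complex.cpow_eq_zero_iff, this]
  have hu0 : (-Complex.I * (2 * τ) : ℂ) ^ (1 / 2 : ℂ) ≠ 0 := by
    simp [Complex.cpow_eq_zero_iff, h0]
  rw [jacobiTheta₂_functional_equation, jacobiTheta₂_functional_equation z]
  have h1 : z / (4 * τ + 1) / (2 * (lowerFour • τ : ℍ)) = z / (2 * τ) := by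
    rw [coe_lowerFour_smul]; field_simp
  have h2 : jacobiTheta₂ (z / (2 * τ)) (-1 / (2 * (lowerFour • τ : ℍ))) =
      jacobiTheta₂ (z / (2 * τ)) (-1 / (2 * τ)) := by
    rw [← jacobiTheta₂_add_right]
    congr 1
    rw [coe_lowerFour_smul]; field_simp; ring
  have h3 : Complex.exp (-Real.pi * Complex.I * (z / (4 * τ + 1)) ^ 2 / (2 * (lowerFour • τ : ℍ))) =
      e (z ^ 2 / (4 * τ + 1)) * Complex.exp (-Real.pi * Complex.I * z ^ 2 / (2 * τ)) := by
    rw [e, ← Complex.exp_add]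
    congr 1
    rw [coe_lowerFour_smul]; field_simp; ring
  have hw2 : (4 * τ + 1 : ℂ) ^ (1 / 2 : ℂ) ≠ 0 := by simp [Complex.cpow_eq_zero_iff, hw]
  rw [h1, h2, h3, hv]
  generalize (4 * τ + 1 : ℂ) ^ (1 / 2 : ℂ) = x at *
  generalize (-Complex.I * (2 * (lowerFour • τ : ℍ)) : ℂ) ^ (1 / 2 : ℂ) = y at *
  field_simp

/-- The product (c·Vτ + d)(4τ + 1) = (c + 4d)τ + d may cross the branch cut of the root. It does so
exactly when the symbol (c/d) changes sign, so the two signs cancel. -/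
lemma thetaLaw_mul_lowerFour {M : SL(2, ℤ)} :
    ThetaLaw (M * lowerFour) ↔ ThetaLaw M := by
  have key : ∀ τ z, (jacobiTheta₂ (z / autFactor (M * lowerFour) τ)
      (2 * ((M * lowerFour) • τ : ℍ)) =
      thetaMult ((M * lowerFour) 1 0) ((M * lowerFour) 1 1) *
        autFactor (M * lowerFour) τ ^ (1 / 2 : ℂ) *
      e (((M * lowerFour) 1 0 : ℂ) * z ^ 2 / (4 * autFactor (M * lowerFour) τ)) *
        jacobiTheta₂ z (2 * τ)) ↔
      (jacobiTheta₂ (z / (4 * τ + 1) / autFactor M (lowerFour • τ)) (2 * (M • (lowerFour • τ) : ℍ)) =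
    thetaMult (M 1 0) (M 1 1) * autFactor M (lowerFour • τ) ^ (1 / 2 : ℂ) *
      e ((M 1 0 : ℂ) * (z / (4 * τ + 1)) ^ 2 / (4 * autFactor M (lowerFour • τ))) *
        jacobiTheta₂ (z / (4 * τ + 1)) (2 * (lowerFour • τ : ℍ))) := by
    intro τ z
    have hw := four_mul_add_one_ne_zero τ
    have hv := autFactor_ne_zero M (lowerFour • τ)
    have hvw : autFactor M (lowerFour • τ) * (4 * τ + 1) = (M 1 0 + 4 * M 1 1) * τ + M 1 1 := by
      rw [autFactor]
      linear_combination (M 1 0 : ℂ) * coe_lowerFour_smul_mul τ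
    have him1 : (autFactor M (lowerFour • τ)).im = M 1 0 * (lowerFour • τ).im := by
      simp [autFactor]
    have him2 : (autFactor M (lowerFour • τ) * (4 * τ + 1)).im = (M 1 0 + 4 * M 1 1 : ℤ) * τ.im := by
      rw [hvw]; simp
    have hsq := csqrt_mul_of_im_pos (w := 4 * τ + 1) hv (by simp [τ.im_pos])
    have hiff : (0 ≤ (autFactor M (lowerFour • τ)).im ∧
        (autFactor M (lowerFour • τ) * (4 * τ + 1)).im < 0) ↔ (0 ≤ M 1 0 ∧ M 1 0 + 4 * M 1 1 < 0) := by
      rw [him1, him2]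
      refine and_congr ?_ ?_
      · rw [mul_nonneg_iff_of_pos_right (lowerFour • τ).im_pos]; exact Int.cast_nonneg_iff
      · rw [← not_le, ← not_le, mul_nonneg_iff_of_pos_right τ.im_pos, Int.cast_nonneg_iff]
    have hmult : thetaMult (M 1 0 + 4 * M 1 1) (M 1 1) =
        (if 0 ≤ M 1 0 ∧ M 1 0 + 4 * M 1 1 < 0 then -1 else 1) * thetaMult (M 1 0) (M 1 1) := by
      rw [thetaMult, thetaMult, shimuraSymbol_add_left]
      split_ifs <;> push_cast <;> ring
    have hexp : e ((M 1 0 : ℂ) * (z / (4 * τ + 1)) ^ 2 / (4 * autFactor M (lowerFour • τ))) *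
        e (z ^ 2 / (4 * τ + 1)) =
        e ((M 1 0 + 4 * M 1 1 : ℂ) * z ^ 2 / (4 * (autFactor M (lowerFour • τ) * (4 * τ + 1)))) := by
      rw [← e_add]
      have hkey : (M 1 0 + 4 * M 1 1 : ℂ) * (4 * τ + 1) =
          M 1 0 + 4 * (autFactor M (lowerFour • τ) * (4 * τ + 1)) := by rw [hvw]; ring
      congr 1
      generalize (4 * τ + 1 : ℂ) = w at *
      field_simp
      linear_combination -z ^ 2 * hkey
    simp only [hiff] at hsq
    rw [(mul_lowerFour_row M).1, (mul_lowerFour_row M).2, hmult, autFactor_mul,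
      autFactor_lowerFour, mul_smul, hsq, jacobiTheta₂_lowerFour, div_div, mul_comm (4 * (τ : ℂ) + 1)
      (autFactor M _)]
    push_cast
    rw [← hexp]
    refine Eq.congr rfl ?_
    split_ifs <;> ring
  constructor
  · intro hM τ z
    have := (key (lowerFour⁻¹ • τ) (z * (4 * (lowerFour⁻¹ • τ : ℍ) + 1))).1 (hM _ _)
    rwa [smul_inv_smul, mul_div_cancel_right₀ _ (four_mul_add_one_ne_zero _)] at this
  · exact fun hM τ z => (key τ z).2 (hM _ _)

lemma jacobiTheta₂_add_two_mul_int (z τ : ℂ) (n : ℤ) :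
    jacobiTheta₂ z (2 * (τ + n)) = jacobiTheta₂ z (2 * τ) := by
  have key : ∀ w, jacobiTheta₂ z (2 * (w + 1)) = jacobiTheta₂ z (2 * w) := fun w => by
    rw [mul_add, mul_one, jacobiTheta₂_add_right]
  induction n using Int.induction_on with
  | zero => simp
  | succ n ih => rw [← ih, ← key (τ + (n : ℤ))]; push_cast; ring_nf
  | pred n ih => rw [← ih, ← key (τ + (_ - 1 : ℤ))]; push_cast; ring_nf

lemma thetaLaw_of_lower_eq_zero {M : SL(2, ℤ)} (h : M 1 0 = 0) : ThetaLaw M := by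
  have hdet := M.det_coe
  rw [Matrix.det_fin_two, h, mul_zero, sub_zero] at hdet
  intro τ z
  have hj : autFactor M τ = M 1 1 := by simp [autFactor, h]
  rw [coe_smul_eq, hj, h]
  -- Here M = ±Tⁿ. For the minus sign √(-1) = i cancels the inverse of ε₋₁ = i, and theta is even in
  -- z.
  rcases Int.eq_one_or_neg_one_of_mul_eq_one' hdet with ⟨h1, h2⟩ | ⟨h1, h2⟩
  · rw [h1, h2]
    simp [thetaMult, shimuraSymbol, epsilon, e_zero, jacobiTheta₂_add_two_mul_int]
  · have := jacobiTheta₂_add_two_mul_int z τ (-(M 0 1))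
    push_cast at this
    have hI : (-1 : ℂ) ^ (1 / 2 : ℂ) = Complex.I := by
      rw [Complex.cpow_def_of_ne_zero (by norm_num), Complex.log_neg_one,
        show (Real.pi * Complex.I * (1 / 2) : ℂ) = Real.pi / 2 * Complex.I by ring,
        Complex.exp_pi_div_two_mul_I]
    rw [h1, h2]
    simp only [thetaMult, shimuraSymbol, epsilon, e_zero, Int.cast_neg, Int.cast_one, hI, Int.cast_zero,
      div_neg, div_one, jacobiTheta₂_neg_left, zero_mul, zero_div]
    rw [← this]
    norm_num
    ring_nf

lemma thetaLaw_mul_T_zpow {M : SL(2, ℤ)} (h : 4 ∣ M 1 0) (n : ℤ) :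
    ((M * ModularGroup.T ^ n) 1 0 = M 1 0 ∧ (M * ModularGroup.T ^ n) 1 1 = M 1 1 + n * M 1 0) ∧
    (ThetaLaw (M * ModularGroup.T ^ n) ↔ ThetaLaw M) := by
  have key : ∀ n : ℤ, M * ModularGroup.T ^ (n + 1) = M * ModularGroup.T ^ n * ModularGroup.T := by
    intro n; rw [_root_.zpow_add_one, mul_assoc]
  have row : ∀ n : ℤ, (M * ModularGroup.T ^ n) 1 0 = M 1 0 ∧
      (M * ModularGroup.T ^ n) 1 1 = M 1 1 + n * M 1 0 := by
    intro n
    simp [Matrix.mul_apply, Fin.sum_univ_two, ModularGroup.coe_T_zpow]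
    ring
  refine ⟨row n, ?_⟩
  have step : ∀ n : ℤ, ThetaLaw (M * ModularGroup.T ^ (n + 1)) ↔ ThetaLaw (M * ModularGroup.T ^ n) :=
    fun n => by rw [key, thetaLaw_mul_T (by rw [(row n).1]; exact h)]
  induction n using Int.induction_on with
  | zero => simp
  | succ n ih => exact (step _).trans ih
  | pred n ih => exact ((step _).symm.trans (by simp)).trans ih

lemma thetaLaw_mul_lowerFour_zpow (M : SL(2, ℤ)) (n : ℤ) :
    ((M * lowerFour ^ n) 1 0 = M 1 0 + 4 * n * M 1 1 ∧ (M * lowerFour ^ n) 1 1 = M 1 1) ∧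
    (ThetaLaw (M * lowerFour ^ n) ↔ ThetaLaw M) := by
  have key : ∀ n : ℤ, M * lowerFour ^ (n + 1) = M * lowerFour ^ n * lowerFour := by
    intro n; rw [_root_.zpow_add_one, mul_assoc]
  have step : ∀ n : ℤ, ThetaLaw (M * lowerFour ^ (n + 1)) ↔ ThetaLaw (M * lowerFour ^ n) :=
    fun n => by rw [key, thetaLaw_mul_lowerFour]
  have rstep : ∀ n : ℤ, (M * lowerFour ^ (n + 1)) 1 0 =
      (M * lowerFour ^ n) 1 0 + 4 * (M * lowerFour ^ n) 1 1 ∧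
      (M * lowerFour ^ (n + 1)) 1 1 = (M * lowerFour ^ n) 1 1 :=
    fun n => by rw [key]; exact mul_lowerFour_row _
  induction n using Int.induction_on with
  | zero => simp
  | succ n ih =>
    refine ⟨⟨?_, ?_⟩, by rw [step, ih.2]⟩
    · rw [(rstep _).1, ih.1.1, ih.1.2]; ring
    · rw [(rstep _).2, ih.1.2]
  | pred n ih =>
    have h1 := rstep (-(n : ℤ) - 1)
    rw [sub_add_cancel] at h1
    have h2 : (M * lowerFour ^ (-(n : ℤ) - 1)) 1 1 = M 1 1 := by rw [← h1.2, ih.1.2]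
    refine ⟨⟨?_, h2⟩, by rw [← ih.2, ← step]; simp⟩
    have := h1.1
    rw [h2, ih.1.1] at this
    linear_combination -this

/-- The theta function is a modular form of weight `1/2` for `Γ₀(4)`. -/
theorem thetaLaw {M : SL(2, ℤ)} (h : 4 ∣ M 1 0) : ThetaLaw M := by
  induction hn : (M 1 0).natAbs using Nat.strong_induction_on generalizing M with
  | _ N ih =>
  rcases eq_or_ne (M 1 0) 0 with h0 | h0
  · exact thetaLaw_of_lower_eq_zero h0
  -- Division with remainder of least absolute value; it is applied to d modulo c and then to c
  -- modulo 4d.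
  have reduce : ∀ a b : ℤ, b ≠ 0 → ∃ n : ℤ, 2 * |a + n * b| ≤ |b| := by
    intro a b hb
    refine ⟨-round ((a : ℚ) / b), ?_⟩
    have := abs_sub_round ((a : ℚ) / b)
    have hb' : (0 : ℚ) < |(b : ℚ)| := abs_pos.2 (by exact_mod_cast hb)
    have h2 : |(a : ℚ) - round ((a : ℚ) / b) * b| ≤ 1 / 2 * |(b : ℚ)| := by
      have hb0 : (b : ℚ) ≠ 0 := by exact_mod_cast hb
      rw [show (a : ℚ) - round ((a : ℚ) / b) * b = ((a : ℚ) / b - round ((a : ℚ) / b)) * b by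
        field_simp, abs_mul]
      exact mul_le_mul_of_nonneg_right this hb'.le
    have h3 : ((2 * |a + -round ((a : ℚ) / b) * b| : ℤ) : ℚ) ≤ ((|b| : ℤ) : ℚ) := by
      push_cast
      rw [neg_mul, ← sub_eq_add_neg]
      linarith
    exact_mod_cast h3
  obtain ⟨n, hn1⟩ := reduce (M 1 1) (M 1 0) h0
  obtain ⟨⟨r1, r2⟩, hT⟩ := thetaLaw_mul_T_zpow h n
  rw [← hT]
  set M' := M * ModularGroup.T ^ n
  have h' : 4 ∣ M' 1 0 := by rw [r1]; exact h
  have hodd := odd_of_four_dvd h'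
  obtain ⟨n', hn2⟩ := reduce (M' 1 0) (4 * M' 1 1) (by
    rintro h
    have : M' 1 1 = 0 := by omega
    rw [this] at hodd; simp at hodd)
  obtain ⟨⟨s1, s2⟩, hV⟩ := thetaLaw_mul_lowerFour_zpow M' n'
  rw [← hV]
  -- Now 2|d| ≤ |c|, and the new lower left entry is at most 2|d| in absolute value. As d is odd and
  -- 4 divides c, equality 2|d| = |c| is impossible, so the descent is strict.
  refine ih _ ?_ ?_ rfl
  · rw [← hn, s1]
    rw [← r2, ← r1] at hn1
    rw [← r1]
    have e1 : 4 * n' * M' 1 1 = n' * (4 * M' 1 1) := by ring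
    rw [e1]
    have hodd' := Int.odd_iff.1 hodd
    generalize M' 1 0 + n' * (4 * M' 1 1) = x at hn2 ⊢
    generalize M' 1 0 = c at *
    generalize M' 1 1 = d at *
    have e2 : |4 * d| = 4 * |d| := by rw [abs_mul]; rfl
    rw [e2] at hn2
    rw [Int.abs_eq_natAbs, Int.abs_eq_natAbs] at hn1 hn2
    omega
  · rw [s1]
    exact dvd_add h' (by rw [mul_assoc]; exact dvd_mul_right _ _)

/-! ### Column sums of the Weil representation -/

/-- The element `(M, √(cτ+d))` of the metaplectic group, with the principal branch. -/
def Mp2Z.principal (M : SL(2, ℤ)) : Mp2Z where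
  mat := M
  phi := fun τ => autFactor M τ ^ (1 / 2 : ℂ)
  holo := by
    rcases eq_or_ne (M 1 0) 0 with h | h
    · have : (fun τ : ℍ => autFactor M τ ^ (1 / 2 : ℂ)) = fun _ => (M 1 1 : ℂ) ^ (1 / 2 : ℂ) := by
        funext τ; simp [autFactor, h]
      rw [this]
      exact mdifferentiable_const
    · rw [UpperHalfPlane.mdifferentiable_iff]
      refine DifferentiableOn.congr
        (f := fun z : ℂ => ((M 1 0 : ℂ) * z + (M 1 1 : ℂ)) ^ (1 / 2 : ℂ)) ?_ ?_
      · intro z hz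
        refine DifferentiableAt.differentiableWithinAt ?_
        refine DifferentiableAt.cpow_const (by fun_prop) (Or.inr ?_)
        have : (z.im : ℝ) ≠ 0 := ne_of_gt hz
        simpa [h] using this
      · intro z hz
        simp [autFactor, UpperHalfPlane.ofComplex_apply_of_im_pos hz]
  sq := fun τ => by
    rw [← Complex.cpow_nat_mul]
    simp

/-- `M' = (a, 4mb; c/4m, d)` is the conjugate of `M = (a, b; c, d)` by `τ ↦ 4mτ`. -/
structure IsScaleConj (m : ℕ) (M M' : SL(2, ℤ)) : Prop where
  a : M' 0 0 = M 0 0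
  b : M' 0 1 = 4 * m * M 0 1
  c : M 1 0 = 4 * m * M' 1 0
  d : M' 1 1 = M 1 1

lemma exists_isScaleConj {m : ℕ} {M : SL(2, ℤ)} (h : (4 * m : ℤ) ∣ M 1 0) : ∃ M', IsScaleConj m M M' := by
  obtain ⟨x, hx⟩ := h
  have hdet := M.det_coe
  rw [Matrix.det_fin_two, hx] at hdet
  refine ⟨⟨!![M 0 0, 4 * m * M 0 1; x, M 1 1], ?_⟩, ?_, ?_, ?_, ?_⟩
  · rw [Matrix.det_fin_two]
    simp only [Matrix.of_apply, Matrix.cons_val', Matrix.cons_val_zero, Matrix.cons_val_one,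
      Matrix.cons_val_fin_one]
    linear_combination hdet
  all_goals simp [hx]

lemma exists_isScaleConj' {m : ℕ} {M' : SL(2, ℤ)} (h : (4 * m : ℤ) ∣ M' 0 1) : ∃ M, IsScaleConj m M M' := by
  obtain ⟨x, hx⟩ := h
  have hdet := M'.det_coe
  rw [Matrix.det_fin_two, hx] at hdet
  refine ⟨⟨!![M' 0 0, x; 4 * m * M' 1 0, M' 1 1], ?_⟩, ?_, ?_, ?_, ?_⟩
  · rw [Matrix.det_fin_two]
    simp only [Matrix.of_apply, Matrix.cons_val', Matrix.cons_val_zero, Matrix.cons_val_one,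
      Matrix.cons_val_fin_one]
    linear_combination hdet
  all_goals simp [hx]

section

variable {m : ℕ} [NeZero m]

/-- `weilRep` is known only through its values at S and T. The matrices of the theta action form a
homomorphism, because the theta functions are linearly independent, and agree with it on these
generators. -/
lemma hasTheta_weilRep (g : Mp2Z) : HasTheta m g (weilRep m g) := by
  choose A B hA hB using exists_hasTheta (m := m)
  let A' : Mp2Z →* Matrix (ZMod (2 * m)) (ZMod (2 * m)) ℂ :=
    ⟨⟨A, (hA 1).unique HasTheta.one⟩, fun g h => (hA _).unique ((hA g).mul (hA h))⟩
  have : A' = weilRep m := by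
    refine MonoidHom.eq_of_eqOn_dense Mp2Z.closure_S_T ?_
    rintro x (rfl | rfl)
    · exact ((hA _).unique HasTheta.S).trans (weilRep_S m).symm
    · exact ((hA _).unique HasTheta.T).trans (weilRep_T m).symm
  rw [← this]
  exact hA g

lemma sum_theta (τ : ℍ) (z : ℂ) :
    ∑ μ, theta m μ τ z = jacobiTheta₂ z (τ / (2 * m)) := by
  have := jacobiTheta₂_split m 0 τ z
  simpa [e_zero] using this.symm

lemma coe_scale (τ : ℍ) : (scale m τ : ℂ) = 4 * m * τ := rfl

lemma exists_scale_eq (τ : ℍ) : ∃ σ : ℍ, scale m σ = τ := by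
  have h0 : (0 : ℝ) < m := Nat.cast_pos.2 (NeZero.pos m)
  have hm := m_ne_zero m
  refine ⟨⟨((1 / (4 * m) : ℝ) : ℂ) * τ, ?_⟩, ?_⟩
  · rw [Complex.im_ofReal_mul]
    have := τ.im_pos
    positivity
  · ext
    rw [coe_scale]
    push_cast
    change 4 * (m : ℂ) * (1 / (4 * m) * τ) = τ
    field_simp

lemma IsScaleConj.autFactor {M M' : SL(2, ℤ)} (h : IsScaleConj m M M') (τ : ℍ) :
    autFactor M' (scale m τ) = autFactor M τ := by
  rw [HalfMaass.autFactor, HalfMaass.autFactor, h.c, h.d, coe_scale]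
  push_cast
  ring

lemma IsScaleConj.smul {M M' : SL(2, ℤ)} (h : IsScaleConj m M M') (τ : ℍ) :
    M' • scale m τ = scale m (M • τ) := by
  ext
  rw [coe_smul_eq, h.autFactor, coe_scale, h.a, h.b, coe_scale, coe_smul_eq M]
  push_cast
  ring

/-- The sum of the theta functions is one Jacobi theta series at τ/2m; for τ = 4mσ this is the
series at 2σ, to which `thetaLaw` for M applies. The index m factor of the slash action cancels the
exponential in z. -/
lemma jslash_principal_sum_theta {M M' : SL(2, ℤ)} (h : IsScaleConj m M M') (τ : ℍ) (z : ℂ) :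
    jslash m (Mp2Z.principal M') (fun τ z => ∑ μ, theta m μ τ z) τ z =
      thetaMult (M 1 0) (M 1 1) * ∑ μ, theta m μ τ z := by
  have hm := m_ne_zero m
  have h4 : (4 : ℤ) ∣ M 1 0 := by rw [h.c, mul_assoc]; exact dvd_mul_right _ _
  obtain ⟨σ, rfl⟩ := exists_scale_eq (m := m) τ
  have hlaw := thetaLaw h4 σ z
  have hj := autFactor_ne_zero M σ
  have hs : autFactor M σ ^ (1 / 2 : ℂ) ≠ 0 := by simp [Complex.cpow_eq_zero_iff, hj]
  have key : ∀ υ : ℍ, (scale m υ : ℂ) / (2 * m) = 2 * υ := by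
    intro υ; rw [coe_scale]; field_simp; ring
  rw [jslash, sum_theta, sum_theta, key]
  change (autFactor M' (scale m σ) ^ (1 / 2 : ℂ))⁻¹ * e (-(m * (M' 1 0 : ℂ) * z ^ 2 /
    autFactor M' (scale m σ))) * jacobiTheta₂ (z / autFactor M' (scale m σ))
      ((M' • scale m σ : ℍ) / (2 * m)) = _
  rw [h.smul, key, h.autFactor, hlaw]
  have hexp : e (-(m * (M' 1 0 : ℂ) * z ^ 2 / autFactor M σ)) *
      e ((M 1 0 : ℂ) * z ^ 2 / (4 * autFactor M σ)) = 1 := by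
    rw [← e_add, h.c, ← e_zero]
    congr 1
    push_cast
    field_simp
    ring
  generalize autFactor M σ ^ (1 / 2 : ℂ) = x at *
  generalize e ((M 1 0 : ℂ) * z ^ 2 / (4 * autFactor M σ)) = y at *
  field_simp
  linear_combination thetaMult (M 1 0) (M 1 1) * jacobiTheta₂ z (2 * σ) * hexp

/-- Compare coefficients of the linearly independent theta functions in two expressions for the
action on their sum. Here the multiplier of scalar forms meets the Weil representation. -/
lemma sum_weilRep_principal {M M' : SL(2, ℤ)} (h : IsScaleConj m M M') (ν : ZMod (2 * m)) :
    ∑ μ, weilRep m (Mp2Z.principal M') μ ν = thetaMult (M 1 0) (M 1 1) := by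
  have hli := Fintype.linearIndependent_iff.1 (theta_linearIndependent m)
    (fun ν => ∑ μ, weilRep m (Mp2Z.principal M') μ ν - thetaMult (M 1 0) (M 1 1)) ?_ ν
  · exact sub_eq_zero.1 hli
  · funext z
    have h1 := jslash_principal_sum_theta h UpperHalfPlane.I z
    have h2 := jslash_sum m (Mp2Z.principal M') Finset.univ (fun _ => 1) (theta m)
      UpperHalfPlane.I z
    simp only [one_mul] at h2
    rw [h2] at h1
    simp only [hasTheta_weilRep (Mp2Z.principal M') _ _ z] at h1
    rw [Finset.sum_comm, Finset.mul_sum] at h1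
    simp only [Finset.sum_apply, Pi.smul_apply, smul_eq_mul, sub_mul, Finset.sum_sub_distrib,
      Pi.zero_apply, Finset.sum_mul]
    rw [h1, sub_self]

/-! ### The action of S² and unitarity -/

lemma theta_neg (μ : ZMod (2 * m)) (τ : ℍ) (z : ℂ) : theta m μ τ (-z) = theta m (-μ) τ z := by
  obtain ⟨c, hc⟩ : ∃ c : ℤ, ((-μ).val : ℤ) = -μ.val + 2 * m * c := by
    have : (((-(μ.val : ℤ) : ℤ)) : ZMod (2 * m)) = (((-μ).val : ℤ) : ZMod (2 * m)) := by simp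
    obtain ⟨c, hc⟩ := (ZMod.intCast_eq_intCast_iff_dvd_sub _ _ _).1 this
    exact ⟨c, by push_cast at hc; linear_combination hc⟩
  refine (theta_eq_tsum m μ τ (-z)).unique ?_
  refine hasSum_of_eq ((Equiv.subLeft (-c)).hasSum_iff.2 (theta_eq_tsum m (-μ) τ z)) fun k => ?_
  rw [Function.comp_apply, Equiv.subLeft_apply]
  have : (residueEquiv m (-μ, -c - k) : ℤ) = -(residueEquiv m (μ, k) : ℤ) := by
    simp only [residueEquiv, Equiv.coe_fn_mk, hc]
    ring
  rw [this]
  congr 1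
  push_cast
  ring

lemma Mp2Z.S_sq_mat : (Mp2Z.S ^ 2).mat = -1 := by
  have : (S ^ 2).mat = ModularGroup.S * ModularGroup.S := by rw [pow_two]; rfl
  rw [this]
  decide

/-- S² = (-1, i) fixes τ and sends z to -z, which exchanges the theta functions of μ and -μ; the
factor is 1/i. -/
lemma weilRep_S_sq (μ ν : ZMod (2 * m)) :
    weilRep m (Mp2Z.S ^ 2) μ ν = if ν = -μ then -Complex.I else 0 := by
  have : HasTheta m (Mp2Z.S ^ 2) (Matrix.of fun μ ν => if ν = -μ then -Complex.I else 0) := by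
    intro μ τ z
    have h1 : autFactor (-1 : SL(2, ℤ)) τ = -1 := by simp [autFactor]
    have h2 : (-1 : SL(2, ℤ)) • τ = τ := by
      ext
      rw [coe_smul_eq, h1]
      simp
    rw [jslash, Mp2Z.S_sq_mat, Mp2Z.S_sq_phi, h1, h2]
    simp [e_zero, div_neg, theta_neg]
  rw [(hasTheta_weilRep _).unique this]
  rfl

lemma conj_e (z : ℂ) : (starRingEnd ℂ) (e z) = e (-(starRingEnd ℂ) z) := by
  rw [e, e, ← Complex.exp_conj]
  congr 1
  simp [Complex.conj_ofNat]

lemma e_neg (z : ℂ) : e (-z) = (e z)⁻¹ := by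
  rw [e, e, ← Complex.exp_neg]; congr 1; ring

lemma exists_val_neg (μ : ZMod (2 * m)) : ∃ c : ℤ, ((-μ).val : ℤ) = -μ.val + 2 * m * c := by
  have : (((-(μ.val : ℤ) : ℤ)) : ZMod (2 * m)) = (((-μ).val : ℤ) : ZMod (2 * m)) := by simp
  obtain ⟨c, hc⟩ := (ZMod.intCast_eq_intCast_iff_dvd_sub _ _ _).1 this
  exact ⟨c, by push_cast at hc; linear_combination hc⟩

/-- Conjugating the characters amounts to negating an index, and e(1/8) = i e(-1/8). Combined with
the known action of S², this identifies the inverse of ρ_L(S) without evaluating a Gauss sum. -/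
lemma conj_weilS (μ ν : ZMod (2 * m)) :
    (starRingEnd ℂ) (weilS m μ ν) = Complex.I * weilS m (-μ) ν := by
  have hm := m_ne_zero m
  obtain ⟨c, hc⟩ := exists_val_neg μ
  have hc' : ((-μ).val : ℂ) = -μ.val + 2 * m * c := by exact_mod_cast congrArg (Int.cast (R := ℂ)) hc
  have h1 : e (-((ν.val : ℂ) * ((-μ).val : ℂ) / (2 * m))) = e ((ν.val : ℂ) * μ.val / (2 * m)) := by
    rw [hc', ← e_add_int ((ν.val : ℂ) * μ.val / (2 * m)) (-(ν.val * c))]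
    congr 1
    push_cast
    field_simp
    ring
  have h2 : Complex.I * e (-1 / 8) = e (1 / 8) := by
    have : Complex.I = e (1 / 4) := by
      rw [e, show (2 * Real.pi * Complex.I * (1 / 4) : ℂ) = Real.pi / 2 * Complex.I by ring,
        Complex.exp_pi_div_two_mul_I]
    rw [this, ← e_add]
    norm_num
  simp only [weilS, Matrix.of_apply, map_mul, map_div₀, conj_e, Complex.conj_ofReal, map_neg,
    map_ofNat, map_one, Complex.conj_natCast, neg_neg]
  rw [h1, ← mul_assoc, ← mul_div_assoc, h2]
  norm_num

lemma weilRep_S_inv : weilRep m Mp2Z.S⁻¹ = (weilS m).map (starRingEnd ℂ) := by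
  have h1 : (weilS m).map (starRingEnd ℂ) * weilS m = 1 := by
    ext μ ν
    have h2 := weilRep_S_sq (m := m) (-μ) ν
    rw [pow_two, map_mul, weilRep_S, Matrix.mul_apply, neg_neg] at h2
    simp only [Matrix.mul_apply, Matrix.map_apply, conj_weilS, mul_assoc]
    rw [← Finset.mul_sum, h2, Matrix.one_apply]
    by_cases h : μ = ν
    · rw [if_pos h.symm, if_pos h]; simp
    · rw [if_neg (Ne.symm h), if_neg h]; simp
  have h3 : weilS m * weilRep m Mp2Z.S⁻¹ = 1 := by
    rw [← weilRep_S, ← map_mul, mul_inv_cancel, map_one]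
  rw [← one_mul (weilRep m Mp2Z.S⁻¹), ← h1, mul_assoc, h3, mul_one]

lemma weilRep_T_inv : weilRep m Mp2Z.T⁻¹ = Matrix.diagonal fun γ => (e (Q m γ))⁻¹ := by
  have h3 : weilT m * weilRep m Mp2Z.T⁻¹ = 1 := by
    rw [← weilRep_T, ← map_mul, mul_inv_cancel, map_one]
  rw [← one_mul (weilRep m Mp2Z.T⁻¹), ← weilT_inv, mul_assoc, h3, mul_one]

/-- The Weil representation is unitary: its dual is the complex conjugate. -/
theorem weilRepDual_eq_conj (g : Mp2Z) :
    weilRepDual m g = (weilRep m g).map (starRingEnd ℂ) := by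
  have : weilRepDual m =
      ((RingHom.mapMatrix (starRingEnd ℂ)).toMonoidHom : _ →* _).comp (weilRep m) := by
    refine MonoidHom.eq_of_eqOn_dense Mp2Z.closure_S_T ?_
    rintro x (rfl | rfl)
    · change (weilRep m Mp2Z.S⁻¹)ᵀ = (weilRep m Mp2Z.S).map (starRingEnd ℂ)
      rw [weilRep_S_inv, weilRep_S]
      ext μ ν
      simp only [Matrix.transpose_apply, Matrix.map_apply, weilS, Matrix.of_apply, mul_comm]
    · change (weilRep m Mp2Z.T⁻¹)ᵀ = (weilRep m Mp2Z.T).map (starRingEnd ℂ)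
      rw [weilRep_T_inv, weilRep_T, weilT, Matrix.diagonal_transpose, Matrix.diagonal_map (map_zero _)]
      congr 1
      funext γ
      simp [conj_e, e_neg]
  rw [this]
  rfl

end

/-! ### The representation attached to the parity of k -/

/-- `ρ_L` for even `k` and its dual for odd `k`. -/
def weilRepOf (m : ℕ) [NeZero m] (k : ℤ) : Mp2Z →* Matrix (ZMod (2 * m)) (ZMod (2 * m)) ℂ :=
  if Even k then weilRep m else weilRepDual m

section

variable {m : ℕ} [NeZero m] (k : ℤ)

lemma negOnePow_cases : (Even k ∧ (k.negOnePow : ℤ) = 1) ∨ (¬ Even k ∧ (k.negOnePow : ℤ) = -1) := by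
  rcases Int.even_or_odd k with h | h
  · exact Or.inl ⟨h, by rw [Int.negOnePow_even _ h]; rfl⟩
  · exact Or.inr ⟨Int.not_even_iff_odd.2 h, by rw [Int.negOnePow_odd _ h]; rfl⟩

lemma weilRepOf_T : weilRepOf m k Mp2Z.T =
    Matrix.diagonal fun γ => e ((k.negOnePow : ℤ) * Q m γ) := by
  rcases negOnePow_cases k with ⟨h, h'⟩ | ⟨h, h'⟩
  · rw [weilRepOf, if_pos h, h', weilRep_T, weilT]
    simp
  · rw [weilRepOf, if_neg h, h', weilRepDual_eq_conj, weilRep_T, weilT,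
      Matrix.diagonal_map (map_zero _)]
    congr 1
    funext γ
    simp [conj_e]

lemma weilRepOf_S_inv (μ ν : ZMod (2 * m)) : weilRepOf m k Mp2Z.S⁻¹ μ ν =
    e ((k.negOnePow : ℤ) / 8) / (Real.sqrt (2 * m) : ℂ) *
      e ((k.negOnePow : ℤ) * ((ν.val : ℂ) * (μ.val : ℂ) / (2 * m))) := by
  rcases negOnePow_cases k with ⟨h, h'⟩ | ⟨h, h'⟩
  · rw [weilRepOf, if_pos h, h', weilRep_S_inv]
    simp [weilS, conj_e, neg_div, Complex.conj_ofNat, -ZMod.natCast_val]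
  · rw [weilRepOf, if_neg h, h', weilRepDual]
    simp [weilS, weilRep_S, mul_comm]

lemma weilRepOf_S_sq (μ ν : ZMod (2 * m)) :
    weilRepOf m k (Mp2Z.S ^ 2) μ ν = if ν = -μ then -((k.negOnePow : ℤ) * Complex.I) else 0 := by
  rcases negOnePow_cases k with ⟨h, h'⟩ | ⟨h, h'⟩
  · rw [weilRepOf, if_pos h, h', weilRep_S_sq]
    simp
  · rw [weilRepOf, if_neg h, h', weilRepDual_eq_conj, Matrix.map_apply, weilRep_S_sq]
    split_ifs <;> simp

lemma epsilon_pow_four (d : ℤ) : epsilon d ^ (4 : ℤ) = 1 := by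
  rw [epsilon]
  split_ifs
  · simp
  · exact_mod_cast Complex.I_pow_four

lemma epsilon_ne_zero (d : ℤ) : epsilon d ≠ 0 := by
  rw [epsilon]; split_ifs <;> simp

/-- As ε_d⁴ = 1, only the parity of k matters: -(2k + 1) is -1 modulo 4 for even k and 1 for odd k.
In the odd case conjugation turns ε_d⁻¹ into ε_d. -/
lemma sum_weilRepOf_principal {M M' : SL(2, ℤ)} (h : IsScaleConj m M M') (ν : ZMod (2 * m)) :
    ∑ μ, weilRepOf m k (Mp2Z.principal M') μ ν =
      (shimuraSymbol (M 1 0) (M 1 1) : ℂ) * epsilon (M 1 1) ^ (-(2 * k + 1)) := by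
  have hε := epsilon_ne_zero (M 1 1)
  rcases negOnePow_cases k with ⟨hk, -⟩ | ⟨hk, -⟩
  · rw [weilRepOf, if_pos hk, sum_weilRep_principal h, thetaMult]
    obtain ⟨l, rfl⟩ := hk
    rw [show -(2 * (l + l) + 1) = 4 * (-l) + -1 by ring, zpow_add₀ hε, _root_.zpow_mul,
      epsilon_pow_four, _root_.one_zpow, one_mul, _root_.zpow_neg_one]
  · rw [weilRepOf, if_neg hk]
    simp only [weilRepDual_eq_conj, Matrix.map_apply]
    rw [← map_sum, sum_weilRep_principal h, thetaMult]
    obtain ⟨l, rfl⟩ := Int.not_even_iff_odd.1 hk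
    rw [show -(2 * (2 * l + 1) + 1) = 4 * (-l - 1) + 1 by ring, zpow_add₀ hε, _root_.zpow_mul,
      epsilon_pow_four, _root_.one_zpow, one_mul, _root_.zpow_one]
    simp only [map_mul, map_intCast, map_inv₀]
    congr 1
    rw [epsilon]
    split_ifs <;> simp

end

/-! ### Functions on `ℤ/2mℤ` and squares modulo `4m` -/

section

variable {m : ℕ} [NeZero m]

/-- The square of `γ ∈ ℤ/2mℤ`, which is well defined modulo `4m`. -/
def sqMod (m : ℕ) (γ : ZMod (2 * m)) : ZMod (4 * m) := (γ.val : ZMod (4 * m)) ^ 2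

omit [NeZero m] in
lemma intCast_eq_sqMod_iff (n : ℤ) (γ : ZMod (2 * m)) :
    (n : ZMod (4 * m)) = sqMod m γ ↔ n ≡ (γ.val : ℤ) ^ 2 [ZMOD 4 * m] := by
  have h := ZMod.intCast_eq_intCast_iff n ((γ.val : ℤ) ^ 2) (4 * m)
  push_cast at h
  rw [sqMod, h]

lemma sqMod_neg (γ : ZMod (2 * m)) : sqMod m (-γ) = sqMod m γ := by
  obtain ⟨c, hc⟩ := exists_val_neg γ
  have h : (((-γ).val : ℤ) : ZMod (4 * m)) ^ 2 = ((γ.val : ℤ) : ZMod (4 * m)) ^ 2 := by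
    rw [hc]
    have h0 : (4 * m : ZMod (4 * m)) = 0 := by exact_mod_cast ZMod.natCast_self (4 * m)
    push_cast
    linear_combination (m * c ^ 2 - (γ.val : ZMod (4 * m)) * c) * h0
  simpa [sqMod] using h

/-- Equal squares modulo 4m force equal parity, and then m divides the product of the
half-difference and the half-sum; being 1 or prime, it divides one of them. -/
lemma sqMod_eq_sqMod_iff (hm : m = 1 ∨ m.Prime) (γ δ : ZMod (2 * m)) :
    sqMod m δ = sqMod m γ ↔ δ = γ ∨ δ = -γ := by
  refine ⟨fun h => ?_, ?_⟩
  · have h1 : (((δ.val : ℤ) ^ 2 : ℤ) : ZMod (4 * m)) = sqMod m γ := by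
      rw [← h]; simp [sqMod]
    obtain ⟨t, ht⟩ := ((intCast_eq_sqMod_iff _ _).1 h1).symm.dvd
    have hpar : (2 : ℤ) ∣ δ.val - γ.val := by
      by_contra hne
      have : ((δ.val : ℤ) - γ.val) % 2 = 1 := by omega
      have h2 : ((δ.val : ℤ) + γ.val) % 2 = 1 := by omega
      have h3 : (((δ.val : ℤ) - γ.val) * (δ.val + γ.val)) % 2 = 1 := by
        rw [Int.mul_emod, this, h2]; rfl
      have h4 : ((δ.val : ℤ) - γ.val) * (δ.val + γ.val) = 2 * (2 * m * t) := by
        linear_combination ht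
      rw [h4] at h3
      omega
    obtain ⟨x, hx⟩ := hpar
    have hy : (δ.val : ℤ) + γ.val = 2 * (x + γ.val) := by linear_combination hx
    have hxy : (m : ℤ) ∣ x * (x + γ.val) := ⟨t, by
      have : (4 : ℤ) * (x * (x + γ.val)) = 4 * (m * t) := by
        linear_combination ht - hx * (2 * (x + (γ.val : ℤ))) - (δ.val - γ.val : ℤ) * hy
      omega⟩
    have key : (m : ℤ) ∣ x ∨ (m : ℤ) ∣ x + γ.val := by
      rcases hm with rfl | hp
      · left; simp
      · exact (Nat.prime_iff_prime_int.1 hp).dvd_or_dvd hxy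
    have hz : ∀ n : ℤ, (2 * m : ℤ) ∣ n → (n : ZMod (2 * m)) = 0 := fun n hn =>
      (ZMod.intCast_zmod_eq_zero_iff_dvd n (2 * m)).2 (by push_cast; exact hn)
    rcases key with ⟨l, hl⟩ | ⟨l, hl⟩
    · left
      have := hz (δ.val - γ.val) ⟨l, by rw [hx, hl]; ring⟩
      push_cast at this
      rw [ZMod.natCast_zmod_val, ZMod.natCast_zmod_val] at this
      exact sub_eq_zero.1 this
    · right
      have := hz (δ.val + γ.val) ⟨l, by rw [hy, hl]; ring⟩
      push_cast at this
      rw [ZMod.natCast_zmod_val, ZMod.natCast_zmod_val] at this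
      exact eq_neg_of_add_eq_zero_left this
  · rintro (rfl | rfl)
    · rfl
    · exact sqMod_neg _

lemma neg_eq_self_iff_sFactor (γ : ZMod (2 * m)) : -γ = γ ↔ γ = 0 ∨ γ = (m : ZMod (2 * m)) := by
  have h2 : ((2 * m : ℕ) : ZMod (2 * m)) = 0 := ZMod.natCast_self _
  push_cast at h2
  constructor
  · intro h
    rw [ZMod.neg_eq_self_iff] at h
    rcases h with h | h
    · exact Or.inl h
    · right
      have : γ.val = m := by omega
      rw [← ZMod.natCast_zmod_val γ, this]
  · rintro (rfl | rfl)
    · simp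
    · linear_combination -h2

lemma sum_sqMod_eq (hm : m = 1 ∨ m.Prime) {E : ZMod (2 * m) → ℂ} (hE : ∀ γ, E (-γ) = E γ)
    (γ : ZMod (2 * m)) :
    ∑ δ, (if sqMod m δ = sqMod m γ then E δ else 0) = sFactor m γ * E γ := by
  simp only [sqMod_eq_sqMod_iff hm]
  rw [← Finset.sum_filter]
  have : (Finset.univ.filter fun δ => δ = γ ∨ δ = -γ) = {γ, -γ} := by ext; simp
  rw [this, sFactor]
  by_cases h : -γ = γ
  · rw [if_pos ((neg_eq_self_iff_sFactor γ).1 h), h]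
    simp
  · rw [if_neg (fun h' => h ((neg_eq_self_iff_sFactor γ).2 h')), Finset.sum_pair (Ne.symm h), hE]
    ring

omit [NeZero m] in
lemma sFactor_ne_zero (γ : ZMod (2 * m)) : sFactor m γ ≠ 0 := by
  rw [sFactor]; split_ifs <;> norm_num

/-! ### Fourier analysis on ℤ/4mℤ -/

open ZMod in
lemma dft_shift {N : ℕ} [NeZero N] (c : ZMod N → ℂ) (a b : ZMod N) :
    𝓕 (fun n => c (n + a)) b = stdAddChar (a * b) * 𝓕 c b := by
  rw [dft_apply, dft_apply, Finset.mul_sum]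
  refine Fintype.sum_equiv (Equiv.addRight a) _ _ fun n => ?_
  rw [Equiv.coe_addRight, smul_eq_mul, smul_eq_mul, ← mul_assoc, ← AddChar.map_add_eq_mul]
  congr 2
  ring

instance neZero_four_mul : NeZero (4 * m) := ⟨by have := NeZero.ne m; omega⟩

omit [NeZero m] in
lemma four_mul_natCast_self : (4 * m : ZMod (4 * m)) = 0 := by exact_mod_cast ZMod.natCast_self (4 * m)

/-- An even b is killed by 2m, an odd b prime to m is a unit, and an odd b not prime to m is a
multiple of an odd prime m. -/
lemma isUnit_or_four_mul_eq_zero (hm : m = 1 ∨ m.Prime) (b : ZMod (4 * m)) :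
    IsUnit b ∨ 2 * m * b = 0 ∨ (m.Prime ∧ m ≠ 2 ∧ 4 * b = 0) := by
  have hb : (b.val : ZMod (4 * m)) = b := ZMod.natCast_zmod_val b
  rcases Nat.even_or_odd b.val with h | h
  · right; left
    obtain ⟨x, hx⟩ := h
    rw [← hb, hx]
    push_cast
    linear_combination (x : ZMod (4 * m)) * four_mul_natCast_self (m := m)
  · have h2 : Nat.Coprime b.val 2 := Nat.coprime_two_right.2 h
    by_cases hc : Nat.Coprime b.val m
    · left
      rw [← hb, ZMod.isUnit_iff_coprime]
      exact Nat.Coprime.mul_right (h2.mul_right h2) hc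
    · rcases hm with rfl | hp
      · simp at hc
      · right; right
        have hdvd : m ∣ b.val := by
          rw [Nat.coprime_comm, hp.coprime_iff_not_dvd, not_not] at hc; exact hc
        refine ⟨hp, ?_, ?_⟩
        · rintro rfl
          exact (Nat.not_even_iff_odd.2 h) (even_iff_two_dvd.2 hdvd)
        · obtain ⟨x, hx⟩ := hdvd
          rw [← hb, hx]
          push_cast
          linear_combination (x : ZMod (4 * m)) * four_mul_natCast_self (m := m)

open ZMod in
/-- A function on `ℤ/4mℤ` that is supported on the squares and whose Fourier transform vanishes on
the units is periodic modulo `2m`. -/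
lemma periodic_of_dft_units (hm : m = 1 ∨ m.Prime) {c : ZMod (4 * m) → ℂ}
    (hsupp : ∀ n, ¬ IsSquare n → c n = 0) (hc : ∀ b, IsUnit b → 𝓕 c b = 0) (n : ZMod (4 * m)) :
    c (n + 2 * m) = c n := by
  set c' : ZMod (4 * m) → ℂ := (fun n => c (n + 2 * m)) - c with hc'
  have hF : ∀ b, 𝓕 c' b = (stdAddChar (2 * (m : ZMod (4 * m)) * b) - 1) * 𝓕 c b := by
    intro b
    rw [hc', map_sub, Pi.sub_apply, dft_shift]
    ring
  suffices c' n = 0 from sub_eq_zero.1 this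
  by_cases hp : m.Prime ∧ m ≠ 2
  -- The transform of c' vanishes at units by hypothesis, and where 2mb = 0 because of its first
  -- factor. At all remaining frequencies 4b = 0, so translation by 4 has no effect.
  · have h4 : ∀ n, c' (n + 4) = c' n := by
      suffices (fun n => c' (n + 4)) - c' = 0 from fun n => sub_eq_zero.1 (congrFun this n)
      refine (ZMod.dft (N := 4 * m) (E := ℂ)).injective ?_
      funext b
      rw [map_sub, Pi.sub_apply, dft_shift, map_zero, Pi.zero_apply, hF]
      rcases isUnit_or_four_mul_eq_zero hm b with h | h | ⟨-, -, h⟩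
      · rw [hc b h]; ring
      · rw [h, AddChar.map_zero_eq_one]; ring
      · rw [h, AddChar.map_zero_eq_one]; ring
    have h4' : ∀ (j : ℕ) (n), c' (n + 4 * j) = c' n := by
      intro j
      induction j with
      | zero => simp
      | succ j ih => intro n; rw [← ih n, ← h4 (n + 4 * j)]; push_cast; ring_nf
    obtain ⟨hp, h2⟩ := hp
    have : Fact m.Prime := ⟨hp⟩
    let π : ZMod (4 * m) →+* ZMod m := ZMod.castHom (Dvd.intro_left 4 rfl) (ZMod m)
    -- As 4 is invertible modulo m, a translation by a multiple of 4 moves n above a nonresidue t.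
    -- There neither the argument nor its translate by 2m is a square, and c vanishes at both.
    obtain ⟨t, ht⟩ := FiniteField.exists_nonsquare (F := ZMod m) (by
      rw [ZMod.ringChar_zmod_n]; exact h2)
    have h40 : (4 : ZMod m) ≠ 0 := by
      have hodd := hp.odd_of_ne_two h2
      have : ((4 : ℕ) : ZMod m) ≠ 0 := by
        rw [Ne, ZMod.natCast_eq_zero_iff]
        intro hd
        have : m ∣ 2 := by
          have : m ∣ 2 * 2 := hd
          rcases (Nat.Prime.dvd_mul hp).1 this with h | h <;> exact h
        exact h2 ((Nat.prime_dvd_prime_iff_eq hp Nat.prime_two).1 this)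
      exact_mod_cast this
    set j := ((t - π n) / 4 : ZMod m).val
    have hj : (4 : ZMod m) * j = t - π n := by
      rw [ZMod.natCast_zmod_val]; field_simp
    rw [← h4' j n, hc', Pi.sub_apply]
    have hm0 : (m : ZMod m) = 0 := ZMod.natCast_self m
    have hπ1 : π (n + 4 * j) = t := by
      rw [map_add, map_mul, map_natCast, map_ofNat, hj]; ring
    have hπ2 : π (n + 4 * j + 2 * m) = t := by
      rw [map_add, hπ1, map_mul, map_natCast, hm0]; ring
    rw [hsupp _ (fun h => ht (hπ1 ▸ h.map π)), hsupp _ (fun h => ht (hπ2 ▸ h.map π)), sub_zero]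
  · have : c' = 0 := by
      refine (ZMod.dft (N := 4 * m) (E := ℂ)).injective ?_
      funext b
      rw [map_zero, Pi.zero_apply, hF]
      rcases isUnit_or_four_mul_eq_zero hm b with h | h | ⟨h1, h2, -⟩
      · rw [hc b h]; ring
      · rw [h, AddChar.map_zero_eq_one]; ring
      · exact absurd ⟨h1, h2⟩ hp
    rw [this]; rfl

lemma stdAddChar_sqMod (b : ℕ) (γ : ZMod (2 * m)) :
    ZMod.stdAddChar (sqMod m γ * (b : ZMod (4 * m))) = e (b * Q m γ) := by
  have hm := m_ne_zero m
  have := ZMod.stdAddChar_coe (N := 4 * m) ((γ.val : ℤ) ^ 2 * b)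
  push_cast at this
  rw [sqMod, this, e, Q]
  congr 1
  push_cast
  ring

open ZMod in
/-- An even function on `ℤ/2mℤ` that is orthogonal to the characters `e(bγ²/4m)`, `b ∈ (ℤ/4mℤ)ˣ`. -/
lemma even_fun_of_orthogonal (hm : m = 1 ∨ m.Prime) {E : ZMod (2 * m) → ℂ} (hE : ∀ γ, E (-γ) = E γ)
    (hb : ∀ b : ZMod (4 * m), IsUnit b → ∑ γ, stdAddChar (-(sqMod m γ * b)) * E γ = 0) :
    (m ≠ 2 → E = 0) ∧ (m = 2 → E 0 = E m ∧ ∀ γ : ZMod (2 * m), γ ≠ 0 → γ ≠ m → E γ = 0) := by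
  set c : ZMod (4 * m) → ℂ := fun n => ∑ δ, if sqMod m δ = n then E δ else 0 with hcdef
  have hcE : ∀ γ, c (sqMod m γ) = sFactor m γ * E γ := sum_sqMod_eq hm hE
  have hdft : ∀ b, 𝓕 c b = ∑ γ, stdAddChar (-(sqMod m γ * b)) * E γ := by
    intro b
    rw [dft_apply]
    simp only [hcdef, smul_eq_mul, Finset.mul_sum, mul_ite, mul_zero]
    rw [Finset.sum_comm]
    refine Finset.sum_congr rfl fun γ _ => ?_
    rw [Finset.sum_ite_eq]
    simp
  have hsq : ∀ n, ¬ IsSquare n → c n = 0 := by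
    intro n hn
    refine Finset.sum_eq_zero fun δ _ => if_neg ?_
    rintro rfl
    exact hn (IsSquare.sq _)
  have hper := periodic_of_dft_units hm hsq fun b h => (hdft b).trans (hb b h)
  have hzero : ∀ γ, c (sqMod m γ) = 0 → E γ = 0 := fun γ h =>
    (mul_eq_zero.1 ((hcE γ).symm.trans h)).resolve_left (sFactor_ne_zero γ)
  refine ⟨fun h2 => ?_, ?_⟩
  -- For odd m, adding 2m means adding 2 modulo 4, while squares are 0 or 1 modulo 4. The shifted
  -- argument is never a square, so periodicity makes c vanish on all squares.
  · have hodd : m % 2 = 1 := by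
      rcases hm with rfl | hp
      · rfl
      · exact hp.eq_two_or_odd.resolve_left h2
    funext γ
    refine hzero γ ?_
    rw [← hper]
    refine hsq _ ?_
    intro hs
    have hs4 := hs.map (ZMod.castHom (Dvd.intro m rfl : 4 ∣ 4 * m) (ZMod 4))
    rw [map_add, map_mul, map_natCast, sqMod, map_pow, map_natCast, map_ofNat] at hs4
    have hm4 : (2 : ZMod 4) * (m : ZMod 4) = 2 := by
      have h1 : ((2 * m : ℕ) : ZMod 4) = (2 : ℕ) := by
        rw [ZMod.natCast_eq_natCast_iff']; omega
      exact_mod_cast h1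
    rw [hm4] at hs4
    revert hs4
    generalize (γ.val : ZMod 4) = x
    revert x
    decide
  -- The squares modulo 8 are 0, 1 and 4. Period 4 identifies the values at 0 and 4 and kills the
  -- value at 1, since 5 is not a square; the common value at 0 and 4 stays free.
  · rintro rfl
    have hs0 : sqMod 2 0 = 0 := by decide
    have hs2 : sqMod 2 ((2 : ℕ) : ZMod (2 * 2)) = 0 + 2 * (2 : ℕ) := by decide
    refine ⟨?_, fun γ h0 h2 => hzero γ ?_⟩
    · have h1 := hcE 0
      have h2 := hcE (2 : ℕ)
      rw [hs2, hper, ← hs0, h1] at h2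
      simpa [sFactor] using h2
    · have hs1 : sqMod 2 γ = 1 := by
        have hv : ∀ γ : ZMod (2 * 2), γ ≠ 0 → γ ≠ (2 : ℕ) → γ.val = 1 ∨ γ.val = 3 := by decide
        rcases hv γ h0 h2 with h | h <;> rw [sqMod, h] <;> rfl
      rw [hs1, ← hper]
      refine hsq _ ?_
      decide

end

/-! ### The slash operator on vector valued functions -/

section

variable {m : ℕ} [NeZero m] (k : ℤ)

/-- `(F|g)(τ) = φ(τ)^{-2κ} ρ(g)⁻¹ F(gτ)`. -/
def vslash (g : Mp2Z) (F : ℍ → ZMod (2 * m) → ℂ) (τ : ℍ) : ZMod (2 * m) → ℂ :=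
  g.phi τ ^ (-(2 * k + 1)) • (weilRepOf m k g⁻¹ *ᵥ F (g.mat • τ))

variable {k}

lemma vslash_mul (g h : Mp2Z) (F : ℍ → ZMod (2 * m) → ℂ) :
    vslash k (g * h) F = vslash k h (vslash k g F) := by
  funext τ
  simp only [vslash]
  rw [Mp2Z.phi_mul, Mp2Z.mat_mul, SemigroupAction.mul_smul g.mat, _root_.mul_inv_rev, map_mul,
    Matrix.mulVec_smul, smul_smul, _root_.mul_zpow, mul_comm (g.phi _ ^ _), Matrix.mulVec_mulVec,
    smul_smul]

lemma vslash_sub (g : Mp2Z) (F G : ℍ → ZMod (2 * m) → ℂ) :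
    vslash k g (F - G) = vslash k g F - vslash k g G := by
  funext τ
  simp only [vslash, Pi.sub_apply, Matrix.mulVec_sub, smul_sub]

lemma vslash_add (g : Mp2Z) (F G : ℍ → ZMod (2 * m) → ℂ) :
    vslash k g (F + G) = vslash k g F + vslash k g G := by
  funext τ
  simp only [vslash, Pi.add_apply, Matrix.mulVec_add, smul_add]

lemma smul_mulVec_vslash (g : Mp2Z) (F : ℍ → ZMod (2 * m) → ℂ) (τ : ℍ) :
    g.phi τ ^ (2 * k + 1) • (weilRepOf m k g *ᵥ vslash k g F τ) = F (g.mat • τ) := by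
  rw [vslash, Matrix.mulVec_smul, smul_smul, ← zpow_add₀ (g.phi_ne_zero τ), Matrix.mulVec_mulVec,
    ← map_mul, mul_inv_cancel, map_one, Matrix.one_mulVec]
  simp

lemma vslash_one (F : ℍ → ZMod (2 * m) → ℂ) : vslash k 1 F = F := by
  funext τ
  simp [vslash]

lemma vslash_eq_of_generators {F : ℍ → ZMod (2 * m) → ℂ} (hS : vslash k Mp2Z.S F = F)
    (hT : vslash k Mp2Z.T F = F) (g : Mp2Z) : vslash k g F = F := by
  have hg : g ∈ Subgroup.closure ({Mp2Z.S, Mp2Z.T} : Set Mp2Z) := by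
    rw [Mp2Z.closure_S_T]; trivial
  induction hg using Subgroup.closure_induction with
  | mem x hx =>
    rcases hx with rfl | rfl
    · exact hS
    · exact hT
  | one => exact vslash_one F
  | mul x y _ _ hx hy => rw [vslash_mul, hx, hy]
  | inv x _ hx => rw [← hx, ← vslash_mul, mul_inv_cancel, vslash_one, hx]

lemma transform_of_vslash_eq {F : ℍ → ZMod (2 * m) → ℂ} {g : Mp2Z} (h : vslash k g F = F) (τ : ℍ) :
    F (g.mat • τ) = g.phi τ ^ (2 * k + 1) • (weilRepOf m k g *ᵥ F τ) := by
  rw [← smul_mulVec_vslash (k := k) g F τ, h]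

lemma Mp2Z.T_pow_mat (n : ℕ) : (Mp2Z.T ^ n).mat = ModularGroup.T ^ n :=
  map_pow Mp2Z.toSL Mp2Z.T n

lemma Mp2Z.T_pow_phi (n : ℕ) (τ : ℍ) : (Mp2Z.T ^ n).phi τ = 1 := by
  induction n generalizing τ with
  | zero => simp
  | succ n ih => rw [pow_succ, phi_mul, ih]; exact one_mul 1

lemma e_nat_mul (n : ℕ) (z : ℂ) : e (n * z) = e z ^ n := by
  rw [e, e, ← Complex.exp_nat_mul]; congr 1; ring

lemma vslash_T_pow (n : ℕ) (F : ℍ → ZMod (2 * m) → ℂ) (τ : ℍ) (γ : ZMod (2 * m)) :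
    vslash k (Mp2Z.T ^ n) F τ γ =
      e (-(n * ((k.negOnePow : ℤ) * Q m γ))) * F (ModularGroup.T ^ n • τ) γ := by
  have h := congrFun (smul_mulVec_vslash (k := k) (Mp2Z.T ^ n) F τ) γ
  rw [Mp2Z.T_pow_phi, _root_.one_zpow, one_smul, Mp2Z.T_pow_mat, map_pow, weilRepOf_T,
    Matrix.diagonal_pow, Matrix.mulVec_diagonal] at h
  rw [← h, Pi.pow_apply, ← e_nat_mul, ← mul_assoc, ← e_add, neg_add_cancel, e_zero, one_mul]

lemma vslash_S (F : ℍ → ZMod (2 * m) → ℂ) (τ : ℍ) (γ : ZMod (2 * m)) :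
    vslash k Mp2Z.S F τ γ = Mp2Z.S.phi τ ^ (-(2 * k + 1)) *
      ∑ δ, weilRepOf m k Mp2Z.S⁻¹ γ δ * F (ModularGroup.S • τ) δ := rfl

lemma weilRepOf_S_inv_neg (γ δ : ZMod (2 * m)) :
    weilRepOf m k Mp2Z.S⁻¹ (-γ) (-δ) = weilRepOf m k Mp2Z.S⁻¹ γ δ := by
  have hm := m_ne_zero m
  obtain ⟨c, hc⟩ := exists_val_neg γ
  obtain ⟨d, hd⟩ := exists_val_neg δ
  have hc' : ((-γ).val : ℂ) = -γ.val + 2 * m * c := by exact_mod_cast congrArg (Int.cast (R := ℂ)) hc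
  have hd' : ((-δ).val : ℂ) = -δ.val + 2 * m * d := by exact_mod_cast congrArg (Int.cast (R := ℂ)) hd
  rw [weilRepOf_S_inv, weilRepOf_S_inv, hc', hd']
  congr 1
  rw [← e_add_int ((k.negOnePow : ℤ) * ((δ.val : ℂ) * (γ.val : ℂ) / (2 * m)))
    ((k.negOnePow : ℤ) * (-γ.val * d - δ.val * c + 2 * m * c * d))]
  congr 1
  push_cast
  field_simp
  ring

lemma vslash_S_neg {F : ℍ → ZMod (2 * m) → ℂ} (hF : ∀ τ γ, F τ (-γ) = F τ γ) (τ : ℍ)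
    (γ : ZMod (2 * m)) : vslash k Mp2Z.S F τ (-γ) = vslash k Mp2Z.S F τ γ := by
  rw [vslash_S, vslash_S]
  congr 1
  refine Fintype.sum_equiv (Equiv.neg (ZMod (2 * m))) _ _ fun δ => ?_
  rw [Equiv.neg_apply, hF, ← weilRepOf_S_inv_neg, neg_neg]

/-! ### Recovering invariance under S from the sum of the components -/

/-- The sum of the components of `F` behaves like a modular form for `Γ⁰(4m)`. -/
def SumIsModular (k : ℤ) (F : ℍ → ZMod (2 * m) → ℂ) : Prop :=
  ∀ M M' : SL(2, ℤ), IsScaleConj m M M' → ∀ τ, ∑ γ, F (M' • τ) γ =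
    (shimuraSymbol (M 1 0) (M 1 1) : ℂ) * epsilon (M 1 1) ^ (-(2 * k + 1)) *
      (autFactor M' τ ^ (1 / 2 : ℂ)) ^ (2 * k + 1) * ∑ γ, F τ γ

lemma sum_smul_mulVec_principal {M M' : SL(2, ℤ)} (h : IsScaleConj m M M') (x : ZMod (2 * m) → ℂ)
    (τ : ℍ) :
    ∑ γ, ((Mp2Z.principal M').phi τ ^ (2 * k + 1) •
      (weilRepOf m k (Mp2Z.principal M') *ᵥ x)) γ =
    (shimuraSymbol (M 1 0) (M 1 1) : ℂ) * epsilon (M 1 1) ^ (-(2 * k + 1)) *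
      (autFactor M' τ ^ (1 / 2 : ℂ)) ^ (2 * k + 1) * ∑ γ, x γ := by
  simp only [Pi.smul_apply, Matrix.mulVec, dotProduct, smul_eq_mul]
  rw [← Finset.mul_sum, Finset.sum_comm]
  simp only [← Finset.sum_mul, sum_weilRepOf_principal k h]
  rw [← Finset.mul_sum]
  change (autFactor M' τ ^ (1 / 2 : ℂ)) ^ (2 * k + 1) * _ = _
  ring

/-- The constant is the common column sum of an invertible matrix, so it cannot vanish; no
coprimality argument for the Jacobi symbol is needed. -/
lemma IsScaleConj.mult_ne_zero {M M' : SL(2, ℤ)} (h : IsScaleConj m M M') :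
    (shimuraSymbol (M 1 0) (M 1 1) : ℂ) * epsilon (M 1 1) ^ (-(2 * k + 1)) ≠ 0 := by
  intro h0
  have key : ∀ ν, ∑ μ, weilRepOf m k (Mp2Z.principal M') μ ν = 0 := fun ν => by
    rw [sum_weilRepOf_principal k h, h0]
  have h1 : ∑ μ, (weilRepOf m k (Mp2Z.principal M') * weilRepOf m k (Mp2Z.principal M')⁻¹) μ 0 = 1 := by
    rw [← map_mul, mul_inv_cancel, map_one]
    simp [Matrix.one_apply]
  simp only [Matrix.mul_apply] at h1
  rw [Finset.sum_comm] at h1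
  simp only [← Finset.sum_mul, key, zero_mul, Finset.sum_const_zero] at h1
  exact zero_ne_one h1

lemma SumIsModular.sum_vslash {F : ℍ → ZMod (2 * m) → ℂ} (hF : SumIsModular k F)
    {M M' : SL(2, ℤ)} (h : IsScaleConj m M M') (τ : ℍ) :
    ∑ γ, vslash k (Mp2Z.principal M') F τ γ = ∑ γ, F τ γ := by
  have h1 := hF M M' h τ
  have h2 := sum_smul_mulVec_principal (k := k) h (vslash k (Mp2Z.principal M') F τ) τ
  rw [smul_mulVec_vslash] at h2
  change ∑ γ, F (M' • τ) γ = _ at h2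
  rw [h1] at h2
  refine (mul_left_cancel₀ (mul_ne_zero h.mult_ne_zero (zpow_ne_zero _ ?_)) h2).symm
  simp [Complex.cpow_eq_zero_iff, autFactor_ne_zero]

/-- T has φ = 1 and S carries the principal root, so the product is principal without a sign. For ab
≡ 1 mod 4m the upper right entry puts the matrix into Γ⁰(4m), which is why units modulo 4m appear.
-/
lemma T_pow_mul_S_mul_T_pow (a b : ℕ) :
    ∃ M : SL(2, ℤ), Mp2Z.T ^ a * Mp2Z.S * Mp2Z.T ^ b = Mp2Z.principal M ∧ M 0 1 = a * b - 1 := by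
  refine ⟨ModularGroup.T ^ a * ModularGroup.S * ModularGroup.T ^ b, ?_, ?_⟩
  · ext τ
    · rw [Mp2Z.mat_mul, Mp2Z.mat_mul, Mp2Z.T_pow_mat, Mp2Z.T_pow_mat]; rfl
    · rw [Mp2Z.phi_mul, Mp2Z.phi_mul, Mp2Z.T_pow_phi, Mp2Z.T_pow_phi, Mp2Z.T_pow_mat, one_mul, mul_one]
      have hT : ∀ (n : ℕ) (τ : ℍ), autFactor (ModularGroup.T ^ n) τ = 1 := fun n τ => by
        rw [← Mp2Z.T_pow_mat, ← Mp2Z.sq, Mp2Z.T_pow_phi, one_pow]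
      change (ModularGroup.T ^ b • τ : ℍ) ^ (1 / 2 : ℂ) = autFactor _ τ ^ (1 / 2 : ℂ)
      rw [autFactor_mul, autFactor_mul, hT, hT, Mp2Z.autFactor_S, one_mul, mul_one]
  · have h1 := ModularGroup.coe_T_zpow a
    have h2 := ModularGroup.coe_T_zpow b
    rw [zpow_natCast] at h1 h2
    simp only [Matrix.SpecialLinearGroup.coe_mul, h1, h2]
    simp [Matrix.mul_apply, Fin.sum_univ_two, ModularGroup.S]
    ring

/-- With a inverse to b, slashing by T^a S T^b preserves the sum of the components, and F is
invariant under T. So F|S and F have equal sums after slashing by T^b, which weights the components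
by characters. -/
lemma sum_vslash_S_sub {F : ℍ → ZMod (2 * m) → ℂ} (hF : SumIsModular k F)
    (hT : vslash k Mp2Z.T F = F) {b : ZMod (4 * m)} (hb : IsUnit b) (τ : ℍ) :
    ∑ γ, e (-(b.val * ((k.negOnePow : ℤ) * Q m γ))) * (vslash k Mp2Z.S F - F) τ γ = 0 := by
  obtain ⟨u, rfl⟩ := hb
  set a := ((u⁻¹ : (ZMod (4 * m))ˣ) : ZMod (4 * m)).val with ha
  set b := (u : ZMod (4 * m)).val with hb
  obtain ⟨M', hM', h01⟩ := T_pow_mul_S_mul_T_pow a b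
  have hdvd : (4 * m : ℤ) ∣ M' 0 1 := by
    have := (ZMod.intCast_zmod_eq_zero_iff_dvd (M' 0 1) (4 * m)).1 (by
      rw [h01]
      push_cast
      rw [ha, hb, ZMod.natCast_zmod_val, ZMod.natCast_zmod_val, Units.inv_mul, sub_self])
    exact_mod_cast this
  obtain ⟨M, hM⟩ := exists_isScaleConj' hdvd
  have hTn : ∀ n : ℕ, vslash k (Mp2Z.T ^ n) F = F := by
    intro n
    induction n with
    | zero => rw [pow_zero, vslash_one]
    | succ n ih => rw [pow_succ, vslash_mul, ih, hT]
  have hsum : ∀ τ, ∑ γ, vslash k (Mp2Z.T ^ b) (vslash k Mp2Z.S F - F) τ γ = 0 := by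
    intro τ
    have := hF.sum_vslash hM τ
    rw [← hM', vslash_mul, vslash_mul, hTn] at this
    rw [vslash_sub, hTn]
    simp only [Pi.sub_apply, Finset.sum_sub_distrib, this, sub_self]
  have := hsum ((ModularGroup.T ^ b)⁻¹ • τ)
  simpa only [vslash_T_pow, smul_inv_smul] using this

/-- The sign (-1)^k in the exponent is absorbed into the unit, since multiplication by ±1 permutes
the units. -/
lemma stdAddChar_neg_sqMod_mul (u : ZMod (4 * m)) (γ : ZMod (2 * m)) :
    ZMod.stdAddChar (-(sqMod m γ * u)) =
      e (-(((k.negOnePow : ℤ) * u : ZMod (4 * m)).val * ((k.negOnePow : ℤ) * Q m γ))) := by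
  have h1 := stdAddChar_sqMod u.val γ
  have h2 := stdAddChar_sqMod (-u).val γ
  rw [ZMod.natCast_zmod_val] at h1 h2
  rcases negOnePow_cases k with ⟨-, h⟩ | ⟨-, h⟩
  · rw [h, AddChar.map_neg_eq_inv, h1, ← e_neg]
    simp
  · rw [← mul_neg, h, h2]
    simp

/-- This is (ST)³ = S² rearranged. On the metaplectic level the two roots multiply to a root of τ,
and τ ∈ ℍ excludes the sign. -/
lemma TSTST : Mp2Z.T * Mp2Z.S * Mp2Z.T * Mp2Z.S * Mp2Z.T = Mp2Z.S := by
  refine Mp2Z.ext ?_ (funext fun τ => ?_)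
  · change ModularGroup.T * ModularGroup.S * ModularGroup.T * ModularGroup.S * ModularGroup.T =
      ModularGroup.S
    decide
  · change 1 * ((ModularGroup.T • ModularGroup.S • ModularGroup.T • τ : ℍ) : ℂ) ^ (1 / 2 : ℂ) * 1 *
      ((ModularGroup.T • τ : ℍ) : ℂ) ^ (1 / 2 : ℂ) * 1 = (τ : ℂ) ^ (1 / 2 : ℂ)
    have hw : (τ + 1 : ℂ) ≠ 0 := by rw [← coe_T_smul]; exact (ModularGroup.T • τ).ne_zero
    have hprod : ((ModularGroup.T • ModularGroup.S • ModularGroup.T • τ : ℍ) : ℂ) *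
        ((ModularGroup.T • τ : ℍ) : ℂ) = τ := by
      rw [coe_T_smul, Mp2Z.coe_S_smul, coe_T_smul]
      field_simp
      ring
    have := csqrt_mul_of_im_pos
      (v := (ModularGroup.T • ModularGroup.S • ModularGroup.T • τ : ℍ)) (w := (ModularGroup.T • τ : ℍ))
      (ModularGroup.T • ModularGroup.S • ModularGroup.T • τ).ne_zero (ModularGroup.T • τ).im_pos
    rw [hprod, if_neg (fun h => absurd h.2 (not_lt.2 τ.im_pos.le)), one_mul] at this
    rw [this]
    ring

/-- The vector valued form is determined by the sum of its components. -/
theorem vslash_S_eq_self (hm : m = 1 ∨ m.Prime) {F : ℍ → ZMod (2 * m) → ℂ}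
    (hmod : SumIsModular k F) (hT : vslash k Mp2Z.T F = F) (heven : ∀ τ γ, F τ (-γ) = F τ γ) :
    vslash k Mp2Z.S F = F := by
  set E := vslash k Mp2Z.S F - F with hE
  have key : ∀ τ, (m ≠ 2 → E τ = 0) ∧
      (m = 2 → E τ 0 = E τ m ∧ ∀ γ : ZMod (2 * m), γ ≠ 0 → γ ≠ m → E τ γ = 0) := by
    intro τ
    refine even_fun_of_orthogonal hm (fun γ => ?_) fun b hb => ?_
    · simp only [hE, Pi.sub_apply, heven, vslash_S_neg heven]
    · simp only [stdAddChar_neg_sqMod_mul (k := k)]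
      refine sum_vslash_S_sub hmod hT (IsUnit.mul ?_ hb) τ
      rcases negOnePow_cases k with ⟨-, h⟩ | ⟨-, h⟩ <;> simp [h]
  suffices E = 0 from sub_eq_zero.1 this
  by_cases h2 : m = 2
  · subst h2
    have hSF : vslash k Mp2Z.S F = F + E := by rw [hE]; abel
    -- Expand F|TSTST = F|S using F|T = F and F|S = F + E.
    have h1 : vslash k Mp2Z.T E + vslash k Mp2Z.T (vslash k Mp2Z.S (vslash k Mp2Z.T E)) = E := by
      have h := congrArg (fun g => vslash k g F) TSTST
      simp only [vslash_mul, hT, hSF, vslash_add] at h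
      rw [add_assoc] at h
      exact add_left_cancel h
    have hTE : ∀ (G : ℍ → ZMod (2 * 2) → ℂ) τ, vslash k Mp2Z.T G τ 0 = G (ModularGroup.T • τ) 0 ∧
        vslash k Mp2Z.T G τ (2 : ℕ) = -G (ModularGroup.T • τ) (2 : ℕ) := by
      intro G τ
      have h := vslash_T_pow (k := k) 1 G τ
      rw [pow_one, pow_one] at h
      have hv : ((2 : ℕ) : ZMod (2 * 2)).val = 2 := rfl
      constructor
      · rw [h]
        simp [Q, e_zero]
      · have he : e (1 / 2) = -1 := by
          rw [e, ← Complex.exp_pi_mul_I]; congr 1; ring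
        have hQ : e (-((1 : ℕ) * ((k.negOnePow : ℤ) * Q 2 ((2 : ℕ) : ZMod (2 * 2))))) = -1 := by
          simp only [Q, hv]
          rcases negOnePow_cases k with ⟨-, h⟩ | ⟨-, h⟩ <;> rw [h]
          · rw [← he, ← e_add_int _ 1]; congr 1; push_cast; norm_num
          · rw [← he]; congr 1; push_cast; norm_num
        rw [h, hQ, neg_one_mul]
    have hne : (0 : ZMod (2 * 2)) ≠ (2 : ℕ) := by decide
    -- E|T has opposite values at 0 and 2 and vanishes elsewhere, while in rows 0 and 2 the matrix
    -- of S⁻¹ has equal entries in columns 0 and 2. The two contributions cancel.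
    have hSE : ∀ (γ : ZMod (2 * 2)) τ, (γ = 0 ∨ γ = (2 : ℕ)) →
        vslash k Mp2Z.S (vslash k Mp2Z.T E) τ γ = 0 := by
      intro γ τ hγ
      rw [vslash_S, Finset.sum_eq_add (0 : ZMod (2 * 2)) (2 : ℕ) hne, (hTE _ _).1, (hTE _ _).2,
        ((key _).2 rfl).1]
      · have hρ : weilRepOf 2 k Mp2Z.S⁻¹ γ 0 = weilRepOf 2 k Mp2Z.S⁻¹ γ (2 : ℕ) := by
          have hv : ((2 : ℕ) : ZMod (2 * 2)).val = 2 := rfl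
          have hv0 : (0 : ZMod (2 * 2)).val = 0 := rfl
          rw [weilRepOf_S_inv, weilRepOf_S_inv, hv, hv0]
          congr 1
          rcases hγ with rfl | rfl
          · rw [hv0]; simp
          · rw [hv, ← e_add_int _ (k.negOnePow : ℤ)]
            congr 1
            push_cast
            ring
        rw [hρ]
        ring
      · rintro δ - ⟨h0, h2⟩
        have := vslash_T_pow (k := k) 1 E (ModularGroup.S • τ) δ
        rw [pow_one, pow_one, ((key _).2 rfl).2 δ h0 h2, mul_zero] at this
        rw [this, mul_zero]
      · simp
      · simp
    -- For x = E₀ = E₂ the relation `h1` reads x(τ + 1) = x(τ) in component 0 and -x(τ + 1) = x(τ)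
    -- in component 2.
    have hE2 : ∀ τ, E τ (2 : ℕ) = 0 := by
      intro τ
      have e0 := congrFun (congrFun h1 τ) 0
      have e2 := congrFun (congrFun h1 τ) (2 : ℕ)
      rw [Pi.add_apply, Pi.add_apply, (hTE _ _).1, (hTE _ _).1, hSE 0 _ (Or.inl rfl),
        ((key _).2 rfl).1, ((key _).2 rfl).1] at e0
      rw [Pi.add_apply, Pi.add_apply, (hTE _ _).2, (hTE _ _).2, hSE (2 : ℕ) _ (Or.inr rfl)] at e2
      linear_combination (-1 / 2 : ℂ) * e0 - (1 / 2 : ℂ) * e2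
    funext τ γ
    by_cases h0 : γ = 0
    · rw [h0, ((key τ).2 rfl).1]; exact hE2 τ
    · by_cases h2 : γ = (2 : ℕ)
      · rw [h2]; exact hE2 τ
      · exact ((key τ).2 rfl).2 γ h0 h2
  · funext τ
    exact (key τ).1 h2

end

/-! ### Affine substitutions -/

/-- The map `τ ↦ aτ + b`. -/
def affine (a b : ℝ) (ha : 0 < a) (τ : ℍ) : ℍ :=
  ⟨a * τ + b, by
    rw [Complex.add_im, Complex.im_ofReal_mul, Complex.ofReal_im, add_zero]
    exact mul_pos ha τ.im_pos⟩

lemma coe_affine (a b : ℝ) (ha : 0 < a) (τ : ℍ) : (affine a b ha τ : ℂ) = a * τ + b := rfl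

lemma affine_im (a b : ℝ) (ha : 0 < a) (τ : ℍ) : (affine a b ha τ).im = a * τ.im := by
  rw [← UpperHalfPlane.coe_im, coe_affine, Complex.add_im, Complex.im_ofReal_mul, Complex.ofReal_im,
    add_zero, UpperHalfPlane.coe_im]

lemma comp_affine_eqOn (f : ℍ → ℂ) (a b : ℝ) (ha : 0 < a) :
    Set.EqOn ((f ∘ affine a b ha) ∘ ofComplex) (fun z => (f ∘ ofComplex) (a * z + b))
      upperHalfPlaneSet := by
  intro z hz
  have hz' : 0 < (a * z + b : ℂ).im := (affine a b ha ⟨z, hz⟩).im_pos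
  simp only [Function.comp_apply]
  rw [ofComplex_apply_of_im_pos hz, ofComplex_apply_of_im_pos hz']
  rfl

lemma IsSmooth.comp_affine {f : ℍ → ℂ} (hf : IsSmooth f) (a b : ℝ) (ha : 0 < a) :
    IsSmooth (f ∘ affine a b ha) := by
  refine ContDiffOn.congr ?_ (comp_affine_eqOn f a b ha)
  refine ContDiffOn.comp (g := f ∘ ofComplex) (f := fun z : ℂ => a * z + b) hf ?_ ?_
  · have : ContDiff ℝ ∞ fun z : ℂ => (a : ℂ) * z + b :=
      (contDiff_const.mul contDiff_id).add contDiff_const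
    exact this.contDiffOn
  · intro z hz
    exact (affine a b ha ⟨z, hz⟩).im_pos

lemma fderiv_comp_affine (g : ℂ → ℂ) (a b : ℝ) (z v : ℂ) :
    fderiv ℝ (fun w => g (a * w + b)) z v = a * fderiv ℝ g (a * z + b) v := by
  have h1 : (fun w : ℂ => g (a * w + b)) = (fun u => (fun t => g (t + b)) (a • u)) := by
    funext w; simp
  rw [h1, fderiv_comp_smul (𝕜 := ℝ) (f := fun t => g (t + (b : ℂ))) a, fderiv_comp_add_right]
  simp

/-- Every derivative gains a factor a, and y is multiplied by a; in each term of Δ_κ the powers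
balance. -/
lemma hypLaplacian_comp_affine (κ : ℝ) (f : ℍ → ℂ) (a b : ℝ) (ha : 0 < a) (τ : ℍ) :
    hypLaplacian κ (f ∘ affine a b ha) τ = hypLaplacian κ f (affine a b ha τ) := by
  set g := f ∘ ofComplex
  have h0 : ∀ z ∈ upperHalfPlaneSet,
      ((f ∘ affine a b ha) ∘ ofComplex) =ᶠ[𝓝 z] fun z => g (a * z + b) := fun z hz =>
    (comp_affine_eqOn f a b ha).eventuallyEq_of_mem (isOpen_upperHalfPlaneSet.mem_nhds hz)
  have h1 : ∀ v, ∀ z ∈ upperHalfPlaneSet, fderiv ℝ ((f ∘ affine a b ha) ∘ ofComplex) z v =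
      a * fderiv ℝ g (a * z + b) v := fun v z hz => by
    rw [(h0 z hz).fderiv_eq, fderiv_comp_affine]
  have h2 : ∀ v, fderiv ℝ (fun z => fderiv ℝ ((f ∘ affine a b ha) ∘ ofComplex) z v) τ v =
      a * (a * fderiv ℝ (fun z => fderiv ℝ g z v) (a * τ + b) v) := fun v => by
    have : (fun z => fderiv ℝ ((f ∘ affine a b ha) ∘ ofComplex) z v) =ᶠ[𝓝 (τ : ℂ)]
        (a : ℂ) • fun z => fderiv ℝ g (a * z + b) v :=
      Filter.eventuallyEq_of_mem (isOpen_upperHalfPlaneSet.mem_nhds τ.im_pos) (h1 v)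
    rw [this.fderiv_eq, fderiv_const_smul_field]
    have h3 := fderiv_comp_affine (fun z => fderiv ℝ g z v) a b τ v
    rw [← h3]
    rfl
  have h1' : ∀ v, fderiv ℝ ((f ∘ affine a b ha) ∘ ofComplex) τ v =
      a * fderiv ℝ g (a * τ + b) v := fun v => h1 v τ τ.im_pos
  have h2' : ∀ v, fderiv ℝ (fun z => fderiv ℝ ((f ∘ affine a b ha) ∘ ofComplex) z v) τ v =
      a * (a * fderiv ℝ (fun z => fderiv ℝ g z v) (a * τ + b) v) := h2
  unfold hypLaplacian dx dy
  rw [h1', h1', h2', h2', affine_im, coe_affine]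
  push_cast
  ring

/-- The smooth functions that are annihilated by `Δ_κ`. -/
def harmonicFunctions (κ : ℝ) : Submodule ℂ (ℍ → ℂ) where
  carrier := {f | IsSmooth f ∧ ∀ τ, hypLaplacian κ f τ = 0}
  zero_mem' := ⟨IsSmooth.zero, hypLaplacian_zero κ⟩
  add_mem' := fun {f g} hf hg => ⟨hf.1.add hg.1, fun τ => by
    rw [hypLaplacian_add κ hf.1 hg.1, hf.2, hg.2, add_zero]⟩
  smul_mem' := fun c f hf => ⟨hf.1.smul c, fun τ => by rw [hypLaplacian_smul, hf.2, mul_zero]⟩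

lemma comp_affine_mem_harmonicFunctions {κ : ℝ} {f : ℍ → ℂ} (hf : f ∈ harmonicFunctions κ) (a b : ℝ)
    (ha : 0 < a) : f ∘ affine a b ha ∈ harmonicFunctions κ :=
  ⟨hf.1.comp_affine a b ha, fun τ => by rw [hypLaplacian_comp_affine, hf.2]⟩

/-- The functions with a principal part supported on `Λ`. -/
def principalFunctions (Λ : Set ℝ) : Submodule ℂ (ℍ → ℂ) where
  carrier := {f | HasPrincipalPart Λ f}
  zero_mem' := HasPrincipalPart.zero Λ
  add_mem' := fun hf hg => hf.add hg
  smul_mem' := fun c _ hf => hf.smul c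

lemma HasPrincipalPart.of_isBigO {Λ : Set ℝ} {f : ℍ → ℂ} {ε : ℝ} (hε : 0 < ε)
    (h : f =O[atImInfty] fun τ : ℍ => Real.exp (-ε * τ.im)) : HasPrincipalPart Λ f :=
  ⟨0, by simp, ε, hε, by simpa using h⟩

lemma HasPrincipalPart.exp {Λ : Set ℝ} {r : ℝ} (hr : r ∈ Λ) (h0 : r ≤ 0) :
    HasPrincipalPart Λ fun τ => e (r * τ) := by
  refine ⟨Finsupp.single r 1, fun s hs => ?_, 1, one_pos, ?_⟩
  · rw [Finset.mem_singleton.1 (Finsupp.support_single_subset hs)]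
    exact ⟨hr, h0⟩
  · simpa [Finsupp.sum_single_index] using Asymptotics.isBigO_zero _ _

lemma tendsto_affine (a b : ℝ) (ha : 0 < a) : Filter.Tendsto (affine a b ha) atImInfty atImInfty := by
  rw [atImInfty, Filter.tendsto_comap_iff]
  have : UpperHalfPlane.im ∘ affine a b ha = fun τ => a * τ.im := by
    funext τ; exact affine_im a b ha τ
  rw [this]
  exact Filter.Tendsto.const_mul_atTop ha Filter.tendsto_comap

/-- The translation multiplies the coefficient at r by e(rb); the dilation scales the exponents by a
and the decay rate to εa. -/
lemma HasPrincipalPart.comp_affine {Λ : Set ℝ} {f : ℍ → ℂ} (hf : HasPrincipalPart Λ f) (a b : ℝ)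
    (ha : 0 < a) : HasPrincipalPart ((fun r => a * r) '' Λ) (f ∘ affine a b ha) := by
  obtain ⟨P, hP, ε, hε, hO⟩ := hf
  have h1 : HasPrincipalPart ((fun r => a * r) '' Λ)
      ((fun τ : ℍ => f τ - P.sum fun r c => c * e (r * τ)) ∘ affine a b ha) := by
    refine HasPrincipalPart.of_isBigO (ε := ε * a) (by positivity) ?_
    have := hO.comp_tendsto (tendsto_affine a b ha)
    refine this.congr_right fun τ => ?_
    rw [Function.comp_apply, affine_im]
    ring_nf
  have h2 : (∑ r ∈ P.support, (P r * e (r * b)) • fun τ : ℍ => e (((a * r : ℝ) : ℂ) * τ)) ∈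
      principalFunctions ((fun r => a * r) '' Λ) :=
    Submodule.sum_mem _ fun r hr => Submodule.smul_mem _ _
      (HasPrincipalPart.exp ⟨r, (hP r hr).1, rfl⟩ (mul_nonpos_of_nonneg_of_nonpos ha.le (hP r hr).2))
  convert h1.add h2 using 1
  funext τ
  simp only [Function.comp_apply, Pi.add_apply, Finset.sum_apply, Pi.smul_apply, smul_eq_mul, Finsupp.sum]
  rw [eq_comm, sub_add_eq_add_sub, sub_eq_iff_eq_add, add_right_inj]
  refine Finset.sum_congr rfl fun r _ => ?_
  rw [mul_assoc, ← e_add, coe_affine]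
  congr 2
  push_cast
  ring

lemma HasPrincipalPart.mono {Λ Λ' : Set ℝ} {f : ℍ → ℂ} (hf : HasPrincipalPart Λ f) (h : Λ ⊆ Λ') :
    HasPrincipalPart Λ' f := by
  obtain ⟨P, hP, ε, hε, hO⟩ := hf
  exact ⟨P, fun r hr => ⟨h (hP r hr).1, (hP r hr).2⟩, ε, hε, hO⟩

lemma sum_range_e {N : ℕ} (hN : 0 < N) (t : ℤ) :
    ∑ j ∈ Finset.range N, e (j * t / N) = if (N : ℤ) ∣ t then (N : ℂ) else 0 := by
  have hN' : (N : ℂ) ≠ 0 := by exact_mod_cast hN.ne'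
  have hpow : ∀ j : ℕ, e (j * t / N) = e (t / N) ^ j := fun j => by
    rw [← e_nat_mul, mul_div_assoc]
  simp only [hpow]
  split_ifs with h
  · obtain ⟨l, rfl⟩ := h
    have : e (((N * l : ℤ) : ℂ) / N) = 1 := by
      rw [← e_int l]; congr 1; push_cast; field_simp
    simp only [this, one_pow, Finset.sum_const, Finset.card_range, nsmul_eq_mul, mul_one]
  · have hne : e (t / N) ≠ 1 := by
      intro h1
      rw [e, Complex.exp_eq_one_iff] at h1
      obtain ⟨l, hl⟩ := h1
      have h2 : (t / N : ℂ) = l := by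
        have h0 : (2 * Real.pi * Complex.I : ℂ) ≠ 0 := Complex.two_pi_I_ne_zero
        exact mul_left_cancel₀ h0 (by rw [hl]; ring)
      rw [div_eq_iff hN'] at h2
      exact h ⟨l, by rw [mul_comm]; exact_mod_cast h2⟩
    rw [geom_sum_eq hne, ← hpow N, mul_div_assoc, mul_comm (N : ℂ), div_mul_cancel₀ _ hN', e_int,
      sub_self, zero_div]

/-! ### The averaging operator -/

section

variable {m : ℕ} [NeZero m] {k : ℤ}

lemma inv_four_mul_pos (m : ℕ) [NeZero m] : (0 : ℝ) < 1 / (4 * m) := by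
  have : (0 : ℝ) < m := Nat.cast_pos.2 (NeZero.pos m)
  positivity

variable (m k) in
/-- The operator `f ↦ (s(γ) 4m)⁻¹ ∑_{j mod 4m} e(-(-1)^k jγ²/4m) f((τ + j)/4m)`, which extracts the
exponents `n` with `(-1)^k n ≡ γ² mod 4m`. -/
def avg : (ℍ → ℂ) →ₗ[ℂ] (ℍ → ZMod (2 * m) → ℂ) where
  toFun f τ γ := 1 / (4 * m * sFactor m γ) * ∑ j ∈ Finset.range (4 * m),
    e (-(j * ((k.negOnePow : ℤ) * (γ.val : ℂ) ^ 2) / (4 * m))) *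
      f (affine (1 / (4 * m)) (j / (4 * m)) (inv_four_mul_pos m) τ)
  map_add' f g := by
    funext τ γ
    simp only [Pi.add_apply, mul_add, Finset.sum_add_distrib]
  map_smul' c f := by
    funext τ γ
    simp only [Pi.smul_apply, smul_eq_mul, RingHom.id_apply, Finset.mul_sum]
    exact Finset.sum_congr rfl fun j _ => by ring

lemma avg_apply (f : ℍ → ℂ) (γ : ZMod (2 * m)) : (fun τ => avg m k f τ γ) =
    (1 / (4 * m * sFactor m γ)) • ∑ j ∈ Finset.range (4 * m),
    e (-(j * ((k.negOnePow : ℤ) * (γ.val : ℂ) ^ 2) / (4 * m))) •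
      (f ∘ affine (1 / (4 * m)) (j / (4 * m)) (inv_four_mul_pos m)) := by
  funext τ
  simp only [Pi.smul_apply, Finset.sum_apply, Function.comp_apply, smul_eq_mul]
  rfl

variable (m k) in
/-- The condition `(-1)^k n ≡ γ² mod 4m`. -/
abbrev SqCond (γ : ZMod (2 * m)) (n : ℤ) : Prop :=
  (k.negOnePow : ℤ) * n ≡ (γ.val : ℤ) ^ 2 [ZMOD 4 * m]

omit [NeZero m] in
lemma sqCond_iff_dvd (γ : ZMod (2 * m)) (n : ℤ) :
    SqCond m k γ n ↔ ((4 * m : ℕ) : ℤ) ∣ n - (k.negOnePow : ℤ) * (γ.val : ℤ) ^ 2 := by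
  rw [SqCond, Int.modEq_comm, Int.modEq_iff_dvd]
  push_cast
  rcases negOnePow_cases k with ⟨-, h⟩ | ⟨-, h⟩
  · rw [h, one_mul, one_mul]
  · rw [h, ← dvd_neg]
    have : -(-1 * n - (γ.val : ℤ) ^ 2) = n - -1 * (γ.val : ℤ) ^ 2 := by ring
    rw [this]

omit [NeZero m] in
lemma sqCond_iff_sqMod (γ : ZMod (2 * m)) (n : ℤ) :
    SqCond m k γ n ↔ sqMod m γ = (((k.negOnePow : ℤ) * n : ℤ) : ZMod (4 * m)) := by
  rw [eq_comm, intCast_eq_sqMod_iff]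

lemma sum_avg_weights (γ : ZMod (2 * m)) (n : ℤ) (τ : ℍ) :
    ∑ j ∈ Finset.range (4 * m), e (-(j * ((k.negOnePow : ℤ) * (γ.val : ℂ) ^ 2) / (4 * m))) *
      e (n * affine (1 / (4 * m)) (j / (4 * m)) (inv_four_mul_pos m) τ) =
    if SqCond m k γ n then 4 * m * e (n / (4 * m) * τ) else 0 := by
  have hm := m_ne_zero m
  have hpos : 0 < 4 * m := by have := NeZero.pos m; omega
  have h := sum_range_e hpos (n - (k.negOnePow : ℤ) * (γ.val : ℤ) ^ 2)
  have hterm : ∀ j : ℕ, e (-(j * ((k.negOnePow : ℤ) * (γ.val : ℂ) ^ 2) / (4 * m))) *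
      e (n * affine (1 / (4 * m)) (j / (4 * m)) (inv_four_mul_pos m) τ) =
      e (n / (4 * m) * τ) *
        e (j * ((n - (k.negOnePow : ℤ) * (γ.val : ℤ) ^ 2 : ℤ) : ℂ) / ((4 * m : ℕ) : ℂ)) := by
    intro j
    rw [← e_add, ← e_add, coe_affine]
    congr 1
    push_cast
    field_simp
    ring
  simp only [hterm]
  rw [← Finset.mul_sum, h]
  simp only [sqCond_iff_dvd]
  split_ifs
  · push_cast; ring
  · ring

/-- All the translates have the same imaginary part, so the y-dependent coefficient leaves the sum
over j, and the characters select the exponents in the class of γ. -/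
lemma hasSum_avg {f : ℍ → ℂ} {cp cm : ℤ → ℂ} (hf : IsFourierExpansion k f cp cm) (τ : ℍ)
    (γ : ZMod (2 * m)) : HasSum (fun n : ℤ => if SqCond m k γ n then
      coeffAt k cp cm n (τ.im / (4 * m)) * e (n / (4 * m) * τ) else 0)
      (sFactor m γ * avg m k f τ γ) := by
  have hm := m_ne_zero m
  have hs := sFactor_ne_zero γ
  have h1 := hasSum_sum (s := Finset.range (4 * m)) fun j _ =>
    (hf.hasSum (affine (1 / (4 * m)) (j / (4 * m)) (inv_four_mul_pos m) τ)).mul_left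
      (e (-(j * ((k.negOnePow : ℤ) * (γ.val : ℂ) ^ 2) / (4 * m))))
  have h2 : sFactor m γ * avg m k f τ γ = 1 / (4 * m) * ∑ j ∈ Finset.range (4 * m),
    e (-(j * ((k.negOnePow : ℤ) * (γ.val : ℂ) ^ 2) / (4 * m))) *
      f (affine (1 / (4 * m)) (j / (4 * m)) (inv_four_mul_pos m) τ) := by
    simp only [avg, LinearMap.coe_mk, AddHom.coe_mk]
    rw [← mul_assoc]
    congr 1
    field_simp
  rw [h2]
  refine hasSum_of_eq (h1.mul_left _) fun n => ?_
  have h3 : ∀ j : ℕ, e (-(j * ((k.negOnePow : ℤ) * (γ.val : ℂ) ^ 2) / (4 * m))) *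
      (coeffAt k cp cm n (affine (1 / (4 * m)) (j / (4 * m)) (inv_four_mul_pos m) τ).im *
        e (n * affine (1 / (4 * m)) (j / (4 * m)) (inv_four_mul_pos m) τ)) =
      coeffAt k cp cm n (τ.im / (4 * m)) *
        (e (-(j * ((k.negOnePow : ℤ) * (γ.val : ℂ) ^ 2) / (4 * m))) *
        e (n * affine (1 / (4 * m)) (j / (4 * m)) (inv_four_mul_pos m) τ)) := by
    intro j
    rw [affine_im, one_div_mul_eq_div]
    ring
  simp only [h3]
  rw [← Finset.mul_sum, sum_avg_weights]
  split_ifs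
  · field_simp
  · ring

/-- The left side depends on f alone, so any expansion of f may be used and uniqueness of the
coefficients is never invoked. -/
theorem avg_eq_lift {f : ℍ → ℂ} {cp cm : ℤ → ℂ} (hf : IsFourierExpansion k f cp cm) :
    avg m k f = lift m k cp cm := by
  funext τ γ
  have hs := sFactor_ne_zero γ
  have h := (hasSum_subtype_iff_indicator (s := {n : ℤ | SqCond m k γ n})
    (f := fun n : ℤ => coeffAt k cp cm n (τ.im / (4 * m)) * e (n / (4 * m) * τ))).2
    (hasSum_of_eq (hasSum_avg hf τ γ) fun n => by
      by_cases hc : SqCond m k γ n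
      · rw [if_pos hc, Set.indicator_of_mem (s := {n : ℤ | SqCond m k γ n}) hc]
      · rw [if_neg hc, Set.indicator_of_notMem (s := {n : ℤ | SqCond m k γ n}) hc])
  have h' := h.tsum_eq
  rw [lift]
  refine Eq.trans ?_ (congrArg (fun x => 1 / sFactor m γ * x) h'.symm)
  field_simp

lemma exists_sqCond_of_plusCondition {n : ℤ} (h : PlusCondition m k n) : ∃ γ, SqCond m k γ n := by
  obtain ⟨a, ha⟩ := h
  refine ⟨(a : ZMod (2 * m)), ha.trans ?_⟩
  obtain ⟨c, hc⟩ : ∃ c : ℤ, (((a : ZMod (2 * m)).val : ℕ) : ℤ) = a + 2 * m * c := by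
    obtain ⟨c, hc⟩ := (ZMod.intCast_eq_intCast_iff_dvd_sub a ((a : ZMod (2 * m)).val : ℤ) (2 * m)).1
      (by simp)
    exact ⟨c, by push_cast at hc; linear_combination hc⟩
  rw [hc]
  exact Int.modEq_iff_dvd.2 ⟨m * c ^ 2 + a * c, by ring⟩

omit [NeZero m] in
lemma sFactor_neg (γ : ZMod (2 * m)) : sFactor m (-γ) = sFactor m γ := by
  have h2 : ((2 * m : ℕ) : ZMod (2 * m)) = 0 := ZMod.natCast_self _
  push_cast at h2
  have hm : -(m : ZMod (2 * m)) = m := by linear_combination -h2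
  have : (-γ = 0 ∨ -γ = (m : ZMod (2 * m))) ↔ (γ = 0 ∨ γ = (m : ZMod (2 * m))) := by
    rw [neg_eq_zero, neg_eq_iff_eq_neg, hm]
  simp only [sFactor, this]

/-- The classes that fit n are γ and -γ; there are s(γ) of them, each with weight 1/s(γ). -/
lemma sum_sqCond_inv_sFactor (hm : m = 1 ∨ m.Prime) {n : ℤ} (h : PlusCondition m k n) :
    ∑ γ, (if SqCond m k γ n then 1 / sFactor m γ else 0) = 1 := by
  obtain ⟨γ₀, h₀⟩ := exists_sqCond_of_plusCondition h
  rw [sqCond_iff_sqMod] at h₀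
  simp only [sqCond_iff_sqMod, ← h₀]
  rw [sum_sqMod_eq hm (fun γ => by rw [sFactor_neg]), mul_one_div_cancel (sFactor_ne_zero γ₀)]

theorem sum_avg_scale (hm : m = 1 ∨ m.Prime) {f : ℍ → ℂ} {cp cm : ℤ → ℂ}
    (hf : IsFourierExpansion k f cp cm) (hplus : ∀ n, ¬ PlusCondition m k n → cp n = 0 ∧ cm n = 0)
    (τ : ℍ) : ∑ γ, avg m k f (scale m τ) γ = f τ := by
  have hm0 := m_ne_zero m
  have h1 := hasSum_sum (s := Finset.univ) fun γ _ =>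
    (hasSum_avg (m := m) hf (scale m τ) γ).mul_left (1 / sFactor m γ)
  have h2 : ∀ γ, 1 / sFactor m γ * (sFactor m γ * avg m k f (scale m τ) γ) =
      avg m k f (scale m τ) γ := fun γ => by
    have := sFactor_ne_zero γ
    field_simp
  simp only [h2] at h1
  refine h1.unique (hasSum_of_eq (hf.hasSum τ) fun n => ?_)
  have him : (scale m τ).im / (4 * m) = τ.im := by
    have h0 : (m : ℝ) ≠ 0 := Nat.cast_ne_zero.2 (NeZero.ne m)
    have : (scale m τ).im = 4 * m * τ.im := by
      rw [← UpperHalfPlane.coe_im, coe_scale]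
      have : (4 * m * (τ : ℂ)) = ((4 * m : ℝ) : ℂ) * τ := by push_cast; ring
      rw [this, Complex.im_ofReal_mul, UpperHalfPlane.coe_im]
    rw [this]
    field_simp
  have he : e ((n : ℂ) / (4 * m) * scale m τ) = e (n * τ) := by
    rw [coe_scale]; congr 1; field_simp
  rw [him, he]
  by_cases hp : PlusCondition m k n
  · have h3 := sum_sqCond_inv_sFactor hm hp
    refine ((congrArg (· * (coeffAt k cp cm n τ.im * e (n * τ))) h3).trans (one_mul _)).symm.trans ?_
    rw [Finset.sum_mul]
    refine Finset.sum_congr rfl fun γ _ => ?_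
    split_ifs <;> ring
  · have : coeffAt k cp cm n τ.im = 0 := by simp [coeffAt, hplus n hp]
    simp [this]

lemma avg_neg {f : ℍ → ℂ} {cp cm : ℤ → ℂ} (hf : IsFourierExpansion k f cp cm) (τ : ℍ)
    (γ : ZMod (2 * m)) : avg m k f τ (-γ) = avg m k f τ γ := by
  refine mul_left_cancel₀ (sFactor_ne_zero γ) ?_
  refine HasSum.unique ?_ (hasSum_avg hf τ γ)
  have := hasSum_avg hf τ (-γ)
  simpa only [sFactor_neg, sqCond_iff_sqMod, sqMod_neg] using this

lemma e_div_eq_of_sqCond {γ : ZMod (2 * m)} {n : ℤ} (h : SqCond m k γ n) :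
    e (n / (4 * m)) = e ((k.negOnePow : ℤ) * Q m γ) := by
  have hm := m_ne_zero m
  obtain ⟨l, hl⟩ := (sqCond_iff_dvd γ n).1 h
  have hn : (n : ℂ) = (k.negOnePow : ℤ) * (γ.val : ℂ) ^ 2 + 4 * m * l := by
    have : n = (k.negOnePow : ℤ) * (γ.val : ℤ) ^ 2 + 4 * m * l := by
      push_cast at hl
      linear_combination hl
    exact_mod_cast congrArg (Int.cast (R := ℂ)) this
  rw [← e_add_int ((k.negOnePow : ℤ) * Q m γ) l, hn, Q]
  congr 1
  push_cast
  field_simp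

lemma vslash_T_avg {f : ℍ → ℂ} {cp cm : ℤ → ℂ} (hf : IsFourierExpansion k f cp cm) :
    vslash k Mp2Z.T (avg m k f) = avg m k f := by
  funext τ γ
  have h := vslash_T_pow (k := k) 1 (avg m k f) τ γ
  rw [pow_one, pow_one, Nat.cast_one, one_mul] at h
  rw [h]
  refine mul_left_cancel₀ (sFactor_ne_zero γ) ?_
  refine HasSum.unique ?_ (hasSum_avg hf τ γ)
  rw [mul_left_comm]
  refine hasSum_of_eq ((hasSum_avg hf (ModularGroup.T • τ) γ).mul_left _) fun n => ?_
  have him : (ModularGroup.T • τ).im = τ.im := by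
    rw [← UpperHalfPlane.coe_im, coe_T_smul]; simp
  rw [him]
  split_ifs with hc
  · rw [coe_T_smul, mul_add, mul_one, e_add, e_div_eq_of_sqCond hc, e_neg]
    have := e_ne_zero ((k.negOnePow : ℤ) * Q m γ)
    field_simp
  · ring

lemma cpow_add_half (z : ℂ) (k : ℤ) : z ^ ((k : ℂ) + 1 / 2) = (z ^ (1 / 2 : ℂ)) ^ (2 * k + 1) := by
  rw [← Complex.cpow_int_mul]
  congr 1
  push_cast
  ring

lemma sumIsModular_avg (hm : m = 1 ∨ m.Prime) {f : ℍ → ℂ} (hf : IsScalarForm m k f)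
    {cp cm : ℤ → ℂ} (hc : IsFourierExpansion k f cp cm)
    (hplus : ∀ n, ¬ PlusCondition m k n → cp n = 0 ∧ cm n = 0) : SumIsModular k (avg m k f) := by
  intro M M' h τ
  obtain ⟨σ, rfl⟩ := exists_scale_eq (m := m) τ
  have hM : M ∈ CongruenceSubgroup.Gamma0 (4 * m) := by
    rw [CongruenceSubgroup.Gamma0_mem, h.c]
    have := four_mul_natCast_self (m := m)
    push_cast
    rw [this, zero_mul]
  rw [h.smul, sum_avg_scale hm hc hplus, sum_avg_scale hm hc hplus, hf.transform M hM, h.autFactor,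
    cpow_add_half]

lemma avg_e (n : ℤ) (τ : ℍ) (γ : ZMod (2 * m)) : avg m k (fun τ => e (n * τ)) τ γ =
    if SqCond m k γ n then 1 / sFactor m γ * e (n / (4 * m) * τ) else 0 := by
  have hm := m_ne_zero m
  have hs := sFactor_ne_zero γ
  simp only [avg, LinearMap.coe_mk, AddHom.coe_mk]
  rw [sum_avg_weights]
  split_ifs
  · field_simp
  · ring

/-- On the principal part the average annihilates exponents outside the class of γ and sends the
others from n to n/4m. The remainder is averaged term by term and still decays, with rate ε/4m. -/
lemma hasPrincipalPart_avg {f : ℍ → ℂ} (hf : HasPrincipalPart (Set.range fun n : ℤ => (n : ℝ)) f)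
    (γ : ZMod (2 * m)) :
    HasPrincipalPart (Set.range fun n : ℤ => (n : ℝ) + ((k.negOnePow : ℤ) : ℝ) * Q m γ)
      fun τ => avg m k f τ γ := by
  have hm := m_ne_zero m
  obtain ⟨P, hP, ε, hε, hO⟩ := hf
  set Λ := Set.range fun n : ℤ => (n : ℝ) + ((k.negOnePow : ℤ) : ℝ) * Q m γ with hΛ
  set R : ℍ → ℂ := fun τ => f τ - P.sum fun r a => a * e (r * τ) with hR
  have hfR : f = R + ∑ r ∈ P.support, P r • fun τ : ℍ => e (r * τ) := by
    funext τ
    simp only [hR, Pi.add_apply, Finset.sum_apply, Pi.smul_apply, smul_eq_mul, Finsupp.sum]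
    ring
  have h1 : (fun τ => avg m k R τ γ) ∈ principalFunctions Λ := by
    rw [avg_apply]
    refine Submodule.smul_mem _ _ (Submodule.sum_mem _ fun j _ => Submodule.smul_mem _ _ ?_)
    refine HasPrincipalPart.of_isBigO (ε := ε * (1 / (4 * m)))
      (mul_pos hε (inv_four_mul_pos m)) ?_
    refine (hO.comp_tendsto (tendsto_affine _ _ (inv_four_mul_pos m))).congr_right fun τ => ?_
    rw [Function.comp_apply, affine_im]
    ring_nf
  have h2 : ∑ r ∈ P.support, P r • (fun τ : ℍ => avg m k (fun τ => e (r * τ)) τ γ) ∈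
      principalFunctions Λ := by
    refine Submodule.sum_mem _ fun r hr => Submodule.smul_mem _ _ ?_
    obtain ⟨⟨n, hn⟩, hr0⟩ := hP r hr
    have hn' : (r : ℂ) = n := by rw [← hn]; push_cast; rfl
    have hn0 : (n : ℝ) ≤ 0 := by rw [← hn] at hr0; exact hr0
    simp only [hn', avg_e]
    split_ifs with hc
    · refine Submodule.smul_mem (principalFunctions Λ) (1 / sFactor m γ)
        (x := fun τ : ℍ => e (n / (4 * m) * τ)) ?_
      have h0 : (m : ℝ) ≠ 0 := Nat.cast_ne_zero.2 (NeZero.ne m)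
      have h3 := HasPrincipalPart.exp (Λ := Λ) (r := n / (4 * m)) ?_
        (div_nonpos_of_nonpos_of_nonneg hn0 (by positivity))
      · push_cast at h3
        exact h3
      · obtain ⟨l, hl⟩ := (sqCond_iff_dvd γ n).1 hc
        refine ⟨l, ?_⟩
        have hl' : (n : ℝ) - (k.negOnePow : ℤ) * (γ.val : ℝ) ^ 2 = 4 * m * l := by
          exact_mod_cast congrArg (Int.cast (R := ℝ)) hl
        simp only [Q]
        field_simp
        linear_combination -hl'
    · exact Submodule.zero_mem (principalFunctions Λ)
  have h3 : (fun τ => avg m k f τ γ) = (fun τ => avg m k R τ γ) +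
      ∑ r ∈ P.support, P r • (fun τ : ℍ => avg m k (fun τ => e (r * τ)) τ γ) := by
    have h := congrArg (avg m k) hfR
    rw [map_add, map_sum] at h
    simp only [map_smul] at h
    rw [h]
    funext τ
    simp only [Pi.add_apply, Finset.sum_apply, Pi.smul_apply]
  rw [h3]
  exact Submodule.add_mem (principalFunctions Λ) h1 h2

lemma avg_mem_harmonicFunctions {κ : ℝ} {f : ℍ → ℂ} (hf : f ∈ harmonicFunctions κ)
    (γ : ZMod (2 * m)) : (fun τ => avg m k f τ γ) ∈ harmonicFunctions κ := by
  rw [avg_apply]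
  exact Submodule.smul_mem _ _ (Submodule.sum_mem _ fun j _ => Submodule.smul_mem _ _
    (comp_affine_mem_harmonicFunctions hf _ _ _))

theorem isVectorForm_avg (hm : m = 1 ∨ m.Prime) {f : ℍ → ℂ} (hf : f ∈ plusSpace m k) :
    IsVectorForm m k (weilRepOf m k) (fun γ => ((k.negOnePow : ℤ) : ℝ) * Q m γ) (avg m k f) := by
  obtain ⟨hs, cp, cm, hc, hplus⟩ := hf
  have hs : IsScalarForm m k f := hs
  have hh : f ∈ harmonicFunctions ((k : ℝ) + 1 / 2) := ⟨hs.smooth, hs.harmonic⟩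
  have hT := vslash_T_avg (m := m) hc
  have hS := vslash_S_eq_self hm (sumIsModular_avg hm hs hc hplus) hT (avg_neg hc)
  exact
    { smooth := fun γ => (avg_mem_harmonicFunctions hh γ).1
      transform := fun g τ => transform_of_vslash_eq (vslash_eq_of_generators hS hT g) τ
      harmonic := fun γ => (avg_mem_harmonicFunctions hh γ).2
      principalPart := fun γ => hasPrincipalPart_avg hs.principalPart γ }

end

/-! ### Mean values of smooth functions along horizontal lines -/

/-- Smoothness at the points of the upper half-plane. -/
def SmoothOnH (g : ℂ → ℂ) : Prop := ∀ z : ℂ, 0 < z.im → ContDiffAt ℝ ∞ g z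

lemma IsSmooth.smoothOnH {f : ℍ → ℂ} (hf : IsSmooth f) : SmoothOnH (f ∘ ofComplex) :=
  fun z hz => hf.contDiffAt ⟨z, hz⟩

section

variable {g h : ℂ → ℂ}

lemma SmoothOnH.dx (hg : SmoothOnH g) : SmoothOnH (dx g) := fun z hz => contDiffAt_fderiv_apply (hg z hz) 1

lemma SmoothOnH.dy (hg : SmoothOnH g) : SmoothOnH (dy g) :=
  fun z hz => contDiffAt_fderiv_apply (hg z hz) Complex.I

lemma SmoothOnH.mul (hg : SmoothOnH g) (hh : SmoothOnH h) : SmoothOnH (fun z => g z * h z) :=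
  fun z hz => (hg z hz).mul (hh z hz)

lemma SmoothOnH.add (hg : SmoothOnH g) (hh : SmoothOnH h) : SmoothOnH (fun z => g z + h z) :=
  fun z hz => (hg z hz).add (hh z hz)

lemma SmoothOnH.const_mul (c : ℂ) (hg : SmoothOnH g) : SmoothOnH (fun z => c * g z) :=
  fun z hz => contDiffAt_const.mul (hg z hz)

lemma im_add_mul_I (x y : ℝ) : (x + y * Complex.I : ℂ).im = y := by simp

lemma SmoothOnH.hasFDerivAt (hg : SmoothOnH g) {z : ℂ} (hz : 0 < z.im) : HasFDerivAt g (fderiv ℝ g z) z :=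
  ((hg z hz).differentiableAt (by simp)).hasFDerivAt

lemma SmoothOnH.hasDerivAt_dx (hg : SmoothOnH g) (x : ℝ) {y : ℝ} (hy : 0 < y) :
    HasDerivAt (fun t : ℝ => g (t + y * Complex.I)) (HalfMaass.dx g (x + y * Complex.I)) x := by
  have h1 : HasDerivAt (fun t : ℝ => (t + y * Complex.I : ℂ)) 1 x :=
    (Complex.ofRealCLM.hasDerivAt (x := x)).add_const _
  exact (hg.hasFDerivAt (by rwa [im_add_mul_I])).comp_hasDerivAt x h1

lemma SmoothOnH.hasDerivAt_dy (hg : SmoothOnH g) (x : ℝ) {y : ℝ} (hy : 0 < y) :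
    HasDerivAt (fun t : ℝ => g (x + t * Complex.I)) (HalfMaass.dy g (x + y * Complex.I)) y := by
  have h1 : HasDerivAt (fun t : ℝ => (x + t * Complex.I : ℂ)) Complex.I y := by
    have := ((Complex.ofRealCLM.hasDerivAt (x := y)).mul_const Complex.I).const_add (x : ℂ)
    simpa using this
  exact (hg.hasFDerivAt (by rwa [im_add_mul_I])).comp_hasDerivAt y h1

lemma SmoothOnH.continuous_horizontal (hg : SmoothOnH g) {y : ℝ} (hy : 0 < y) :
    Continuous fun x : ℝ => g (x + y * Complex.I) :=
  continuous_iff_continuousAt.2 fun x => (hg.hasDerivAt_dx x hy).continuousAt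

/-- The integral of `g` over the horizontal segment from `iy` to `1 + iy`. -/
def mean (g : ℂ → ℂ) (y : ℝ) : ℂ := ∫ x in (0 : ℝ)..1, g (x + y * Complex.I)

lemma mean_congr {y : ℝ} (hgh : ∀ x : ℝ, g (x + y * Complex.I) = h (x + y * Complex.I)) :
    mean g y = mean h y :=
  intervalIntegral.integral_congr fun x _ => hgh x

lemma mean_add (hg : SmoothOnH g) (hh : SmoothOnH h) {y : ℝ} (hy : 0 < y) :
    mean (fun z => g z + h z) y = mean g y + mean h y :=
  intervalIntegral.integral_add ((hg.continuous_horizontal hy).intervalIntegrable _ _)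
    ((hh.continuous_horizontal hy).intervalIntegrable _ _)

lemma mean_const_mul (c : ℂ) (g : ℂ → ℂ) (y : ℝ) : mean (fun z => c * g z) y = c * mean g y :=
  intervalIntegral.integral_const_mul _ _

/-- Differentiation under the integral sign, dominated by the maximum of the y-derivative on the
compact rectangle [0, 1] × [y/2, 2y]. -/
lemma hasDerivAt_mean (hg : SmoothOnH g) {y : ℝ} (hy : 0 < y) : HasDerivAt (mean g) (mean (dy g) y) y := by
  have hcpt : IsCompact (Set.uIcc (0 : ℝ) 1 ×ˢ Set.Icc (y / 2) (2 * y)) :=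
    isCompact_uIcc.prod isCompact_Icc
  have hcont : ContinuousOn (fun p : ℝ × ℝ => dy g (p.1 + p.2 * Complex.I))
      (Set.uIcc (0 : ℝ) 1 ×ˢ Set.Icc (y / 2) (2 * y)) := by
    intro p hp
    have hp2 : 0 < p.2 := lt_of_lt_of_le (by positivity) hp.2.1
    refine ContinuousAt.continuousWithinAt ?_
    refine ContinuousAt.comp (f := fun p : ℝ × ℝ => (p.1 + p.2 * Complex.I : ℂ)) (g := dy g) ?_ ?_
    · exact (hg.dy _ (by rwa [im_add_mul_I])).continuousAt
    · fun_prop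
  obtain ⟨M, hM⟩ := hcpt.exists_bound_of_continuousOn hcont
  refine (intervalIntegral.hasDerivAt_integral_of_dominated_loc_of_deriv_le
    (F := fun (y x : ℝ) => g (x + y * Complex.I)) (F' := fun (y x : ℝ) => dy g (x + y * Complex.I))
    (s := Set.Ioo (y / 2) (2 * y)) (bound := fun _ => M)
    (Ioo_mem_nhds (by linarith) (by linarith)) ?_ ?_ ?_ ?_ ?_ ?_).2
  · filter_upwards [lt_mem_nhds hy] with t ht
    exact (hg.continuous_horizontal ht).aestronglyMeasurable
  · exact (hg.continuous_horizontal hy).intervalIntegrable _ _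
  · exact (hg.dy.continuous_horizontal hy).aestronglyMeasurable
  · refine Filter.Eventually.of_forall fun x hx t ht => ?_
    exact hM (x, t) ⟨Set.uIoc_subset_uIcc hx, Set.Ioo_subset_Icc_self ht⟩
  · exact intervalIntegrable_const
  · refine Filter.Eventually.of_forall fun x _ t ht => ?_
    exact hg.hasDerivAt_dy x (lt_trans (by positivity) ht.1)

lemma mean_dx (hg : SmoothOnH g) (hper : ∀ z, g (z + 1) = g z) {y : ℝ} (hy : 0 < y) :
    mean (dx g) y = 0 := by
  have := intervalIntegral.integral_eq_sub_of_hasDerivAt (a := 0) (b := 1)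
    (fun x _ => hg.hasDerivAt_dx x hy) ((hg.dx.continuous_horizontal hy).intervalIntegrable _ _)
  rw [mean, this, sub_eq_zero]
  have h := hper ((0 : ℝ) + y * Complex.I)
  rw [← h]
  congr 1
  push_cast
  ring

lemma fderiv_periodic (hper : ∀ z, g (z + 1) = g z) (v z : ℂ) :
    fderiv ℝ g (z + 1) v = fderiv ℝ g z v := by
  rw [← fderiv_comp_add_right, show (fun x => g (x + 1)) = g from funext hper]

/-! ### Fourier coefficients along horizontal lines -/

/-- The coefficient at `q^n` of the restriction of `g` to the line `Im z = y`. -/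
def coef (n : ℤ) (g : ℂ → ℂ) (y : ℝ) : ℂ := mean (fun z => e (-(n * z)) * g z) y

lemma hasFDerivAt_e_neg (n : ℤ) (z : ℂ) : HasFDerivAt (fun z => e (-(n * z)))
    ((e (-(n * z)) * (-(2 * Real.pi * Complex.I * n)) : ℂ) • (ContinuousLinearMap.id ℝ ℂ)) z := by
  have h1 : HasDerivAt (fun z => e (-(n * z))) (e (-(n * z)) * (-(2 * Real.pi * Complex.I * n))) z := by
    have h0 : HasDerivAt (fun z : ℂ => 2 * Real.pi * Complex.I * (-(n * z)))
        (-(2 * Real.pi * Complex.I * n)) z := by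
      have := ((hasDerivAt_id z).const_mul (n : ℂ)).neg.const_mul (2 * Real.pi * Complex.I : ℂ)
      exact this.congr_deriv (by ring)
    exact h0.cexp
  have h2 := h1.hasFDerivAt.restrictScalars ℝ
  refine h2.congr_fderiv ?_
  ext v
  simp [mul_comm]

lemma smoothOnH_e_neg (n : ℤ) : SmoothOnH fun z => e (-(n * z)) := by
  intro z _
  have : ContDiff ℂ ∞ fun z : ℂ => e (-(n * z)) := by
    unfold e
    fun_prop
  exact (this.restrict_scalars ℝ).contDiffAt

lemma e_neg_periodic (n : ℤ) (z : ℂ) : e (-(n * (z + 1))) = e (-(n * z)) := by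
  rw [← e_add_int (-(n * z)) (-n)]
  congr 1
  push_cast
  ring

lemma fderiv_e_neg_mul (hg : SmoothOnH g) (n : ℤ) {z : ℂ} (hz : 0 < z.im) (v : ℂ) :
    fderiv ℝ (fun z => e (-(n * z)) * g z) z v =
      e (-(n * z)) * fderiv ℝ g z v - 2 * Real.pi * Complex.I * n * v * (e (-(n * z)) * g z) := by
  rw [show (fun z => e (-(n * z)) * g z) = (fun z => e (-(n * z))) * g from rfl,
    ((hasFDerivAt_e_neg n z).mul (hg.hasFDerivAt hz)).fderiv]
  simp only [_root_.add_apply, FunLike.coe_smul, Pi.smul_apply,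
    ContinuousLinearMap.coe_id', id_eq, smul_eq_mul]
  ring

lemma SmoothOnH.e_neg_mul (hg : SmoothOnH g) (n : ℤ) : SmoothOnH fun z => e (-(n * z)) * g z :=
  (smoothOnH_e_neg n).mul hg

lemma coef_congr {n : ℤ} {y : ℝ} (h' : ∀ x : ℝ, g (x + y * Complex.I) = h (x + y * Complex.I)) :
    coef n g y = coef n h y :=
  mean_congr (y := y) fun x => by rw [h']

lemma coef_add (n : ℤ) (hg : SmoothOnH g) (hh : SmoothOnH h) {y : ℝ} (hy : 0 < y) :
    coef n (fun z => g z + h z) y = coef n g y + coef n h y := by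
  rw [coef, coef, coef, ← mean_add (hg.e_neg_mul n) (hh.e_neg_mul n) hy]
  simp only [mul_add]

lemma coef_const_mul (n : ℤ) (c : ℂ) (g : ℂ → ℂ) (y : ℝ) :
    coef n (fun z => c * g z) y = c * coef n g y := by
  rw [coef, coef, ← mean_const_mul]
  simp only [mul_left_comm]

/-- Integration by parts, in the form that the mean of the x-derivative of a periodic function is
zero. -/
lemma coef_dx (hg : SmoothOnH g) (hper : ∀ z, g (z + 1) = g z) (n : ℤ) {y : ℝ} (hy : 0 < y) :
    coef n (dx g) y = 2 * Real.pi * Complex.I * n * coef n g y := by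
  have h1 := mean_dx (hg.e_neg_mul n) (fun z => by rw [e_neg_periodic, hper]) hy
  have h2 : mean (dx fun z => e (-(n * z)) * g z) y =
      mean (fun z => e (-(n * z)) * dx g z +
        -(2 * Real.pi * Complex.I * n) * (e (-(n * z)) * g z)) y :=
    mean_congr fun x => by
      refine (fderiv_e_neg_mul hg n (by rwa [im_add_mul_I]) 1).trans ?_
      rw [dx]; ring
  rw [h2, mean_add (hg.dx.e_neg_mul n) ((hg.e_neg_mul n).const_mul _) hy, mean_const_mul] at h1
  rw [coef, coef]
  linear_combination h1

lemma hasDerivAt_coef (hg : SmoothOnH g) (n : ℤ) {y : ℝ} (hy : 0 < y) :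
    HasDerivAt (coef n g) (coef n (dy g) y + 2 * Real.pi * n * coef n g y) y := by
  have h1 := hasDerivAt_mean (hg.e_neg_mul n) hy
  have h2 : mean (dy fun z => e (-(n * z)) * g z) y =
      mean (fun z => e (-(n * z)) * dy g z + (2 * Real.pi * n) * (e (-(n * z)) * g z)) y :=
    mean_congr fun x => by
      refine (fderiv_e_neg_mul hg n (by rwa [im_add_mul_I]) Complex.I).trans ?_
      rw [dy]
      linear_combination (-2 * Real.pi * n * (e (-(n * (x + y * Complex.I))) *
        g (x + y * Complex.I))) * Complex.I_mul_I
  rw [h2, mean_add (hg.dy.e_neg_mul n) ((hg.e_neg_mul n).const_mul _) hy, mean_const_mul] at h1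
  exact h1

/-! ### The differential equation for the Fourier coefficients -/

/-- `∂g/∂x + i ∂g/∂y`. -/
def dbar (g : ℂ → ℂ) (z : ℂ) : ℂ := dx g z + Complex.I * dy g z

lemma SmoothOnH.dbar (hg : SmoothOnH g) : SmoothOnH (dbar g) := hg.dx.add (hg.dy.const_mul _)

/-- The factor e(-nz) is holomorphic, so `dbar` passes through it; and ∂/∂y equals -i `dbar` up to a
multiple of ∂/∂x, which has mean zero. -/
lemma hasDerivAt_coef_dbar (hg : SmoothOnH g) (hper : ∀ z, g (z + 1) = g z) (n : ℤ) {y : ℝ}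
    (hy : 0 < y) : HasDerivAt (coef n g) (-Complex.I * coef n (dbar g) y) y := by
  convert hasDerivAt_coef hg n hy using 1
  have : coef n (dbar g) y = coef n (dx g) y + Complex.I * coef n (dy g) y := by
    rw [← coef_const_mul, ← coef_add n hg.dx (hg.dy.const_mul _) hy]
    rfl
  rw [this, coef_dx hg hper n hy]
  linear_combination (-(2 * Real.pi * n * coef n g y) - coef n (dy g) y) * Complex.I_mul_I

lemma dx_dy (hg : SmoothOnH g) {z : ℂ} (hz : 0 < z.im) : dx (dy g) z = dy (dx g) z := by
  have hsym : IsSymmSndFDerivAt ℝ g z := (hg z hz).isSymmSndFDerivAt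
    (by rw [minSmoothness_of_isRCLikeNormedField]; exact WithTop.coe_le_coe.2 le_top)
  have hd : DifferentiableAt ℝ (fderiv ℝ g) z :=
    ((hg z hz).fderiv_right (m := ∞) (by simp)).differentiableAt (by simp)
  have key : ∀ v w, fderiv ℝ (fun z => fderiv ℝ g z v) z w = fderiv ℝ (fderiv ℝ g) z w v := fun v w => by
    rw [fderiv_clm_apply hd (differentiableAt_const v)]
    simp
  change fderiv ℝ (fun z => fderiv ℝ g z Complex.I) z 1 = fderiv ℝ (fun z => fderiv ℝ g z 1) z Complex.I
  rw [key, key]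
  exact hsym 1 Complex.I

lemma dbar_periodic (hper : ∀ z, g (z + 1) = g z) (z : ℂ) : dbar g (z + 1) = dbar g z := by
  simp only [dbar, dx, dy, fderiv_periodic hper]

lemma fderiv_dbar (hg : SmoothOnH g) {z : ℂ} (hz : 0 < z.im) (v : ℂ) :
    fderiv ℝ (dbar g) z v = fderiv ℝ (dx g) z v + Complex.I * fderiv ℝ (dy g) z v := by
  have h1 := hg.dx.hasFDerivAt hz
  have h2 := (hg.dy.hasFDerivAt hz).const_mul Complex.I
  have h3 : HasFDerivAt (dbar g) (fderiv ℝ (dx g) z + Complex.I • fderiv ℝ (dy g) z) z := h1.add h2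
  rw [h3.fderiv]
  simp

/-- Applying ∂/∂x - i∂/∂y to `dbar` g gives the Euclidean Laplacian, so harmonicity says y(∂/∂x -
i∂/∂y) `dbar` g = iκ `dbar` g. On coefficients ∂/∂x contributes 2πn, and the derivative of e(-nz)
another 2πn. -/
lemma hasDerivAt_coef_of_harmonic {κ : ℝ} {f : ℍ → ℂ} (hf : f ∈ harmonicFunctions κ)
    (hper : ∀ z, (f ∘ ofComplex) (z + 1) = (f ∘ ofComplex) z) (n : ℤ) {y : ℝ} (hy : 0 < y) :
    HasDerivAt (coef n (dbar (f ∘ ofComplex)))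
      ((4 * Real.pi * n - κ / y : ℝ) * coef n (dbar (f ∘ ofComplex)) y) y := by
  have hg := hf.1.smoothOnH
  set g := f ∘ ofComplex with hgdef
  convert hasDerivAt_coef hg.dbar n hy using 1
  have hyC : (y : ℂ) ≠ 0 := by exact_mod_cast hy.ne'
  have h1 : coef n (dy (dbar g)) y =
      coef n (fun z => -Complex.I * dx (dbar g) z + -(κ / y : ℂ) * dbar g z) y := by
    refine coef_congr fun x => ?_
    set z : ℂ := x + y * Complex.I with hz
    have hzim : 0 < z.im := by rwa [hz, im_add_mul_I]
    have hz' : z.im = y := by rw [hz, im_add_mul_I]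
    have hlap := hf.2 ⟨z, hzim⟩
    rw [hypLaplacian, UpperHalfPlane.coe_mk, ← hgdef] at hlap
    change -(z.im : ℂ) ^ 2 * _ + Complex.I * κ * z.im * _ = 0 at hlap
    rw [hz'] at hlap
    have e1 : dy (dbar g) z = dy (dx g) z + Complex.I * dy (dy g) z := fderiv_dbar hg hzim _
    have e2 : dx (dbar g) z = dx (dx g) z + Complex.I * dx (dy g) z := fderiv_dbar hg hzim _
    have e3 := dx_dy hg hzim
    have hlap' : y * (dx (dx g) z + dy (dy g) z) = Complex.I * κ * dbar g z := by
      refine mul_left_cancel₀ hyC ?_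
      rw [dbar]
      linear_combination -hlap
    refine mul_left_cancel₀ hyC ?_
    rw [e1, e2, ← e3, mul_add (y : ℂ) (-Complex.I * _), ← mul_assoc (y : ℂ) (-(κ / y : ℂ)), mul_neg (y : ℂ),
      mul_div_cancel₀ _ hyC]
    linear_combination Complex.I * hlap' + (κ * dbar g z + y * dx (dy g) z) * Complex.I_mul_I
  rw [h1, coef_add n (hg.dbar.dx.const_mul _) (hg.dbar.const_mul _) hy, coef_const_mul, coef_const_mul,
    coef_dx hg.dbar (dbar_periodic hper) n hy]
  push_cast
  linear_combination (2 * Real.pi * n * coef n (dbar g) y) * Complex.I_mul_I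

end

/-! ### Solutions of the differential equation -/

/-- `y ↦ y^{-κ} e^{λy}`. -/
def ode (κ l y : ℝ) : ℝ := y ^ (-κ) * Real.exp (l * y)

lemma ode_pos (κ l : ℝ) {y : ℝ} (hy : 0 < y) : 0 < ode κ l y :=
  mul_pos (Real.rpow_pos_of_pos hy _) (Real.exp_pos _)

lemma eq_const_of_hasDerivAt_zero {b : ℝ → ℂ} (h : ∀ y, 0 < y → HasDerivAt b 0 y) :
    ∃ C, ∀ y, 0 < y → b y = C := by
  obtain ⟨C, hC⟩ := isOpen_Ioi.exists_is_const_of_deriv_eq_zero (isPreconnected_Ioi (a := (0 : ℝ)))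
    (fun y hy => (h y hy).differentiableAt.differentiableWithinAt) (fun y hy => (h y hy).deriv)
  exact ⟨C, fun y hy => hC y hy⟩

lemma eq_const_mul_ode {κ l : ℝ} {b : ℝ → ℂ}
    (h : ∀ y, 0 < y → HasDerivAt b ((l - κ / y : ℝ) * b y) y) :
    ∃ C : ℂ, ∀ y, 0 < y → b y = C * ode κ l y := by
  have hd : ∀ y : ℝ, 0 < y → HasDerivAt (fun y => (ode (-κ) (-l) y : ℂ))
      ((κ / y - l : ℝ) * ode (-κ) (-l) y : ℝ) y := fun y hy => by
    have h1 := (Real.hasDerivAt_rpow_const (x := y) (p := κ) (Or.inl hy.ne')).mul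
      (((hasDerivAt_id y).const_mul (-l)).exp)
    have h2 : HasDerivAt (ode (-κ) (-l)) ((κ / y - l : ℝ) * ode (-κ) (-l) y) y := by
      have : ode (-κ) (-l) = fun y => y ^ κ * Real.exp (-l * y) := by
        funext y; rw [ode, neg_neg]
      rw [this]
      refine h1.congr_deriv ?_
      rw [Real.rpow_sub_one hy.ne']
      simp only [id]
      ring
    exact h2.ofReal_comp
  obtain ⟨C, hC⟩ := eq_const_of_hasDerivAt_zero (b := fun y => b y * ode (-κ) (-l) y) fun y hy => by
    refine ((h y hy).mul (hd y hy)).congr_deriv ?_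
    push_cast
    ring
  refine ⟨C, fun y hy => ?_⟩
  have h1 : ode (-κ) (-l) y * ode κ l y = 1 := by
    rw [ode, ode, neg_neg, mul_mul_mul_comm, ← Real.rpow_add hy, ← Real.exp_add]
    simp
  rw [← hC y hy, mul_assoc, ← Complex.ofReal_mul, h1, Complex.ofReal_one, mul_one]

lemma rpow_le_rpow_abs {t y : ℝ} (κ : ℝ) (ht : 1 ≤ t) (hty : t ≤ y) : t ^ κ ≤ y ^ |κ| :=
  (Real.rpow_le_rpow_of_exponent_le ht (le_abs_self κ)).trans
    (Real.rpow_le_rpow (by linarith) hty (abs_nonneg κ))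

/-- If C ≠ 0, the increments of b over [y, y + 1] have size about y^(-κ) e^(ly), more than the bound
allows when l ≥ 0. In the application l = 4πn, and a remainder O(e^(-εy)) in f costs e^((2πn - ε)y)
in the coefficient, whence l/2. -/
lemma eq_zero_of_hasDerivAt_ode {κ l ε K A : ℝ} {b : ℝ → ℂ} {C p : ℂ} (hl : 0 ≤ l) (hε : 0 < ε)
    (hb : ∀ y, 0 < y → HasDerivAt b (C * ode κ l y) y)
    (hK : ∀ y, A ≤ y → ‖b y - p‖ ≤ K * Real.exp ((l / 2 - ε) * y)) : C = 0 := by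
  by_contra hC
  -- The mean value theorem needs a real function; pairing with the conjugate of C gives a
  -- derivative that is |C|² times a positive function.
  set β : ℝ → ℝ := fun y => ((starRingEnd ℂ) C * b y).re with hβ
  have hβd : ∀ y, 0 < y → HasDerivAt β (‖C‖ ^ 2 * ode κ l y) y := fun y hy => by
    have h1 := Complex.reCLM.hasFDerivAt.comp_hasDerivAt y ((hb y hy).const_mul ((starRingEnd ℂ) C))
    refine h1.congr_deriv ?_
    rw [← mul_assoc, mul_comm _ C, Complex.mul_conj, ← Complex.ofReal_mul, Complex.reCLM_apply,
      Complex.ofReal_re, Complex.normSq_eq_norm_sq]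
  have hK0 : 0 ≤ K := by
    by_contra! h
    have := (norm_nonneg _).trans (hK A le_rfl)
    nlinarith [Real.exp_pos ((l / 2 - ε) * A)]
  have key : ∀ y, max A 1 ≤ y →
      ‖C‖ ≤ K * (1 + Real.exp (l / 2)) * Real.exp ε * ((y + 1) ^ |κ| * Real.exp (-ε * (y + 1))) := by
    intro y hy
    have hyA : A ≤ y := (le_max_left _ _).trans hy
    have hy1 : 1 ≤ y := (le_max_right _ _).trans hy
    obtain ⟨t, ⟨ht1, ht2⟩, ht⟩ := exists_hasDerivAt_eq_slope β (fun y => ‖C‖ ^ 2 * ode κ l y)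
      (show y < y + 1 by linarith)
      (fun t ht => (hβd t (by linarith [ht.1])).continuousAt.continuousWithinAt)
      (fun t ht => hβd t (by linarith [ht.1]))
    rw [add_sub_cancel_left, div_one] at ht
    have h1 : β (y + 1) - β y ≤ ‖C‖ * (K * (1 + Real.exp (l / 2)) * Real.exp ((l / 2 - ε) * y)) := by
      have e1 : β (y + 1) - β y = ((starRingEnd ℂ) C * ((b (y + 1) - p) - (b y - p))).re := by
        rw [hβ, ← Complex.sub_re, ← mul_sub]
        congr 2
        ring
      rw [e1]
      refine (Complex.re_le_norm _).trans ?_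
      rw [norm_mul, RCLike.norm_conj]
      refine mul_le_mul_of_nonneg_left ((norm_sub_le _ _).trans ?_) (norm_nonneg _)
      have h2 := hK y hyA
      have h3 := hK (y + 1) (by linarith)
      have h4 : Real.exp ((l / 2 - ε) * (y + 1)) ≤ Real.exp (l / 2) * Real.exp ((l / 2 - ε) * y) := by
        rw [← Real.exp_add]
        exact Real.exp_le_exp.2 (by linarith)
      have h5 := mul_le_mul_of_nonneg_left h4 hK0
      linarith
    rw [← ht] at h1
    have hC0 : 0 < ‖C‖ := norm_pos_iff.2 hC
    have h6 : ‖C‖ * ode κ l t ≤ K * (1 + Real.exp (l / 2)) * Real.exp ((l / 2 - ε) * y) := by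
      refine le_of_mul_le_mul_left ?_ hC0
      rw [← mul_assoc, ← pow_two]
      exact h1
    have h7 : ode κ l t * (t ^ κ * Real.exp (-l * t)) = 1 := by
      rw [ode, mul_mul_mul_comm, ← Real.rpow_add (by linarith), ← Real.exp_add]
      simp
    have h8 : t ^ κ * Real.exp (-l * t) ≤ (y + 1) ^ |κ| * Real.exp (-l * y) :=
      mul_le_mul (rpow_le_rpow_abs κ (by linarith) ht2.le) (Real.exp_le_exp.2 (by nlinarith))
        (Real.exp_pos _).le (by positivity)
    calc ‖C‖ = ‖C‖ * ode κ l t * (t ^ κ * Real.exp (-l * t)) := by rw [mul_assoc, h7, mul_one]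
      _ ≤ K * (1 + Real.exp (l / 2)) * Real.exp ((l / 2 - ε) * y) *
          ((y + 1) ^ |κ| * Real.exp (-l * y)) := by
        refine mul_le_mul h6 h8 ?_ (by positivity)
        exact mul_nonneg (Real.rpow_nonneg (by linarith) _) (Real.exp_pos _).le
      _ = K * (1 + Real.exp (l / 2)) * (y + 1) ^ |κ| *
          (Real.exp ((l / 2 - ε) * y) * Real.exp (-l * y)) := by ring
      _ ≤ K * (1 + Real.exp (l / 2)) * (y + 1) ^ |κ| * (Real.exp ε * Real.exp (-ε * (y + 1))) := by
        refine mul_le_mul_of_nonneg_left ?_ (by positivity)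
        rw [← Real.exp_add, ← Real.exp_add]
        exact Real.exp_le_exp.2 (by nlinarith)
      _ = _ := by ring
  have hlim : Filter.Tendsto (fun y : ℝ => K * (1 + Real.exp (l / 2)) * Real.exp ε *
      ((y + 1) ^ |κ| * Real.exp (-ε * (y + 1)))) Filter.atTop (𝓝 0) := by
    have := ((tendsto_rpow_mul_exp_neg_mul_atTop_nhds_zero |κ| ε hε).comp
      (Filter.tendsto_atTop_add_const_right _ (1 : ℝ) Filter.tendsto_id)).const_mul
        (K * (1 + Real.exp (l / 2)) * Real.exp ε)
    simpa using! this
  have := ge_of_tendsto hlim (Filter.eventually_atTop.2 ⟨_, key⟩)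
  exact hC (norm_le_zero_iff.1 this)

/-! ### The incomplete Gamma function -/

lemma integrableOn_incGamma (a : ℝ) {y : ℝ} (hy : 0 < y) :
    MeasureTheory.IntegrableOn (fun t : ℝ => Real.exp (-t) * t ^ (a - 1)) (Set.Ioi y) := by
  refine integrable_of_isBigO_exp_neg (b := 1 / 2) (by norm_num) ?_
    (Real.Gamma_integrand_isLittleO _).isBigO
  intro t ht
  refine ContinuousAt.continuousWithinAt ?_
  have : t ≠ 0 := (lt_of_lt_of_le hy ht).ne'
  exact (Real.continuous_exp.comp continuous_neg).continuousAt.mul (Real.continuousAt_rpow_const _ _ (Or.inl this))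

lemma incGamma_eq (a : ℝ) {y : ℝ} (hy : 0 < y) :
    incGamma a y = incGamma a 1 - ∫ t in (1 : ℝ)..y, Real.exp (-t) * t ^ (a - 1) := by
  have := intervalIntegral.integral_interval_add_Ioi (integrableOn_incGamma a one_pos)
    (integrableOn_incGamma a hy)
  rw [incGamma, incGamma]
  linarith

lemma hasDerivAt_incGamma (a : ℝ) {y : ℝ} (hy : 0 < y) :
    HasDerivAt (incGamma a) (-(Real.exp (-y) * y ^ (a - 1))) y := by
  have hcont : ∀ t : ℝ, 0 < t → ContinuousAt (fun t : ℝ => Real.exp (-t) * t ^ (a - 1)) t := fun t ht =>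
    (Real.continuous_exp.comp continuous_neg).continuousAt.mul
      (Real.continuousAt_rpow_const _ _ (Or.inl ht.ne'))
  have hco : ContinuousOn (fun t : ℝ => Real.exp (-t) * t ^ (a - 1)) (Set.Ioi 0) :=
    fun t ht => (hcont t ht).continuousWithinAt
  have h1 := intervalIntegral.integral_hasDerivAt_right (a := 1) (b := y)
    ((hco.mono fun t ht => lt_of_lt_of_le (lt_min one_pos hy) ht.1).intervalIntegrable)
    (hco.stronglyMeasurableAtFilter isOpen_Ioi y hy) (hcont y hy)
  refine (h1.const_sub (incGamma a 1)).congr_of_eventuallyEq ?_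
  filter_upwards [lt_mem_nhds hy] with t ht using incGamma_eq a ht

lemma tendsto_incGamma (a : ℝ) : Filter.Tendsto (incGamma a) Filter.atTop (𝓝 0) := by
  have h1 := MeasureTheory.intervalIntegral_tendsto_integral_Ioi (1 : ℝ) (integrableOn_incGamma a one_pos)
    Filter.tendsto_id
  have h2 := h1.const_sub (incGamma a 1)
  rw [← incGamma, sub_self] at h2
  refine h2.congr' ?_
  filter_upwards [Filter.eventually_gt_atTop 0] with y hy using (incGamma_eq a hy).symm

lemma hasDerivAt_incGamma_mul (k : ℤ) {l y : ℝ} (hl : 0 < l) (hy : 0 < y) :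
    HasDerivAt (fun y => (incGamma (1 / 2 - k) (l * y) : ℂ))
      (-(l ^ (1 / 2 - k : ℝ) * ode (k + 1 / 2) (-l) y : ℝ)) y := by
  have h1 : HasDerivAt (fun y => incGamma (1 / 2 - k) (l * y))
      (-(Real.exp (-(l * y)) * (l * y) ^ (1 / 2 - k - 1 : ℝ)) * (l * 1)) y :=
    (hasDerivAt_incGamma (1 / 2 - k) (mul_pos hl hy)).comp y ((hasDerivAt_id y).const_mul l)
  have h2 := h1.ofReal_comp
  refine h2.congr_deriv ?_
  rw [ode, Real.mul_rpow hl.le hy.le, Real.rpow_sub_one hl.ne', show (1 / 2 - k - 1 : ℝ) = -(k + 1 / 2) by ring,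
    neg_mul l]
  rw [← Complex.ofReal_neg]
  congr 1
  field_simp

/-- For n ≥ 0 growth forces C = 0 and the coefficient is constant. For n < 0 the derivative is a
multiple of that of the incomplete Gamma function; the constant left over is p, since the error and
the Gamma term both tend to 0. -/
lemma exists_coeff {k n : ℤ} {ε K A : ℝ} {b : ℝ → ℂ} {C p : ℂ} (hε : 0 < ε)
    (hb : ∀ y, 0 < y → HasDerivAt b (C * ode (k + 1 / 2) (4 * Real.pi * n) y) y)
    (hK : ∀ y, A ≤ y → ‖b y - p‖ ≤ K * Real.exp ((2 * Real.pi * n - ε) * y)) :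
    ∃ cp cm : ℂ, (∀ y, 0 < y →
        b y = cp + cm * (incGamma (1 / 2 - k) (4 * Real.pi * |(n : ℝ)| * y) : ℂ)) ∧
      (0 ≤ n → cm = 0) ∧ (n < 0 → cp = p) ∧ ((∀ y, 0 < y → b y = 0) → cp = 0 ∧ cm = 0) := by
  have hpi := Real.pi_pos
  rcases le_or_gt 0 n with hn | hn
  · have hn' : (0 : ℝ) ≤ n := by exact_mod_cast hn
    have hC : C = 0 := eq_zero_of_hasDerivAt_ode (l := 4 * Real.pi * n) (by positivity) hε hb
      fun y hy => (hK y hy).trans_eq (by ring_nf)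
    obtain ⟨c, hc⟩ := eq_const_of_hasDerivAt_zero fun y hy =>
      (hb y hy).congr_deriv (by rw [hC, zero_mul])
    refine ⟨c, 0, fun y hy => by rw [hc y hy, zero_mul, add_zero], fun _ => rfl,
      fun h => absurd hn (not_le.2 h), fun h => ⟨?_, rfl⟩⟩
    rw [← hc 1 one_pos, h 1 one_pos]
  · have hn' : (n : ℝ) < 0 := by exact_mod_cast hn
    set l : ℝ := 4 * Real.pi * |(n : ℝ)| with hl
    have hl' : 4 * Real.pi * n = -l := by rw [hl, abs_of_neg hn']; ring
    have hl0 : 0 < l := by have := abs_pos.2 hn'.ne; rw [hl]; positivity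
    have hL : ((l ^ (1 / 2 - k : ℝ) : ℝ) : ℂ) ≠ 0 := by
      exact_mod_cast (Real.rpow_pos_of_pos hl0 _).ne'
    rw [hl'] at hb
    -- The derivative of Γ(1/2 - k, ly) is -l^(1/2 - k) y^(-κ) e^(-ly), so this multiple of it
    -- accounts for all of b'.
    set cm : ℂ := -(C / (l ^ (1 / 2 - k : ℝ) : ℝ)) with hcm
    obtain ⟨c, hc⟩ := eq_const_of_hasDerivAt_zero
      (b := fun y => b y - cm * (incGamma (1 / 2 - k) (l * y) : ℂ)) fun y hy => by
        refine ((hb y hy).sub ((hasDerivAt_incGamma_mul k hl0 hy).const_mul cm)).congr_deriv ?_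
        rw [hcm, Complex.ofReal_mul]
        linear_combination (-(ode (k + 1 / 2) (-l) y : ℂ)) * div_mul_cancel₀ C hL
    have hcp : c = p := by
      have h1 : Filter.Tendsto (fun y => b y - p) Filter.atTop (𝓝 0) := by
        refine squeeze_zero_norm' (Filter.eventually_atTop.2 ⟨A, hK⟩) ?_
        have h2 : 0 < -(2 * Real.pi * n - ε) := by nlinarith
        have := ((Real.tendsto_exp_neg_atTop_nhds_zero.comp
          (Filter.tendsto_id.const_mul_atTop h2)).const_mul K)
        rw [mul_zero] at this
        refine this.congr fun y => ?_
        simp only [Function.comp_apply, id]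
        ring_nf
      have h3 : Filter.Tendsto (fun y => cm * (incGamma (1 / 2 - k) (l * y) : ℂ)) Filter.atTop (𝓝 0) := by
        have h4 := (tendsto_incGamma (1 / 2 - k)).comp (Filter.tendsto_id.const_mul_atTop hl0)
        have h5 := ((Complex.continuous_ofReal.tendsto 0).comp h4).const_mul cm
        simpa [Function.comp_def] using! h5
      have h6 := h1.sub h3
      rw [sub_zero] at h6
      have h7 : Filter.Tendsto (fun _ : ℝ => c - p) Filter.atTop (𝓝 0) := by
        refine h6.congr' ?_
        filter_upwards [Filter.eventually_gt_atTop 0] with y hy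
        rw [← hc y hy]
        ring
      exact sub_eq_zero.1 (tendsto_nhds_unique tendsto_const_nhds h7)
    refine ⟨c, cm, fun y hy => by rw [← hc y hy]; ring, fun h => absurd h (not_le.2 hn), fun _ => hcp,
      fun h => ?_⟩
    have hC : C = 0 := by
      have h1 : HasDerivAt b 0 1 := (hasDerivAt_const (1 : ℝ) (0 : ℂ)).congr_of_eventuallyEq
        (by filter_upwards [lt_mem_nhds one_pos] with y hy using h y hy)
      have h2 := (hb 1 one_pos).unique h1
      exact (mul_eq_zero.1 h2).resolve_right (by exact_mod_cast (ode_pos _ _ one_pos).ne')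
    have hcm0 : cm = 0 := by rw [hcm, hC, zero_div, neg_zero]
    refine ⟨?_, hcm0⟩
    rw [← hc 1 one_pos, h 1 one_pos, hcm0, zero_mul, sub_zero]

/-! ### Fourier expansions -/

/-- Periodicity holds on all of ℂ, because `ofComplex` is constant off the upper half-plane; later
statements need no domain condition. -/
lemma comp_ofComplex_periodic {f : ℍ → ℂ} (hf : ∀ τ : ℍ, f (ModularGroup.T • τ) = f τ) (z : ℂ) :
    (f ∘ ofComplex) (z + 1) = (f ∘ ofComplex) z := by
  have him : (z + 1).im = z.im := by simp
  simp only [Function.comp_apply]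
  rcases lt_or_ge 0 z.im with hz | hz
  · rw [ofComplex_apply_of_im_pos hz, ← hf ⟨z, hz⟩, ofComplex_apply_of_im_pos (him ▸ hz)]
    congr 1
    ext
    rw [coe_T_smul]
  · rw [ofComplex_apply_of_im_nonpos hz, ofComplex_apply_of_im_nonpos (him ▸ hz)]

lemma coef_e_neg (n j : ℤ) {y : ℝ} (hy : 0 < y) :
    coef n (fun z => e (-(j * z))) y = if n = -j then 1 else 0 := by
  split_ifs with h
  · have : ∀ x : ℝ, e (-(n * (x + y * Complex.I))) * e (-(j * (x + y * Complex.I))) = 1 := fun x => by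
      rw [← e_add, ← e_zero, h]
      congr 1
      push_cast
      ring
    rw [coef, mean]
    simp only [this, intervalIntegral.integral_const, sub_zero, one_smul]
  · have h1 := coef_dx (smoothOnH_e_neg j) (e_neg_periodic j) n hy
    have h2 : coef n (dx fun z => e (-(j * z))) y =
        coef n (fun z => (-(2 * Real.pi * Complex.I * j)) * e (-(j * z))) y :=
      coef_congr fun x => by
        rw [dx, (hasFDerivAt_e_neg j _).fderiv]
        simp [mul_comm]
    rw [h2, coef_const_mul] at h1
    have h3 : (2 * Real.pi * Complex.I * (n + j)) * coef n (fun z => e (-(j * z))) y = 0 := by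
      linear_combination -h1
    refine (mul_eq_zero.1 h3).resolve_left (mul_ne_zero Complex.two_pi_I_ne_zero fun h4 => h ?_)
    exact eq_neg_of_add_eq_zero_left (by exact_mod_cast h4)

lemma coef_finset_sum {ι : Type*} (s : Finset ι) (n : ℤ) {g : ι → ℂ → ℂ} (hg : ∀ i ∈ s, SmoothOnH (g i))
    {y : ℝ} (hy : 0 < y) : coef n (fun z => ∑ i ∈ s, g i z) y = ∑ i ∈ s, coef n (g i) y := by
  simp only [coef, mean, Finset.mul_sum]
  exact intervalIntegral.integral_finsetSum fun i hi =>
    (((hg i hi).e_neg_mul n).continuous_horizontal hy).intervalIntegrable _ _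

lemma norm_e (z : ℂ) : ‖e z‖ = Real.exp (-(2 * Real.pi * z.im)) := by
  rw [e, Complex.norm_exp]
  simp

lemma norm_coef_le {g : ℂ → ℂ} {y K : ℝ} (n : ℤ) (hK : ∀ x : ℝ, ‖g (x + y * Complex.I)‖ ≤ K) :
    ‖coef n g y‖ ≤ Real.exp (2 * Real.pi * n * y) * K := by
  have h := intervalIntegral.norm_integral_le_of_norm_le_const (a := 0) (b := 1)
    (f := fun x : ℝ => e (-(n * (x + y * Complex.I))) * g (x + y * Complex.I))
    (C := Real.exp (2 * Real.pi * n * y) * K) fun x _ => by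
      rw [norm_mul, norm_e]
      refine mul_le_mul (le_of_eq ?_) (hK x) (norm_nonneg _) (Real.exp_pos _).le
      congr 1
      simp
      ring
  rwa [sub_zero, abs_one, mul_one] at h

/-- The principal part contributes exactly its coefficient at n, and the remainder O(e^(-εy)) is
amplified by |e(-nz)| = e^(2πny). The constants do not depend on n. -/
lemma exists_coef_bound {f : ℍ → ℂ} (hf : IsSmooth f)
    (hP : HasPrincipalPart (Set.range fun n : ℤ => (n : ℝ)) f) :
    ∃ (p : ℝ →₀ ℂ) (ε K A : ℝ), 0 < ε ∧ ∀ (n : ℤ) (y : ℝ), A ≤ y →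
      ‖coef n (f ∘ ofComplex) y - p n‖ ≤ K * Real.exp ((2 * Real.pi * n - ε) * y) := by
  obtain ⟨P, hPs, ε, hε, hO⟩ := hP
  obtain ⟨K, hK⟩ := hO.bound
  obtain ⟨A, hA⟩ := (atImInfty_mem _).1 hK
  refine ⟨P, ε, K, max A 1, hε, fun n y hy => ?_⟩
  have hy0 : 0 < y := lt_of_lt_of_le one_pos ((le_max_right A 1).trans hy)
  have hyA : A ≤ y := (le_max_left A 1).trans hy
  have hint : ∀ r ∈ P.support, ∃ j : ℤ, r = ((-j : ℤ) : ℝ) := fun r hr => by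
    obtain ⟨j, hj⟩ := (hPs r hr).1
    exact ⟨-j, by rw [neg_neg]; exact hj.symm⟩
  have hsm : ∀ r ∈ P.support, SmoothOnH fun z => P r * e (r * z) := fun r hr => by
    obtain ⟨j, rfl⟩ := hint r hr
    convert (smoothOnH_e_neg j).const_mul (P ((-j : ℤ) : ℝ)) using 4
    push_cast
    ring
  have hsum : coef n (fun z => ∑ r ∈ P.support, P r * e (r * z)) y = P n := by
    rw [coef_finset_sum _ n hsm hy0]
    have : ∀ r ∈ P.support, coef n (fun z => P r * e (r * z)) y = if r = (n : ℝ) then P r else 0 := by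
      intro r hr
      obtain ⟨j, rfl⟩ := hint r hr
      have h1 : (fun z => P ((-j : ℤ) : ℝ) * e ((((-j : ℤ) : ℝ) : ℂ) * z)) =
          fun z => P ((-j : ℤ) : ℝ) * e (-(j * z)) := by
        funext z
        congr 2
        push_cast
        ring
      rw [h1, coef_const_mul, coef_e_neg n j hy0, mul_ite, mul_one, mul_zero]
      refine if_congr ?_ rfl rfl
      rw [Int.cast_inj, eq_comm]
    rw [Finset.sum_congr rfl this, Finset.sum_ite_eq' P.support (n : ℝ)]
    split_ifs with h
    · rfl
    · exact (Finsupp.notMem_support_iff.1 h).symm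
  have hsmooth : SmoothOnH fun z => -1 * ∑ r ∈ P.support, P r * e (r * z) :=
    SmoothOnH.const_mul _ fun z hz => ContDiffAt.sum fun r hr => hsm r hr z hz
  have hdiff : coef n (f ∘ ofComplex) y - P n = coef n (fun z => (f ∘ ofComplex) z +
      -1 * ∑ r ∈ P.support, P r * e (r * z)) y := by
    rw [coef_add n hf.smoothOnH hsmooth hy0, coef_const_mul, hsum]
    ring
  rw [hdiff]
  refine (norm_coef_le n (K := K * Real.exp (-ε * y)) fun x => ?_).trans_eq ?_
  · have hz : 0 < (x + y * Complex.I : ℂ).im := by rwa [im_add_mul_I]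
    have him : (⟨x + y * Complex.I, hz⟩ : ℍ).im = y := im_add_mul_I x y
    have h1 := hA ⟨x + y * Complex.I, hz⟩ (by rwa [him])
    rw [Set.mem_ofPred_eq, him, Real.norm_of_nonneg (Real.exp_pos _).le] at h1
    refine le_trans (le_of_eq ?_) h1
    rw [Function.comp_apply, ofComplex_apply_of_im_pos hz, neg_one_mul, ← sub_eq_add_neg]
    rfl
  · rw [mul_left_comm, ← Real.exp_add]
    ring_nf

/-- Two integrations by parts at fixed height gain the factor 1/n². -/
lemma norm_coef_mul_e_le {g : ℂ → ℂ} (hg : SmoothOnH g) (hper : ∀ z, g (z + 1) = g z) {y : ℝ}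
    (hy : 0 < y) : ∃ M : ℝ, ∀ n : ℤ, n ≠ 0 →
      ‖coef n g y * e (n * (y * Complex.I))‖ ≤ M * (1 / (n : ℝ) ^ 2) := by
  obtain ⟨M, hM⟩ := isCompact_uIcc.exists_bound_of_continuousOn
    ((hg.dx.dx.continuous_horizontal hy).continuousOn (s := Set.uIcc (0 : ℝ) 1))
  refine ⟨M, fun n hn => ?_⟩
  have h1 : coef n (dx (dx g)) y = (2 * Real.pi * Complex.I * n) ^ 2 * coef n g y := by
    rw [coef_dx hg.dx (fun z => fderiv_periodic hper 1 z) n hy, coef_dx hg hper n hy]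
    ring
  have h2 : ‖coef n (dx (dx g)) y‖ ≤ Real.exp (2 * Real.pi * n * y) * M := by
    have h := intervalIntegral.norm_integral_le_of_norm_le_const (a := 0) (b := 1)
      (f := fun x : ℝ => e (-(n * (x + y * Complex.I))) * dx (dx g) (x + y * Complex.I))
      (C := Real.exp (2 * Real.pi * n * y) * M) fun x hx => by
        rw [norm_mul, norm_e]
        refine mul_le_mul (le_of_eq ?_) (hM x (Set.uIoc_subset_uIcc hx)) (norm_nonneg _)
          (Real.exp_pos _).le
        congr 1
        simp
        ring
    rwa [sub_zero, abs_one, mul_one] at h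
  rw [h1, norm_mul] at h2
  have hn' : (0 : ℝ) < (n : ℝ) ^ 2 := by positivity
  have h3 : ‖(2 * Real.pi * Complex.I * n : ℂ) ^ 2‖ = 4 * Real.pi ^ 2 * (n : ℝ) ^ 2 := by
    rw [norm_pow]
    simp only [norm_mul, Complex.norm_ofNat, Complex.norm_real, Complex.norm_I, Complex.norm_intCast,
      Real.norm_of_nonneg Real.pi_pos.le]
    rw [mul_pow, sq_abs]
    ring
  have h4 : ‖e (n * (y * Complex.I))‖ = (Real.exp (2 * Real.pi * n * y))⁻¹ := by
    rw [norm_e, ← Real.exp_neg]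
    congr 1
    simp
    ring
  rw [norm_mul, h4, ← div_eq_mul_inv, div_le_iff₀ (Real.exp_pos _), mul_one_div, div_mul_eq_mul_div,
    le_div_iff₀ hn']
  rw [h3] at h2
  have h5 : (1 : ℝ) ≤ 4 * Real.pi ^ 2 := by nlinarith [Real.pi_gt_three]
  have h6 : 0 ≤ ‖coef n g y‖ * (n : ℝ) ^ 2 := by positivity
  nlinarith

/-- At fixed y this is the Fourier series of a continuous function on the circle, whose coefficients
are summable by the 1/n² bound. -/
lemma hasSum_coef {g : ℂ → ℂ} (hg : SmoothOnH g) (hper : ∀ z, g (z + 1) = g z) (x : ℝ) {y : ℝ}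
    (hy : 0 < y) : HasSum (fun n : ℤ => coef n g y * e (n * (x + y * Complex.I)))
      (g (x + y * Complex.I)) := by
  have hp : Function.Periodic (fun x : ℝ => g (x + y * Complex.I)) 1 := fun x => by
    refine Eq.trans (congrArg g ?_) (hper (x + y * Complex.I))
    push_cast
    ring
  let G : C(AddCircle (1 : ℝ), ℂ) := ⟨hp.lift, continuous_coinduced_dom.2 (hg.continuous_horizontal hy)⟩
  have hG : ∀ n, fourierCoeff G n = coef n g y * e (n * (y * Complex.I)) := fun n => by
    rw [fourierCoeff_eq_intervalIntegral G n 0, coef, mean, ← intervalIntegral.integral_mul_const,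
      div_one, one_smul, zero_add]
    refine intervalIntegral.integral_congr fun x _ => ?_
    have h1 : G (x : AddCircle (1 : ℝ)) = g (x + y * Complex.I) := rfl
    have h2 : fourier (-n) (x : AddCircle (1 : ℝ)) = e (-(n * x)) := by
      rw [fourier_coe_apply, e]
      congr 1
      push_cast
      ring
    rw [h1, h2, smul_eq_mul, mul_right_comm, ← e_add]
    congr 2
    ring
  have hs : Summable (fourierCoeff G) := by
    obtain ⟨M, hM⟩ := norm_coef_mul_e_le hg hper hy
    refine Summable.of_norm_bounded_eventually
      ((Real.summable_one_div_int_pow.2 (one_lt_two)).mul_left M) ?_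
    filter_upwards [(Set.finite_singleton (0 : ℤ)).compl_mem_cofinite] with n hn
    rw [hG]
    exact hM n hn
  have := has_pointwise_sum_fourier_series_of_summable hs (x : AddCircle (1 : ℝ))
  refine hasSum_of_eq this fun n => ?_
  rw [hG, smul_eq_mul, fourier_coe_apply, mul_assoc]
  congr 1
  rw [e, e, ← Complex.exp_add]
  congr 1
  push_cast
  ring

/-- The last clause serves the plus condition, which is checked on the integrals `coef` rather than
on the expansion. -/
theorem exists_isFourierExpansion {k : ℤ} {f : ℍ → ℂ} (hf : f ∈ harmonicFunctions ((k : ℝ) + 1 / 2))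
    (hper : ∀ τ : ℍ, f (ModularGroup.T • τ) = f τ)
    (hP : HasPrincipalPart (Set.range fun n : ℤ => (n : ℝ)) f) :
    ∃ cp cm : ℤ → ℂ, IsFourierExpansion k f cp cm ∧
      ∀ n, (∀ y, 0 < y → coef n (f ∘ ofComplex) y = 0) → cp n = 0 ∧ cm n = 0 := by
  have hper' := comp_ofComplex_periodic hper
  have hg := hf.1.smoothOnH
  obtain ⟨p, ε, K, A, hε, hK⟩ := exists_coef_bound hf.1 hP
  have key : ∀ n : ℤ, ∃ cp cm : ℂ, (∀ y, 0 < y → coef n (f ∘ ofComplex) y =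
      cp + cm * (incGamma (1 / 2 - k) (4 * Real.pi * |(n : ℝ)| * y) : ℂ)) ∧
      (0 ≤ n → cm = 0) ∧ (n < 0 → cp = p n) ∧
      ((∀ y, 0 < y → coef n (f ∘ ofComplex) y = 0) → cp = 0 ∧ cm = 0) := fun n => by
    obtain ⟨C, hC⟩ := eq_const_mul_ode fun y hy => hasDerivAt_coef_of_harmonic hf hper' n hy
    refine exists_coeff (C := -Complex.I * C) hε (fun y hy => ?_) (hK n)
    refine (hasDerivAt_coef_dbar hg hper' n hy).congr_deriv ?_
    rw [hC y hy]
    ring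
  choose cp cm h1 h2 h3 h4 using key
  refine ⟨cp, cm, ⟨?_, h2, fun τ => ?_⟩, h4⟩
  -- For negative n the holomorphic coefficient is that of the principal part, which has finite
  -- support. The minimum with 0 keeps n in this range.
  · obtain ⟨B, hB⟩ := (p.support.finite_toSet).bddBelow
    refine ⟨min ⌊B⌋ 0, fun n hn => ?_⟩
    rw [h3 n (lt_of_lt_of_le hn (min_le_right _ _))]
    by_contra h
    have h5 : B ≤ n := hB (Finsupp.mem_support_iff.2 h)
    have h6 : ((⌊B⌋ : ℤ) : ℝ) ≤ n := (Int.floor_le B).trans h5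
    exact absurd (Int.cast_le.1 h6) (not_le.2 (lt_of_lt_of_le hn (min_le_left _ _)))
  · have h5 := hasSum_coef hg hper' τ.re τ.im_pos
    have h6 : (τ.re + τ.im * Complex.I : ℂ) = τ := Complex.re_add_im τ
    rw [h6, Function.comp_apply, ofComplex_apply] at h5
    refine hasSum_of_eq h5 fun n => ?_
    rw [coeffAt, h1 n τ.im τ.im_pos]

/-! ### From vector-valued to scalar-valued forms -/

section

variable {m : ℕ} [NeZero m] {k : ℤ} {F : ℍ → ZMod (2 * m) → ℂ}

/-- The function `τ ↦ ∑_γ F_γ(4mτ)`. -/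
def descend (F : ℍ → ZMod (2 * m) → ℂ) (τ : ℍ) : ℂ := ∑ γ, F (scale m τ) γ

lemma four_mul_pos (m : ℕ) [NeZero m] : (0 : ℝ) < 4 * m := by
  have : (0 : ℝ) < m := Nat.cast_pos.2 (NeZero.pos m)
  positivity

lemma scale_eq_affine (τ : ℍ) : scale m τ = affine (4 * m) 0 (four_mul_pos m) τ := by
  ext
  rw [coe_scale, coe_affine]
  push_cast
  ring

lemma descend_eq_sum (F : ℍ → ZMod (2 * m) → ℂ) :
    descend F = ∑ γ, (fun τ => F τ γ) ∘ affine (4 * m) 0 (four_mul_pos m) := by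
  funext τ
  rw [descend, Finset.sum_apply]
  simp only [Function.comp_apply, scale_eq_affine]

variable (m k) in
/-- The exponents in the component `F_γ` lie in `ℤ + (-1)^k γ²/4m`. -/
abbrev expShift (γ : ZMod (2 * m)) : ℝ := ((k.negOnePow : ℤ) : ℝ) * Q m γ

lemma four_mul_expShift (γ : ZMod (2 * m)) :
    4 * (m : ℝ) * expShift m k γ = (((k.negOnePow : ℤ) * (γ.val : ℤ) ^ 2 : ℤ) : ℝ) := by
  have := (four_mul_pos m).ne'
  rw [expShift, Q, mul_left_comm, mul_div_cancel₀ _ this]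
  push_cast
  rfl

namespace IsVectorForm

lemma map_T (hF : IsVectorForm m k (weilRepOf m k) (expShift m k) F) (τ : ℍ) (γ : ZMod (2 * m)) :
    F (ModularGroup.T • τ) γ = e (expShift m k γ) * F τ γ := by
  have h := congrFun (hF.transform Mp2Z.T τ) γ
  rw [weilRepOf_T, Pi.smul_apply, Matrix.mulVec_diagonal] at h
  refine h.trans ?_
  change (1 : ℂ) ^ (2 * k + 1) • _ = _
  rw [_root_.one_zpow, one_smul, expShift]
  push_cast
  rfl

lemma map_add_nat (hF : IsVectorForm m k (weilRepOf m k) (expShift m k) F) (j : ℕ) (τ : ℍ)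
    (γ : ZMod (2 * m)) : F (affine 1 j one_pos τ) γ = e (j * expShift m k γ) * F τ γ := by
  induction j with
  | zero =>
    have : affine 1 ((0 : ℕ) : ℝ) one_pos τ = τ := by
      ext
      rw [coe_affine]
      simp
    rw [this, Nat.cast_zero, zero_mul, e_zero, one_mul]
  | succ j ih =>
    have : affine 1 ((j + 1 : ℕ) : ℝ) one_pos τ = ModularGroup.T • affine 1 (j : ℝ) one_pos τ := by
      ext
      rw [coe_T_smul, coe_affine, coe_affine]
      push_cast
      ring
    rw [this, hF.map_T, ih, ← mul_assoc, ← e_add]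
    congr 2
    push_cast
    ring

/-- S² acts trivially on ℍ and sends γ to -γ with the scalar -(-1)^k i, which cancels against φ^(2κ)
= i^(2k + 1). This is why even k goes with ρ_L and odd k with its dual. -/
lemma map_neg (hF : IsVectorForm m k (weilRepOf m k) (expShift m k) F) (τ : ℍ) (γ : ZMod (2 * m)) :
    F τ (-γ) = F τ γ := by
  have h := congrFun (hF.transform (Mp2Z.S ^ 2) τ) γ
  rw [Mp2Z.S_sq_mat, Mp2Z.S_sq_phi, Pi.smul_apply, Matrix.mulVec, dotProduct] at h
  simp only [weilRepOf_S_sq, ite_mul, zero_mul, Finset.sum_ite_eq', Finset.mem_univ, if_true,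
    smul_eq_mul] at h
  have h1 : (-1 : SL(2, ℤ)) • τ = τ := by
    ext
    rw [coe_smul_eq]
    simp [autFactor]
  have h2 : Complex.I ^ (2 * k + 1) * -((k.negOnePow : ℤ) * Complex.I) = 1 := by
    have h3 : Complex.I ^ (2 * k + 1) = (-1) ^ k * Complex.I := by
      rw [_root_.zpow_add_one₀ Complex.I_ne_zero, _root_.zpow_mul, zpow_ofNat, Complex.I_sq]
    rw [h3]
    rcases negOnePow_cases k with ⟨hk, hs⟩ | ⟨hk, hs⟩
    · rw [hs, hk.neg_one_zpow]
      simp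
    · rw [hs, (Int.not_even_iff_odd.1 hk).neg_one_zpow]
      simp
  rw [h1, ← mul_assoc, h2, one_mul] at h
  exact h.symm

lemma mem_harmonicFunctions {ρ : Mp2Z →* Matrix (ZMod (2 * m)) (ZMod (2 * m)) ℂ}
    {q : ZMod (2 * m) → ℝ} (hF : IsVectorForm m k ρ q F) (γ : ZMod (2 * m)) :
    (fun τ => F τ γ) ∈ harmonicFunctions ((k : ℝ) + 1 / 2) :=
  ⟨hF.smooth γ, hF.harmonic γ⟩

/-- Translating τ by j multiplies F_δ by a character of j, so the average keeps only the δ with the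
same square as γ. These are ±γ, and evenness makes their sum s(γ)F_γ. -/
theorem avg_descend (hm : m = 1 ∨ m.Prime)
    (hF : IsVectorForm m k (weilRepOf m k) (expShift m k) F) : avg m k (descend F) = F := by
  have hm0 : (m : ℂ) ≠ 0 := m_ne_zero m
  funext τ γ
  have h1 : ∀ j : ℕ, descend F (affine (1 / (4 * m)) (j / (4 * m)) (inv_four_mul_pos m) τ) =
      ∑ δ, e (j * expShift m k δ) * F τ δ := fun j => by
    have : scale m (affine (1 / (4 * m)) (j / (4 * m)) (inv_four_mul_pos m) τ) =
        affine 1 j one_pos τ := by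
      ext
      rw [coe_scale, coe_affine, coe_affine]
      push_cast
      field_simp
    simp only [descend, this, hF.map_add_nat]
  have h2 : ∀ (j : ℕ) (δ : ZMod (2 * m)),
      e (-(j * ((k.negOnePow : ℤ) * (γ.val : ℂ) ^ 2) / (4 * m))) * (e (j * expShift m k δ) * F τ δ) =
      e (j * (((k.negOnePow : ℤ) * ((δ.val : ℤ) ^ 2 - (γ.val : ℤ) ^ 2) : ℤ) : ℂ) / (4 * m : ℕ)) *
        F τ δ := fun j δ => by
    rw [← mul_assoc, ← e_add, expShift, Q]
    congr 2
    push_cast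
    field_simp
    ring
  have h3 : ∀ δ : ZMod (2 * m),
      ((4 * m : ℕ) : ℤ) ∣ (k.negOnePow : ℤ) * ((δ.val : ℤ) ^ 2 - (γ.val : ℤ) ^ 2) ↔
      sqMod m δ = sqMod m γ := fun δ => by
    rw [(Units.isUnit k.negOnePow).dvd_mul_left, ← ZMod.intCast_zmod_eq_zero_iff_dvd, Int.cast_sub, sub_eq_zero]
    simp [sqMod]
  have h4 : avg m k (descend F) τ γ = 1 / (4 * m * sFactor m γ) *
      ∑ δ, 4 * m * (if sqMod m δ = sqMod m γ then F τ δ else 0) := by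
    change 1 / (4 * m * sFactor m γ) * ∑ j ∈ Finset.range (4 * m), _ * descend F _ = _
    simp only [h1, Finset.mul_sum, h2]
    rw [Finset.sum_comm]
    refine Finset.sum_congr rfl fun δ _ => ?_
    rw [← Finset.mul_sum, ← Finset.sum_mul, sum_range_e (by have := NeZero.pos m; omega)]
    simp only [h3]
    split_ifs
    · push_cast
      ring
    · ring
  rw [h4, ← Finset.mul_sum, sum_sqMod_eq hm (fun γ => hF.map_neg τ γ)]
  have := sFactor_ne_zero γ
  field_simp

lemma descend_transform (hF : IsVectorForm m k (weilRepOf m k) (expShift m k) F) {M : SL(2, ℤ)}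
    (hM : M ∈ CongruenceSubgroup.Gamma0 (4 * m)) (τ : ℍ) :
    descend F (M • τ) = (shimuraSymbol (M 1 0) (M 1 1) : ℂ) * epsilon (M 1 1) ^ (-(2 * k + 1)) *
      autFactor M τ ^ ((k : ℂ) + 1 / 2) * descend F τ := by
  have hd : (4 * m : ℤ) ∣ M 1 0 := by
    have := (ZMod.intCast_zmod_eq_zero_iff_dvd _ _).1 (CongruenceSubgroup.Gamma0_mem.1 hM)
    exact_mod_cast this
  obtain ⟨M', h⟩ := exists_isScaleConj hd
  rw [descend, ← h.smul]
  have h1 := hF.transform (Mp2Z.principal M') (scale m τ)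
  change F (M' • scale m τ) = _ at h1
  rw [h1, sum_smul_mulVec_principal h, h.autFactor, cpow_add_half, descend]

lemma descend_mem_harmonicFunctions {ρ : Mp2Z →* Matrix (ZMod (2 * m)) (ZMod (2 * m)) ℂ}
    {q : ZMod (2 * m) → ℝ} (hF : IsVectorForm m k ρ q F) :
    descend F ∈ harmonicFunctions ((k : ℝ) + 1 / 2) := by
  rw [descend_eq_sum]
  exact Submodule.sum_mem _ fun γ _ =>
    comp_affine_mem_harmonicFunctions (hF.mem_harmonicFunctions γ) _ _ _

lemma hasPrincipalPart_descend (hF : IsVectorForm m k (weilRepOf m k) (expShift m k) F) :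
    HasPrincipalPart (Set.range fun n : ℤ => (n : ℝ)) (descend F) := by
  rw [descend_eq_sum]
  refine Submodule.sum_mem (principalFunctions _) fun γ _ =>
    ((hF.principalPart γ).comp_affine _ _ _).mono ?_
  rintro _ ⟨_, ⟨n, rfl⟩, rfl⟩
  refine ⟨4 * m * n + (k.negOnePow : ℤ) * (γ.val : ℤ) ^ 2, ?_⟩
  have := four_mul_expShift (k := k) γ
  simp only [mul_add, this]
  push_cast
  ring

end IsVectorForm

/-! ### Behaviour at the cusps -/

/-- This is diag(N, 1) g = h (A B; 0 D). The first column of the left side divided by its gcd A is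
primitive, and Bézout coefficients complete it to h. -/
lemma exists_upper_triangular {N : ℤ} (hN : 0 < N) (g : SL(2, ℤ)) :
    ∃ (h : SL(2, ℤ)) (A B D : ℤ), 0 < A ∧ 0 < D ∧ h 0 0 * A = N * g 0 0 ∧ h 1 0 * A = g 1 0 ∧
      h 0 0 * B + h 0 1 * D = N * g 0 1 ∧ h 1 0 * B + h 1 1 * D = g 1 1 := by
  have hdet := g.det_coe
  rw [Matrix.det_fin_two] at hdet
  have hne : Int.gcd (N * g 0 0) (g 1 0) ≠ 0 := by
    intro h0
    rw [Int.gcd_eq_zero_iff] at h0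
    have h1 : g 0 0 = 0 := (mul_eq_zero.1 h0.1).resolve_left hN.ne'
    rw [h1, h0.2] at hdet
    simp at hdet
  set A : ℤ := (Int.gcd (N * g 0 0) (g 1 0) : ℤ) with hA
  have hA0 : 0 < A := by positivity
  obtain ⟨p, hp⟩ : A ∣ N * g 0 0 := Int.gcd_dvd_left _ _
  obtain ⟨q, hq⟩ : A ∣ g 1 0 := Int.gcd_dvd_right _ _
  have hbez := Int.gcd_eq_gcd_ab (N * g 0 0) (g 1 0)
  set s := Int.gcdA (N * g 0 0) (g 1 0)
  set r := Int.gcdB (N * g 0 0) (g 1 0)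
  have hps : p * s + q * r = 1 := by
    refine mul_left_cancel₀ hA0.ne' ?_
    rw [← hA] at hbez
    linear_combination -hbez - s * hp - r * hq
  have hAD : A * (p * g 1 1 - q * (N * g 0 1)) = N := by
    linear_combination N * hdet - g 1 1 * hp + (N * g 0 1) * hq
  refine ⟨⟨!![p, -r; q, s], ?_⟩, A, s * (N * g 0 1) + r * g 1 1, p * g 1 1 - q * (N * g 0 1), hA0, ?_,
    ?_, ?_, ?_, ?_⟩
  · rw [Matrix.det_fin_two]
    simp only [Matrix.of_apply, Matrix.cons_val', Matrix.cons_val_zero, Matrix.cons_val_one,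
      Matrix.cons_val_fin_one]
    linear_combination hps
  · exact pos_of_mul_pos_right (hN.trans_eq hAD.symm) hA0.le
  · simp only [Matrix.of_apply, Matrix.cons_val', Matrix.cons_val_zero, Matrix.cons_val_fin_one]
    linear_combination -hp
  · simp only [Matrix.of_apply, Matrix.cons_val', Matrix.cons_val_zero, Matrix.cons_val_one,
      Matrix.cons_val_fin_one]
    linear_combination -hq
  · simp only [Matrix.of_apply, Matrix.cons_val', Matrix.cons_val_zero, Matrix.cons_val_one,
      Matrix.cons_val_fin_one]
    linear_combination (N * g 0 1) * hps
  · simp only [Matrix.of_apply, Matrix.cons_val', Matrix.cons_val_zero, Matrix.cons_val_one,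
      Matrix.cons_val_fin_one]
    linear_combination g 1 1 * hps

lemma ofReal_mul_cpow {r : ℝ} (hr : 0 < r) {x : ℂ} (hx : x ≠ 0) (s : ℂ) :
    (r * x) ^ s = (r : ℂ) ^ s * x ^ s := by
  have hr' : (r : ℂ) ≠ 0 := by exact_mod_cast hr.ne'
  rw [Complex.cpow_def_of_ne_zero (mul_ne_zero hr' hx), Complex.cpow_def_of_ne_zero hr',
    Complex.cpow_def_of_ne_zero hx, ← Complex.exp_add, Complex.log_ofReal_mul hr hx,
    Complex.ofReal_log hr.le, add_mul]

/-- Since 4m·gτ = h(Aτ + B)/D, applying F's transformation law under h expresses f at the cusp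
through the expansions of the F_δ at ∞. The automorphy factors of g and h differ by the positive
constant D, which is harmless for principal powers. -/
lemma IsVectorForm.hasPrincipalPart_cusp (hF : IsVectorForm m k (weilRepOf m k) (expShift m k) F)
    (g : SL(2, ℤ)) : HasPrincipalPart (Set.range fun r : ℚ => (r : ℝ))
      fun τ => autFactor g τ ^ (-((k : ℂ) + 1 / 2)) * descend F (g • τ) := by
  have hN : (0 : ℤ) < 4 * m := by have := NeZero.pos m; omega
  obtain ⟨h, A, B, D, hA, hD, h1, h2, h3, h4⟩ := exists_upper_triangular hN g
  have hA' : (0 : ℝ) < A := by exact_mod_cast hA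
  have hD' : (0 : ℝ) < D := by exact_mod_cast hD
  have hDC : (D : ℂ) ≠ 0 := by exact_mod_cast hD.ne'
  have h1' : (h 0 0 * A : ℂ) = 4 * m * g 0 0 := by exact_mod_cast h1
  have h2' : (h 1 0 * A : ℂ) = g 1 0 := by exact_mod_cast h2
  have h3' : (h 0 0 * B + h 0 1 * D : ℂ) = 4 * m * g 0 1 := by exact_mod_cast h3
  have h4' : (h 1 0 * B + h 1 1 * D : ℂ) = g 1 1 := by exact_mod_cast h4
  set w : ℍ → ℍ := affine (A / D) (B / D) (div_pos hA' hD') with hw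
  have hwc : ∀ τ, (w τ : ℂ) = A / D * τ + B / D := fun τ => by
    rw [hw, coe_affine]
    push_cast
    rfl
  have haut : ∀ τ, autFactor h (w τ) = ((D⁻¹ : ℝ) : ℂ) * autFactor g τ := fun τ => by
    rw [autFactor, autFactor, hwc, ← h2', ← h4']
    push_cast
    field_simp
    ring
  have hsm : ∀ τ, scale m (g • τ) = h • w τ := fun τ => by
    ext
    have hg := autFactor_ne_zero g τ
    rw [coe_scale, coe_smul_eq, coe_smul_eq, haut, hwc]
    push_cast
    field_simp
    linear_combination (-(τ : ℂ)) * h1' - h3'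
  set c : ℂ := (((D⁻¹ : ℝ) : ℂ) ^ (1 / 2 : ℂ)) ^ (2 * k + 1) with hc
  have hval : (fun τ => autFactor g τ ^ (-((k : ℂ) + 1 / 2)) * descend F (g • τ)) =
      ∑ γ, ∑ δ, (c * weilRepOf m k (Mp2Z.principal h) γ δ) • ((fun τ => F τ δ) ∘ w) := by
    funext τ
    have hg := autFactor_ne_zero g τ
    have h5 := hF.transform (Mp2Z.principal h) (w τ)
    change F (h • w τ) = (autFactor h (w τ) ^ (1 / 2 : ℂ)) ^ (2 * k + 1) • _ at h5
    rw [haut, ofReal_mul_cpow (inv_pos.2 hD') hg, _root_.mul_zpow, ← hc, ← cpow_add_half] at h5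
    have h6 : autFactor g τ ^ ((k : ℂ) + 1 / 2) ≠ 0 := by
      rw [Ne, Complex.cpow_eq_zero_iff]
      exact fun h => hg h.1
    rw [descend, hsm, h5, Complex.cpow_neg, Finset.mul_sum, Finset.sum_apply]
    refine Finset.sum_congr rfl fun γ _ => ?_
    rw [Finset.sum_apply, Pi.smul_apply, Matrix.mulVec, dotProduct, smul_eq_mul, Finset.mul_sum,
      Finset.mul_sum]
    refine Finset.sum_congr rfl fun δ _ => ?_
    simp only [Pi.smul_apply, Function.comp_apply, smul_eq_mul]
    rw [mul_comm c, mul_assoc, inv_mul_cancel_left₀ h6, mul_assoc]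
  rw [hval]
  refine Submodule.sum_mem (principalFunctions _) fun γ _ => Submodule.sum_mem _ fun δ _ =>
    Submodule.smul_mem _ _ (((hF.principalPart δ).comp_affine _ _ _).mono ?_)
  rintro _ ⟨_, ⟨n, rfl⟩, rfl⟩
  refine ⟨A / D * (n + (k.negOnePow : ℤ) * ((δ.val : ℚ) ^ 2 / (4 * m))), ?_⟩
  simp only [expShift, Q]
  push_cast
  ring

/-! ### The plus condition -/

/-- An integral over a full period is invariant under translation by t, but the integrand is
multiplied by a constant different from 1. -/
lemma coef_eq_zero_of_map_add {g : ℂ → ℂ} {n : ℤ} {y t : ℝ} {c : ℂ}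
    (hper : ∀ x : ℝ, g (x + y * Complex.I + 1) = g (x + y * Complex.I))
    (hg : ∀ x : ℝ, g (x + y * Complex.I + t) = c * g (x + y * Complex.I))
    (hc : e (-(n * t)) * c ≠ 1) : coef n g y = 0 := by
  set φ : ℝ → ℂ := fun x => e (-(n * (x + y * Complex.I))) * g (x + y * Complex.I) with hφ
  have h1 : Function.Periodic φ 1 := fun x => by
    have : ((x + 1 : ℝ) + y * Complex.I : ℂ) = x + y * Complex.I + 1 := by push_cast; ring
    simp only [hφ]
    rw [this, hper, e_neg_periodic]
  have h2 : ∀ x, φ (x + t) = e (-(n * t)) * c * φ x := fun x => by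
    have : ((x + t : ℝ) + y * Complex.I : ℂ) = x + y * Complex.I + t := by push_cast; ring
    simp only [hφ]
    rw [this, hg, mul_add, neg_add, e_add]
    ring
  have h3 : ∫ x in (0 : ℝ)..1, φ (x + t) = ∫ x in (0 : ℝ)..1, φ x := by
    rw [intervalIntegral.integral_comp_add_right, zero_add, add_comm 1 t,
      h1.intervalIntegral_add_eq t 0, zero_add]
  simp only [h2, intervalIntegral.integral_const_mul] at h3
  have h4 : (e (-(n * t)) * c - 1) * ∫ x in (0 : ℝ)..1, φ x = 0 := by linear_combination h3
  exact (mul_eq_zero.1 h4).resolve_left (sub_ne_zero.2 hc)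

lemma e_eq_one_iff (z : ℂ) : e z = 1 ↔ ∃ n : ℤ, z = n := by
  refine ⟨fun h => ?_, fun ⟨n, hn⟩ => hn ▸ e_int n⟩
  rw [e, Complex.exp_eq_one_iff] at h
  obtain ⟨n, hn⟩ := h
  exact ⟨n, mul_left_cancel₀ Complex.two_pi_I_ne_zero (by rw [hn]; ring)⟩

lemma comp_ofComplex_add {f : ℍ → ℂ} {z : ℂ} (hz : 0 < z.im) (t : ℝ) :
    (f ∘ ofComplex) (z + t) = f (affine 1 t one_pos ⟨z, hz⟩) := by
  have him : 0 < (z + t).im := by simpa using hz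
  rw [Function.comp_apply, ofComplex_apply_of_im_pos him]
  congr 1
  ext
  rw [coe_affine]
  simp

namespace IsVectorForm

/-- Under τ ↦ τ + 1/4m the function F_γ(4mτ) is multiplied by e((-1)^k γ²/4m), so it can only
contribute to n ≡ (-1)^k γ² mod 4m. -/
lemma coef_descend_eq_zero (hF : IsVectorForm m k (weilRepOf m k) (expShift m k) F) {n : ℤ}
    (hn : ¬ PlusCondition m k n) {y : ℝ} (hy : 0 < y) : coef n (descend F ∘ ofComplex) y = 0 := by
  have hm0 : (m : ℂ) ≠ 0 := m_ne_zero m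
  set f : ZMod (2 * m) → ℍ → ℂ := fun γ => (fun τ => F τ γ) ∘ affine (4 * m) 0 (four_mul_pos m) with hf
  have hsm : ∀ γ, SmoothOnH (f γ ∘ ofComplex) := fun γ =>
    ((hF.smooth γ).comp_affine _ _ _).smoothOnH
  have hsum : descend F ∘ ofComplex = fun z => ∑ γ, (f γ ∘ ofComplex) z := by
    funext z
    rw [descend_eq_sum, Function.comp_apply, Finset.sum_apply]
    rfl
  have hshift : ∀ (γ : ZMod (2 * m)) (j : ℕ) (x : ℝ),
      (f γ ∘ ofComplex) (x + y * Complex.I + ((j / (4 * m) : ℝ) : ℂ)) =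
        e (j * expShift m k γ) * (f γ ∘ ofComplex) (x + y * Complex.I) := fun γ j x => by
    have hz : 0 < (x + y * Complex.I : ℂ).im := by rwa [im_add_mul_I]
    rw [comp_ofComplex_add hz, Function.comp_apply, ofComplex_apply_of_im_pos hz]
    simp only [hf, Function.comp_apply]
    rw [← hF.map_add_nat]
    congr 1
    ext
    simp only [coe_affine]
    push_cast
    field_simp
    ring
  rw [hsum, coef_finset_sum _ n (fun γ _ => hsm γ) hy]
  refine Finset.sum_eq_zero fun γ _ => coef_eq_zero_of_map_add (t := ((1 : ℕ) / (4 * m) : ℝ)) (fun x => ?_)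
    (fun x => hshift γ 1 x) fun h => hn ?_
  · have h1 := hshift γ (4 * m) x
    have h2 : (((4 * m : ℕ) / (4 * m) : ℝ) : ℂ) = 1 := by push_cast; field_simp
    have h3 : (((4 * m : ℕ) : ℂ) * (expShift m k γ : ℝ)) =
        (((k.negOnePow : ℤ) * (γ.val : ℤ) ^ 2 : ℤ) : ℂ) := by
      have := four_mul_expShift (k := k) γ
      have h4 := congrArg (fun r : ℝ => (r : ℂ)) this
      push_cast at h4 ⊢
      exact h4
    rwa [h2, h3, e_int, one_mul] at h1
  · rw [← e_add, e_eq_one_iff] at h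
    obtain ⟨l, hl⟩ := h
    have h1 : (n : ℂ) - (k.negOnePow : ℤ) * (γ.val : ℂ) ^ 2 = 4 * m * -l := by
      rw [mul_neg, ← hl, expShift, Q]
      push_cast
      field_simp
      ring
    have h2 : n - (k.negOnePow : ℤ) * (γ.val : ℤ) ^ 2 = ((4 * m : ℕ) : ℤ) * -l := by
      exact_mod_cast h1
    exact ⟨γ.val, (sqCond_iff_dvd γ n).2 ⟨-l, h2⟩⟩

theorem descend_mem_plusSpace (hF : IsVectorForm m k (weilRepOf m k) (expShift m k) F) :
    descend F ∈ plusSpace m k := by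
  have hh := hF.descend_mem_harmonicFunctions
  have hper : ∀ τ : ℍ, descend F (ModularGroup.T • τ) = descend F τ := fun τ => by
    have : scale m (ModularGroup.T • τ) = affine 1 ((4 * m : ℕ) : ℝ) one_pos (scale m τ) := by
      ext
      rw [coe_scale, coe_T_smul, coe_affine, coe_scale]
      push_cast
      ring
    rw [descend, descend, this]
    refine Finset.sum_congr rfl fun γ _ => ?_
    have h4 := congrArg (fun r : ℝ => (r : ℂ)) (four_mul_expShift (k := k) γ)
    rw [hF.map_add_nat, show (((4 * m : ℕ) : ℂ) * (expShift m k γ : ℝ)) =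
      (((k.negOnePow : ℤ) * (γ.val : ℤ) ^ 2 : ℤ) : ℂ) by push_cast at h4 ⊢; exact h4, e_int, one_mul]
  obtain ⟨cp, cm, hc, hz⟩ := exists_isFourierExpansion hh hper hF.hasPrincipalPart_descend
  exact ⟨
    { smooth := hh.1
      transform := fun M hM τ => hF.descend_transform hM τ
      harmonic := hh.2
      principalPart := hF.hasPrincipalPart_descend
      principalPart_cusps := hF.hasPrincipalPart_cusp },
    cp, cm, hc, fun n hn => hz n fun y hy => hF.coef_descend_eq_zero hn hy⟩

end IsVectorForm

/-! ### The isomorphism -/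

/-- The isomorphism `f ↦ F` from the plus space onto the vector-valued forms. -/
def plusEquiv (hm : m = 1 ∨ m.Prime) :
    plusSpace m k ≃ₗ[ℂ] vectorForms m k (weilRepOf m k) (expShift m k) where
  toFun f := ⟨avg m k f.1, isVectorForm_avg hm f.2⟩
  map_add' f g := Subtype.ext (map_add (avg m k) f.1 g.1)
  map_smul' c f := Subtype.ext (map_smul (avg m k) c f.1)
  invFun F := ⟨descend F.1, IsVectorForm.descend_mem_plusSpace F.2⟩
  left_inv f := Subtype.ext (by
    obtain ⟨_, cp, cm, hc, hplus⟩ := f.2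
    funext τ
    exact sum_avg_scale hm hc hplus τ)
  right_inv F := Subtype.ext (IsVectorForm.avg_descend hm F.2)

theorem exists_plusSpace_equiv (hm : m = 1 ∨ m.Prime) {W : Submodule ℂ (ℍ → ZMod (2 * m) → ℂ)}
    (hW : W = vectorForms m k (weilRepOf m k) (expShift m k)) :
    ∃ Φ : plusSpace m k ≃ₗ[ℂ] W,
      (∀ (f : plusSpace m k) (cp cm : ℤ → ℂ), IsFourierExpansion k f cp cm →
        (Φ f : ℍ → ZMod (2 * m) → ℂ) = lift m k cp cm) ∧
      ∀ (F : W) (τ : ℍ), (Φ.symm F : ℍ → ℂ) τ = ∑ γ, F.1 (scale m τ) γ := by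
  subst hW
  exact ⟨plusEquiv hm, fun f cp cm hf => avg_eq_lift hf, fun F τ => rfl⟩

lemma weilForms_eq (hk : Even k) :
    weilForms m k = vectorForms m k (weilRepOf m k) (expShift m k) := by
  have : (k.negOnePow : ℤ) = 1 := by rw [Int.negOnePow_even k hk]; rfl
  rw [weilForms, weilRepOf, if_pos hk]
  congr 1
  funext γ
  rw [expShift, this, Int.cast_one, one_mul]

lemma dualWeilForms_eq (hk : Odd k) :
    dualWeilForms m k = vectorForms m k (weilRepOf m k) (expShift m k) := by
  have : (k.negOnePow : ℤ) = -1 := by rw [Int.negOnePow_odd k hk]; rfl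
  rw [dualWeilForms, weilRepOf, if_neg (Int.not_even_iff_odd.2 hk)]
  congr 1
  funext γ
  rw [expShift, this, Int.cast_neg, Int.cast_one, neg_one_mul]

end

end

end HalfMaass

theorem theorem1 (m : ℕ) [NeZero m] (hm : m = 1 ∨ m.Prime) (k : ℤ) :
    (Even k → ∃ Φ : HalfMaass.plusSpace m k ≃ₗ[ℂ] HalfMaass.weilForms m k,
      (∀ (f : HalfMaass.plusSpace m k) (cp cm : ℤ → ℂ),
        HalfMaass.IsFourierExpansion k f cp cm →
          (Φ f : UpperHalfPlane → ZMod (2 * m) → ℂ) = HalfMaass.lift m k cp cm) ∧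
      ∀ (F : HalfMaass.weilForms m k) (τ : UpperHalfPlane),
        (Φ.symm F : UpperHalfPlane → ℂ) τ = ∑ γ, F.1 (HalfMaass.scale m τ) γ) ∧
    (Odd k → ∃ Φ : HalfMaass.plusSpace m k ≃ₗ[ℂ] HalfMaass.dualWeilForms m k,
      (∀ (f : HalfMaass.plusSpace m k) (cp cm : ℤ → ℂ),
        HalfMaass.IsFourierExpansion k f cp cm →
          (Φ f : UpperHalfPlane → ZMod (2 * m) → ℂ) = HalfMaass.lift m k cp cm) ∧
      ∀ (F : HalfMaass.dualWeilForms m k) (τ : UpperHalfPlane),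
        (Φ.symm F : UpperHalfPlane → ℂ) τ = ∑ γ, F.1 (HalfMaass.scale m τ) γ) := by
  exact ⟨fun hk => HalfMaass.exists_plusSpace_equiv hm (HalfMaass.weilForms_eq hk),
    fun hk => HalfMaass.exists_plusSpace_equiv hm (HalfMaass.dualWeilForms_eq hk)⟩
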